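/- Let $G=\mathrm{SL}_2(\mathbb R)$ act on the upper half plane $\mathbb H=\{x+iy:y>0\}$ by fractional linear transformations, with the hyperbolic metric $y^{-1}\sqrt{dx^2+dy^2}$ and area $y^{-2}dx\,dy$. Put $n_x=\begin{pmatrix}1&x\\0&1\end{pmatrix}$, $N=\{n_x:x\in\mathbb R\}$ and $a_y=\begin{pmatrix}\sqrt y&0\\0&1/\sqrt y\end{pmatrix}$ for $y>0$, so that $n_xa_y(i)=x+iy$. Let $\Gamma<G$ be a finitely generated discrete subgroup such that the area of $\Gamma\backslash\mathbb H$ is infinite and whose critical exponent $\delta$ (the abscissa of convergence of $\sum_{\gamma\in\Gamma}e^{-s\,d(i,\gamma i)}$) satisfies $\delta>1/2$. Assume that the horocycle $(N\cap\Gamma)\backslash N$ is closed in $\Gamma\backslash G$ and infinite, i.e. $N\cap\Gamma$ is trivial. Let $\phi\in L^2(\Gamma\backslash\mathbb H)$ be a (classical, $C^2$) $\Gamma$-invariant eigenfunction of the hyperbolic Laplacian $\Delta=-y^2(\partial_{xx}+\partial_{yy})$ with eigenvalue $\lambda=s(1-s)<1/4$, where $s>1/2$. Then there are constants $C$, $x_0>0$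 and $0<y_0<1$, depending on $\Gamma$ and $\phi$, such that for all $x,y$ with $|x|>x_0$ and $0<y<y_0$, $$|\phi(n_xa_y(i))|\le C\left(\frac{y}{x^2+y^2}\right)^{s}.$$ -/

import Mathlib

open scoped MatrixGroups UpperHalfPlane

namespace HorocycleBound

/-- The unipotent matrix `n_x = (1 x; 0 1)`. -/
def nMat (x : ℝ) : SL(2, ℝ) :=
  ⟨!![1, x; 0, 1], by simp [Matrix.det_fin_two_of]⟩

theorem nMat_coe (x : ℝ) : (nMat x : Matrix (Fin 2) (Fin 2) ℝ) = !![1, x; 0, 1] := rfl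

/-- The diagonal matrix `a_y = (√y 0; 0 1/√y)`, for `y > 0`. -/
noncomputable def aMat (y : ℝ) (hy : 0 < y) : SL(2, ℝ) :=
  ⟨!![√y, 0; 0, 1 / √y], by
    have h : √y ≠ 0 := (Real.sqrt_pos.2 hy).ne'
    simp [Matrix.det_fin_two_of, h]⟩

/-- The horospherical subgroup `N = {n_x : x ∈ ℝ}` of `SL(2, ℝ)`. -/
def N : Subgroup SL(2, ℝ) where
  carrier := Set.range nMat
  mul_mem' := by
    rintro _ _ ⟨x, rfl⟩ ⟨y, rfl⟩
    refine ⟨x + y, Subtype.ext ?_⟩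
    rw [Matrix.SpecialLinearGroup.coe_mul, nMat_coe, nMat_coe, nMat_coe]
    simp [add_comm]
  one_mem' := by
    refine ⟨0, Subtype.ext ?_⟩
    rw [Matrix.SpecialLinearGroup.coe_one, nMat_coe, Matrix.one_fin_two]
  inv_mem' := by
    rintro _ ⟨x, rfl⟩
    refine ⟨-x, Subtype.ext ?_⟩
    rw [Matrix.SpecialLinearGroup.coe_inv, nMat_coe, nMat_coe, Matrix.adjugate_fin_two]
    simp

/-- The critical exponent of `Γ`: the abscissa of convergence of the Poincaré series
`∑_{γ ∈ Γ} exp (-s d(i, γ i))`, with `d` the hyperbolic distance. -/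
noncomputable def criticalExponent (Γ : Subgroup SL(2, ℝ)) : ℝ :=
  sInf {s : ℝ | 0 ≤ s ∧
    Summable fun γ : Γ ↦ Real.exp (-s * dist UpperHalfPlane.I ((γ : SL(2, ℝ)) • UpperHalfPlane.I))}

/-- The image of `N` in `Γ \ SL(2, ℝ)` (with the quotient topology) is closed. -/
def HorocycleClosed (Γ : Subgroup SL(2, ℝ)) : Prop :=
  IsClosed (Quotient.mk (MulAction.orbitRel Γ SL(2, ℝ)) '' (N : Set SL(2, ℝ)))

/-- The horocycle `(N ∩ Γ) \ N` is infinite, that is, a line and not a circle: `N ∩ Γ` is trivial. -/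
def HorocycleInfinite (Γ : Subgroup SL(2, ℝ)) : Prop :=
  N ⊓ Γ = ⊥

/-- The group of transformations of `ℍ` induced by `Γ`, i.e. the image of `Γ` in `PSL(2, ℝ)`.
It acts faithfully also when `-1 ∈ Γ`. -/
noncomputable def transformationGroup (Γ : Subgroup SL(2, ℝ)) : Subgroup (Equiv.Perm ℍ) :=
  Γ.map (MulAction.toPermHom SL(2, ℝ) ℍ)

/-- `F` is a (measurable) fundamental domain for the action of `Γ` on `ℍ`, with respect to the
hyperbolic area `dx dy / y ^ 2`. -/
def IsFundDomain (Γ : Subgroup SL(2, ℝ)) (F : Set ℍ) : Prop :=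
  MeasureTheory.IsFundamentalDomain (transformationGroup Γ) F MeasureTheory.volume

/-- The hyperbolic Laplace operator `-y² (∂²/∂x² + ∂²/∂y²)`. -/
noncomputable def hypLaplacian (φ : ℍ → ℂ) (z : ℍ) : ℂ :=
  -((z.im : ℂ) ^ 2) *
    Laplacian.laplacian (fun w : ℂ ↦ φ (UpperHalfPlane.ofComplex w)) (z : ℂ)

/-- `φ` is a `Γ`-invariant eigenfunction (of class `C²`) of the hyperbolic Laplace operator with
eigenvalue `l`. -/
structure IsEigenfunction (Γ : Subgroup SL(2, ℝ)) (φ : ℍ → ℂ) (l : ℝ) : Prop where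
  invariant : ∀ γ ∈ Γ, ∀ z : ℍ, φ (γ • z) = φ z
  contDiff : ContDiffOn ℝ 2 (fun w : ℂ ↦ φ (UpperHalfPlane.ofComplex w)) {w : ℂ | 0 < w.im}
  eigen : ∀ z : ℍ, hypLaplacian φ z = (l : ℂ) * φ z

end HorocycleBound

open scoped MatrixGroups UpperHalfPlane

namespace HorocycleBound

open Topology

/-! The heart of the matter is that infinity is not a limit point of Γ. Then some region |z| > R of
ℍ injects into Γ\ℍ, φ is square integrable on that region, and what remains is an elliptic decay
estimate in a half plane minus a half disc.

Group side (`exists_radius`). The bottom row (c, d) identifies N\G with the punctured plane, where a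
closed horocycle means that the orbit (0, 1)Γ is closed. By Baire it is discrete, hence locally
finite away from the origin. If it accumulated at the origin, Γ would contain a hyperbolic element;
renormalising short rows by its powers shows that all of Γ preserves its pair of fixed points, so Γ
is a finite union of cosets of a cyclic group and its exponent is at most 1/2. Hence the rows are
bounded below (`exists_le_norm_rowSet`), and Im γi = 1/(c² + d²) is bounded above. As N ∩ Γ is
trivial, the stabiliser of infinity is then contained in ±1.

Finite generation enters through plane topology (`exists_norm_smul_I_le`). A suitable neighbourhood
of the orbit of i is connected. If the orbit were unbounded, at bounded height, then in the disc
model the neighbourhood would miss the outer parts of infinitely many radii, ending at points γ⁻¹∞.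
Two of these radii and a transversal segment fence off an open set around a third endpoint γ⁻¹∞, so
no orbit point is close to it; applying γ, no orbit point is close to infinity, a contradiction. A
bounded orbit bounds the isometric circles uniformly (`exists_forall_lt_norm_imp_eq_one`), which
gives R.

Analytic side (`exists_abs_le_rpow`). Unfolding (`setLIntegral_le_of_precisely_invariant`) makes
f²/y² integrable on |z| > R for f the real or imaginary part of φ, and a local mean value inequality
bounds f on |z| ≥ 2R (`exists_abs_le_of_eigen`). The solution (y/|z|²)^s cannot serve for comparison
on the half circle |z| = 2R, because it vanishes at the two ends, where f is only known to be
bounded. Moving half of the pole to an end b = ±2R gives (y/(|z||z - b|))^s, a supersolution of the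
same decay; the sum over both ends is bounded below on the half circle.

The comparison (`le_of_le_on_circle`) has no pointwise boundary data at y = 0 or at infinity, only
the L² bound. A convex function Ψ of (f - H)/√y satisfies div(y∇Ψ) ≥ (1/4 - λ)Ψ/y with Ψ/y ≤ f²/y²
integrable. Testing against wide cutoffs forces Ψ = 0, because λ < 1/4 (`eq_zero_of_subsolution`).
-/

/-! ### Matrix entries, discreteness and distances from i -/

theorem SL2_det (g : SL(2, ℝ)) : g 0 0 * g 1 1 - g 0 1 * g 1 0 = 1 := by
  have := g.det_coe
  rwa [Matrix.det_fin_two] at this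

theorem SL2_mul_apply (g h : SL(2, ℝ)) (i j : Fin 2) :
    (g * h) i j = g i 0 * h 0 j + g i 1 * h 1 j := by
  simp [Matrix.mul_apply, Fin.sum_univ_two]

theorem SL2_inv_apply (g : SL(2, ℝ)) :
    g⁻¹ 0 0 = g 1 1 ∧ g⁻¹ 0 1 = -g 0 1 ∧ g⁻¹ 1 0 = -g 1 0 ∧ g⁻¹ 1 1 = g 0 0 := by
  simp [Matrix.SpecialLinearGroup.SL2_inv_expl]

theorem SL2_ext {g h : SL(2, ℝ)} (h00 : g 0 0 = h 0 0) (h01 : g 0 1 = h 0 1)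
    (h10 : g 1 0 = h 1 0) (h11 : g 1 1 = h 1 1) : g = h := by
  ext i j
  fin_cases i <;> fin_cases j <;> assumption

instance secondCountableTopology_SL2 : SecondCountableTopology SL(2, ℝ) :=
  have : SecondCountableTopology (Matrix (Fin 2) (Fin 2) ℝ) :=
    inferInstanceAs (SecondCountableTopology (Fin 2 → Fin 2 → ℝ))
  Matrix.SpecialLinearGroup.isClosedEmbedding_val.isEmbedding.secondCountableTopology

theorem countable_of_discrete (Γ : Subgroup SL(2, ℝ)) [DiscreteTopology Γ] : Countable Γ :=
  countable_of_Lindelof_of_discrete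

/-- A discrete subgroup has finitely many elements with bounded entries. -/
theorem finite_of_bounded_entries (Γ : Subgroup SL(2, ℝ)) [DiscreteTopology Γ] (M : ℝ) :
    {g : SL(2, ℝ) | g ∈ Γ ∧ ∀ i j, |g i j| ≤ M}.Finite := by
  have hK : IsCompact {A : Matrix (Fin 2) (Fin 2) ℝ | ∀ i j, A i j ∈ Set.Icc (-M) M} := by
    have h := isCompact_univ_pi (X := fun _ : Fin 2 ↦ Fin 2 → ℝ)
      (s := fun _ ↦ Set.univ.pi fun _ : Fin 2 ↦ Set.Icc (-M) M)
      (fun _ ↦ isCompact_univ_pi fun _ ↦ isCompact_Icc)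
    have h2 : (Set.univ.pi fun _ : Fin 2 ↦ Set.univ.pi fun _ : Fin 2 ↦ Set.Icc (-M) M) =
        {A : Matrix (Fin 2) (Fin 2) ℝ | ∀ i j, A i j ∈ Set.Icc (-M) M} := by
      ext A
      simp only [Set.mem_pi, Set.mem_univ, true_imp_iff]
      rfl
    exact h2 ▸ h
  have hK' := Matrix.SpecialLinearGroup.isClosedEmbedding_val.isCompact_preimage hK
  have hc := hK'.inter_left (Subgroup.isClosed_of_discrete (H := Γ))
  have hd : IsDiscrete (Γ : Set SL(2, ℝ)) := ⟨‹DiscreteTopology Γ›⟩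
  refine (hc.finite (hd.mono Set.inter_subset_left)).subset ?_
  rintro g ⟨hg, h⟩
  exact ⟨hg, fun i j ↦ abs_le.1 (h i j)⟩

theorem coe_smul_I (g : SL(2, ℝ)) :
    ((g • UpperHalfPlane.I : ℍ) : ℂ) =
      (g 0 0 * Complex.I + g 0 1) / (g 1 0 * Complex.I + g 1 1) := by
  rw [UpperHalfPlane.coe_specialLinearGroup_apply]; simp

theorem row_sq_pos (g : SL(2, ℝ)) : 0 < g 1 0 ^ 2 + g 1 1 ^ 2 := by
  have := SL2_det g
  by_contra h
  have h0 : g 1 0 = 0 := by nlinarith [sq_nonneg (g 1 0), sq_nonneg (g 1 1)]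
  have h1 : g 1 1 = 0 := by nlinarith [sq_nonneg (g 1 0), sq_nonneg (g 1 1)]
  simp [h0, h1] at this

theorem im_smul_I (g : SL(2, ℝ)) :
    (g • UpperHalfPlane.I : ℍ).im = 1 / (g 1 0 ^ 2 + g 1 1 ^ 2) := by
  rw [← UpperHalfPlane.coe_im, coe_smul_I, Complex.div_im]
  have h := SL2_det g
  simp only [Complex.normSq_apply, Complex.add_re, Complex.mul_re, Complex.ofReal_re, Complex.I_re,
    Complex.ofReal_im, Complex.I_im, Complex.add_im, Complex.mul_im]
  rw [← sub_div]
  congr 1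
  · linear_combination h
  · ring

theorem normSq_smul_I (g : SL(2, ℝ)) :
    Complex.normSq ((g • UpperHalfPlane.I : ℍ) : ℂ) =
      (g 0 0 ^ 2 + g 0 1 ^ 2) / (g 1 0 ^ 2 + g 1 1 ^ 2) := by
  rw [coe_smul_I, Complex.normSq_div]
  simp only [Complex.normSq_apply, Complex.add_re, Complex.mul_re, Complex.ofReal_re, Complex.I_re,
    Complex.ofReal_im, Complex.I_im, Complex.add_im, Complex.mul_im]
  ring_nf

theorem cosh_dist_I (z : ℍ) :
    Real.cosh (dist UpperHalfPlane.I z) = (Complex.normSq z + 1) / (2 * z.im) := by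
  rw [UpperHalfPlane.cosh_dist, Complex.dist_eq, ← Complex.normSq_eq_norm_sq]
  have := z.im_pos
  simp only [Complex.normSq_apply, UpperHalfPlane.coe_I, Complex.sub_re, Complex.sub_im,
    Complex.I_re, Complex.I_im, UpperHalfPlane.I_im, UpperHalfPlane.coe_re, UpperHalfPlane.coe_im]
  field_simp
  ring

theorem cosh_dist_smul_I (g : SL(2, ℝ)) :
    Real.cosh (dist UpperHalfPlane.I (g • UpperHalfPlane.I)) =
      (g 0 0 ^ 2 + g 0 1 ^ 2 + g 1 0 ^ 2 + g 1 1 ^ 2) / 2 := by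
  rw [cosh_dist_I, normSq_smul_I, im_smul_I]
  have := row_sq_pos g
  field_simp
  ring

/-! ### Closed horocycles and the orbit of bottom rows -/

/-- The orbit of the row vector `(0, 1)` under right multiplication by `Γ`. -/
def rowSet (Γ : Subgroup SL(2, ℝ)) : Set (ℝ × ℝ) :=
  {v | ∃ g ∈ Γ, v = (g 1 0, g 1 1)}

/-- Right multiplication of a row vector by a matrix. -/
def rowMul (v : ℝ × ℝ) (g : SL(2, ℝ)) : ℝ × ℝ :=
  (v.1 * g 0 0 + v.2 * g 1 0, v.1 * g 0 1 + v.2 * g 1 1)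

theorem continuous_rowMul (g : SL(2, ℝ)) : Continuous fun v ↦ rowMul v g := by
  unfold rowMul; fun_prop

theorem rowMul_mul (v : ℝ × ℝ) (g h : SL(2, ℝ)) : rowMul v (g * h) = rowMul (rowMul v g) h := by
  simp only [rowMul, SL2_mul_apply]; ext <;> ring

theorem rowMul_one (v : ℝ × ℝ) : rowMul v 1 = v := by
  simp [rowMul]

theorem rowMul_row (g h : SL(2, ℝ)) : rowMul (g 1 0, g 1 1) h = ((g * h) 1 0, (g * h) 1 1) := by
  simp only [rowMul, SL2_mul_apply]

theorem rowMul_mem_rowSet {Γ : Subgroup SL(2, ℝ)} {v : ℝ × ℝ} (hv : v ∈ rowSet Γ)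
    {g : SL(2, ℝ)} (hg : g ∈ Γ) : rowMul v g ∈ rowSet Γ := by
  obtain ⟨h, hh, rfl⟩ := hv
  exact ⟨h * g, Γ.mul_mem hh hg, rowMul_row _ _⟩

theorem rowSet_ne_zero {Γ : Subgroup SL(2, ℝ)} {v : ℝ × ℝ} (hv : v ∈ rowSet Γ) : v ≠ 0 := by
  rintro rfl
  obtain ⟨g, -, h⟩ := hv
  have h0 : 0 = g 1 0 := congrArg Prod.fst h
  have h1 : 0 = g 1 1 := congrArg Prod.snd h
  have := row_sq_pos g
  rw [← h0, ← h1] at this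
  simp at this

theorem sq_add_sq_pos_of_ne_zero {v : ℝ × ℝ} (hv : v ≠ 0) : 0 < v.1 ^ 2 + v.2 ^ 2 := by
  by_contra h
  exact hv (Prod.ext (by simp only [Prod.fst_zero]; nlinarith [sq_nonneg v.1, sq_nonneg v.2])
    (by simp only [Prod.snd_zero]; nlinarith [sq_nonneg v.1, sq_nonneg v.2]))

/-- A matrix of determinant one with prescribed bottom row. -/
noncomputable def rowSection (v : {v : ℝ × ℝ // v ≠ 0}) : SL(2, ℝ) :=
  ⟨!![v.1.2 / (v.1.1 ^ 2 + v.1.2 ^ 2), -v.1.1 / (v.1.1 ^ 2 + v.1.2 ^ 2); v.1.1, v.1.2], by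
    have := (sq_add_sq_pos_of_ne_zero v.2).ne'
    rw [Matrix.det_fin_two_of]
    field_simp
    ring⟩

theorem continuous_rowSection : Continuous rowSection := by
  refine continuous_induced_rng.2 (continuous_matrix fun i j ↦ ?_)
  have h : ∀ v : {v : ℝ × ℝ // v ≠ 0}, v.1.1 ^ 2 + v.1.2 ^ 2 ≠ 0 :=
    fun v ↦ (sq_add_sq_pos_of_ne_zero v.2).ne'
  fin_cases i <;> fin_cases j <;> simp only
  · exact Continuous.div (by fun_prop) (by fun_prop) h
  · exact Continuous.div (by fun_prop) (by fun_prop) h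
  · fun_prop
  · fun_prop

theorem nMat_apply (x : ℝ) :
    nMat x 0 0 = 1 ∧ nMat x 0 1 = x ∧ nMat x 1 0 = 0 ∧ nMat x 1 1 = 1 := by
  simp [nMat_coe]

theorem mem_N_iff (g : SL(2, ℝ)) : g ∈ N ↔ g 1 0 = 0 ∧ g 1 1 = 1 := by
  constructor
  · rintro ⟨x, rfl⟩
    exact (nMat_apply x).2.2
  · rintro ⟨h0, h1⟩
    have := SL2_det g
    rw [h0, h1] at this
    obtain ⟨n0, n1, n2, n3⟩ := nMat_apply (g 0 1)
    exact ⟨g 0 1, SL2_ext (by rw [n0]; linarith) n1 (by rw [n2, h0]) (by rw [n3, h1])⟩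

theorem isClosed_mul_N {Γ : Subgroup SL(2, ℝ)} (h : HorocycleClosed Γ) :
    IsClosed {g : SL(2, ℝ) | ∃ γ ∈ Γ, γ * g ∈ N} := by
  have hq := IsClosed.preimage (continuous_quotient_mk' (s := MulAction.orbitRel Γ SL(2, ℝ))) h
  convert hq using 1
  ext g
  simp only [Set.mem_ofPred_eq, Set.mem_preimage, Set.mem_image, SetLike.mem_coe]
  constructor
  · rintro ⟨γ, hγ, hn⟩
    exact ⟨γ * g, hn, Quotient.sound ⟨⟨γ, hγ⟩, rfl⟩⟩
  · rintro ⟨n, hn, he⟩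
    obtain ⟨γ, hγ⟩ := Quotient.exact he
    refine ⟨γ.1, γ.2, ?_⟩
    have : γ.1 * g = n := hγ
    rwa [this]

/-- Inverting the closed set ΓN gives NΓ, and `rowSection` is a continuous section of the projection
of G to N\G, the punctured plane; pulling back along it yields closedness there. The origin itself
may be a limit point, hence the set `D`. -/
theorem exists_isClosed_rowSet_eq {Γ : Subgroup SL(2, ℝ)} (h : HorocycleClosed Γ) :
    ∃ D : Set (ℝ × ℝ), IsClosed D ∧ rowSet Γ = D ∩ {0}ᶜ := by
  have h1 := (isClosed_mul_N h).preimage (continuous_inv.comp continuous_rowSection)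
  obtain ⟨D, hD, hD'⟩ := isClosed_induced_iff.1 h1
  refine ⟨D, hD, ?_⟩
  have key : ∀ v : {v : ℝ × ℝ // v ≠ 0}, v.1 ∈ D ↔ v.1 ∈ rowSet Γ := by
    intro v
    have h2 : v ∈ Subtype.val ⁻¹' D ↔ v.1 ∈ rowSet Γ := by
      rw [hD']
      simp only [Set.mem_preimage, Set.mem_ofPred_eq, Function.comp]
      have hs0 : rowSection v 1 0 = v.1.1 := by simp [rowSection]
      have hs1 : rowSection v 1 1 = v.1.2 := by simp [rowSection]
      constructor
      · rintro ⟨γ, hγ, hn⟩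
        have hn' := N.inv_mem hn
        rw [mul_inv_rev, inv_inv, mem_N_iff] at hn'
        refine ⟨γ, hγ, ?_⟩
        have e : rowSection v = (rowSection v * γ⁻¹) * γ := by group
        have e0 := SL2_mul_apply (rowSection v * γ⁻¹) γ 1 0
        have e1 := SL2_mul_apply (rowSection v * γ⁻¹) γ 1 1
        rw [← e, hn'.1, hn'.2] at e0 e1
        rw [hs0] at e0
        rw [hs1] at e1
        ext
        · simp [e0]
        · simp [e1]
      · rintro ⟨γ, hγ, hv⟩
        refine ⟨γ, hγ, ?_⟩
        rw [← N.inv_mem_iff, mul_inv_rev, inv_inv, mem_N_iff, SL2_mul_apply, SL2_mul_apply]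
        obtain ⟨i0, i1, i2, i3⟩ := SL2_inv_apply γ
        rw [i0, i1, i2, i3, hs0, hs1, hv]
        have := SL2_det γ
        constructor <;> simp only [] <;> linarith
    exact h2
  ext v
  constructor
  · intro hv
    exact ⟨(key ⟨v, rowSet_ne_zero hv⟩).2 hv, rowSet_ne_zero hv⟩
  · rintro ⟨hv, h0⟩
    exact (key ⟨v, h0⟩).1 hv

/-- A countable nonempty locally compact Hausdorff space has an isolated point by Baire. Γ acts
transitively on the rows by homeomorphisms, so every row is isolated. -/
theorem isDiscrete_rowSet {Γ : Subgroup SL(2, ℝ)} [DiscreteTopology Γ] (h : HorocycleClosed Γ) :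
    IsDiscrete (rowSet Γ) := by
  obtain ⟨D, hD, hS⟩ := exists_isClosed_rowSet_eq h
  have hlc : IsLocallyClosed (rowSet Γ) := by
    rw [hS]
    exact hD.isLocallyClosed.inter (isOpen_compl_singleton.isLocallyClosed)
  have := hlc.locallyCompactSpace
  have hne : Nonempty (rowSet Γ) := ⟨⟨_, 1, Γ.one_mem, rfl⟩⟩
  have hcount : Countable (rowSet Γ) := by
    have := countable_of_discrete Γ
    have hsur : Function.Surjective
        (fun γ : Γ ↦ (⟨(γ.1 1 0, γ.1 1 1), γ.1, γ.2, rfl⟩ : rowSet Γ)) := by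
      rintro ⟨_, g, hg, rfl⟩
      exact ⟨⟨g, hg⟩, rfl⟩
    exact hsur.countable
  obtain ⟨x, hx⟩ := nonempty_interior_of_iUnion_of_closed
    (f := fun x : rowSet Γ ↦ ({x} : Set (rowSet Γ))) (fun x ↦ isClosed_singleton)
    (Set.iUnion_of_singleton _)
  have hxo : IsOpen ({x} : Set (rowSet Γ)) := by
    rcases Set.subset_singleton_iff_eq.1 (interior_subset (s := ({x} : Set (rowSet Γ)))) with h | h
    · exact absurd h hx.ne_empty
    · exact h ▸ isOpen_interior
  obtain ⟨U, hU, hUx⟩ := isOpen_induced_iff.1 hxo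
  refine ⟨discreteTopology_iff_isOpen_singleton.2 fun y ↦ ?_⟩
  obtain ⟨⟨_, gx, hgx, rfl⟩, hx⟩ : {z : rowSet Γ // z = x} := ⟨x, rfl⟩
  obtain ⟨_, gy, hgy, rfl⟩ := y
  rw [isOpen_induced_iff]
  -- Right multiplication by this element carries the row of `gy` to the isolated row of `gx`.
  have hg : gy⁻¹ * gx ∈ Γ := Γ.mul_mem (Γ.inv_mem hgy) hgx
  refine ⟨(fun v ↦ rowMul v (gy⁻¹ * gx)) ⁻¹' U, hU.preimage (continuous_rowMul _), ?_⟩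
  have hyx : rowMul (gy 1 0, gy 1 1) (gy⁻¹ * gx) = (gx 1 0, gx 1 1) := by
    rw [rowMul_row, mul_inv_cancel_left]
  ext ⟨v, hv⟩
  simp only [Set.mem_preimage, Set.mem_singleton_iff]
  have hUm : ∀ w : rowSet Γ, w.1 ∈ U ↔ w = x := fun w ↦ by
    change w ∈ Subtype.val ⁻¹' U ↔ w = x
    rw [hUx]; rfl
  constructor
  · intro hvU
    have h1 := (hUm ⟨_, rowMul_mem_rowSet hv hg⟩).1 hvU
    rw [← hx] at h1
    have h2 : rowMul v (gy⁻¹ * gx) = (gx 1 0, gx 1 1) := congrArg Subtype.val h1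
    rw [← hyx] at h2
    have h3 := congrArg (fun w ↦ rowMul w (gy⁻¹ * gx)⁻¹) h2
    exact Subtype.ext (by simpa only [← rowMul_mul, mul_inv_cancel, rowMul_one] using h3)
  · intro h1
    have h2 : v = (gy 1 0, gy 1 1) := congrArg Subtype.val h1
    rw [h2, hyx]
    exact (hUm ⟨_, gx, hgx, rfl⟩).2 hx

/-- If the horocycle is closed, the bottom rows of `Γ` are locally finite away from the origin. -/
theorem finite_rowSet_annulus {Γ : Subgroup SL(2, ℝ)} [DiscreteTopology Γ]
    (h : HorocycleClosed Γ) {r : ℝ} (hr : 0 < r) (M : ℝ) :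
    {v ∈ rowSet Γ | r ≤ ‖v‖ ∧ ‖v‖ ≤ M}.Finite := by
  obtain ⟨D, hD, hS⟩ := exists_isClosed_rowSet_eq h
  have hK : IsCompact (Metric.closedBall (0 : ℝ × ℝ) M ∩ (Metric.ball 0 r)ᶜ) :=
    (isCompact_closedBall _ _).inter_right Metric.isOpen_ball.isClosed_compl
  have hK' := hK.inter_left hD
  have hsub : D ∩ (Metric.closedBall (0 : ℝ × ℝ) M ∩ (Metric.ball 0 r)ᶜ) =
      {v ∈ rowSet Γ | r ≤ ‖v‖ ∧ ‖v‖ ≤ M} := by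
    ext v
    simp only [hS, Set.mem_inter_iff, mem_closedBall_zero_iff, Set.mem_compl_iff,
      mem_ball_zero_iff, not_lt, Set.mem_singleton_iff, Set.mem_ofPred_eq]
    constructor
    · rintro ⟨h1, h2, h3⟩
      exact ⟨⟨h1, norm_pos_iff.1 (hr.trans_le h3)⟩, h3, h2⟩
    · rintro ⟨⟨h1, -⟩, h3, h2⟩
      exact ⟨h1, h2, h3⟩
  rw [hsub] at hK'
  exact hK'.finite ((isDiscrete_rowSet h).mono fun v hv ↦ hv.1)

/-! ### Accumulation of rows at the origin forces an elementary group -/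

/-- If the bottom rows of `Γ` accumulate at the origin, then `Γ` has a hyperbolic element. -/
theorem exists_two_lt_abs_trace {Γ : Subgroup SL(2, ℝ)}
    (h : ∀ r > 0, ∃ g ∈ Γ, |g 1 0| < r ∧ |g 1 1| < r) :
    ∃ g ∈ Γ, 2 < |g 0 0 + g 1 1| := by
  by_contra! hcon
  have hzero : ∀ g ∈ Γ, g 1 0 = 0 := by
    intro g hg
    by_contra hne
    have hpos : 0 < |g 1 0| := abs_pos.2 hne
    -- If γ has a tiny bottom row and |tr γ| ≤ 2, then its entry a is at most 3 and bc ≈ -1, so b is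
    -- huge. The term b · g₁₀ must then dominate tr(γg), which is also at most 2. `K` exceeds all
    -- the other contributions, and `ε` makes |b · g₁₀| at least `K`.
    set K := 2 + 3 * |g 0 0| + |g 0 1| + |g 1 1| with hK
    have hKpos : 0 < K := by positivity
    set ε := min (1 / 6) (|g 1 0| / (2 * K)) with hε
    have hεpos : 0 < ε := lt_min (by norm_num) (by positivity)
    have hε1 : ε ≤ 1 / 6 := min_le_left _ _
    have hε2 : ε * (2 * K) ≤ |g 1 0| := (le_div_iff₀ (by positivity)).1 (min_le_right _ _)
    obtain ⟨γ, hγ, hc, hd⟩ := h ε hεpos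
    have hdet := SL2_det γ
    have htr := hcon γ hγ
    have htr' := hcon (γ * g) (Γ.mul_mem hγ hg)
    rw [SL2_mul_apply, SL2_mul_apply] at htr'
    have ha : |γ 0 0| ≤ 3 := by
      have := abs_sub (γ 0 0 + γ 1 1) (γ 1 1)
      rw [add_sub_cancel_right] at this
      linarith
    have hbc : 1 / 2 ≤ |γ 0 1| * ε := by
      have h1 : |γ 0 0 * γ 1 1| ≤ 3 * ε := by
        rw [abs_mul]
        exact mul_le_mul ha hd.le (abs_nonneg _) (by norm_num)
      have h2 : |γ 0 1 * γ 1 0| ≤ |γ 0 1| * ε := by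
        rw [abs_mul]
        exact mul_le_mul_of_nonneg_left hc.le (abs_nonneg _)
      have h3 := abs_le.1 h1
      have h4 := abs_le.1 h2
      linarith
    have hb : K ≤ |γ 0 1| * |g 1 0| := by
      calc K ≤ (|γ 0 1| * ε) * (2 * K) := by nlinarith
        _ = |γ 0 1| * (ε * (2 * K)) := by ring
        _ ≤ _ := mul_le_mul_of_nonneg_left hε2 (abs_nonneg _)
    have h1 : |γ 0 1| * |g 1 0| ≤ 2 + |γ 0 0| * |g 0 0| + |γ 1 0| * |g 0 1| + |γ 1 1| * |g 1 1| := by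
      simp only [← abs_mul]
      have := abs_le.1 htr'
      rcases abs_cases (γ 0 1 * g 1 0) with h5 | h5 <;>
        linarith [neg_abs_le (γ 0 0 * g 0 0), neg_abs_le (γ 1 0 * g 0 1),
          neg_abs_le (γ 1 1 * g 1 1), le_abs_self (γ 0 0 * g 0 0), le_abs_self (γ 1 0 * g 0 1),
          le_abs_self (γ 1 1 * g 1 1)]
    have h2 : |γ 0 0| * |g 0 0| ≤ 3 * |g 0 0| := mul_le_mul_of_nonneg_right ha (abs_nonneg _)
    have h3 : |γ 1 0| * |g 0 1| ≤ (1 / 6) * |g 0 1| :=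
      mul_le_mul_of_nonneg_right (by linarith) (abs_nonneg _)
    have h4 : |γ 1 1| * |g 1 1| ≤ (1 / 6) * |g 1 1| :=
      mul_le_mul_of_nonneg_right (by linarith) (abs_nonneg _)
    have h5 : |g 0 1| = 0 := by linarith [abs_nonneg (g 0 1), abs_nonneg (g 1 1)]
    have h6 : |g 1 1| = 0 := by linarith [abs_nonneg (g 0 1), abs_nonneg (g 1 1)]
    have := SL2_det g
    rw [abs_eq_zero.1 h5, abs_eq_zero.1 h6] at this
    simp at this
  -- With every lower left entry zero, ad = 1, impossible for |a| ≤ 3 and |d| < 1/4.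
  obtain ⟨γ, hγ, -, hd⟩ := h (1 / 4) (by norm_num)
  have hdet := SL2_det γ
  have htr := hcon γ hγ
  rw [hzero γ hγ, mul_zero, sub_zero] at hdet
  have ha : |γ 0 0| ≤ 3 := by
    have := abs_sub (γ 0 0 + γ 1 1) (γ 1 1)
    rw [add_sub_cancel_right] at this
    linarith
  have h1 : |γ 0 0 * γ 1 1| ≤ 3 * (1 / 4) := by
    rw [abs_mul]
    exact mul_le_mul ha hd.le (abs_nonneg _) (by norm_num)
  rw [hdet] at h1
  norm_num at h1

/-- The diagonal matrix with entries `u` and `u⁻¹`. -/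
def diagMat (u : ℝˣ) : SL(2, ℝ) :=
  ⟨!![(u : ℝ), 0; 0, ((u⁻¹ : ℝˣ) : ℝ)], by simp [Matrix.det_fin_two_of]⟩

theorem diagMat_apply (u : ℝˣ) :
    diagMat u 0 0 = u ∧ diagMat u 0 1 = 0 ∧ diagMat u 1 0 = 0 ∧ diagMat u 1 1 = (u : ℝ)⁻¹ :=
  ⟨rfl, rfl, rfl, Units.val_inv_eq_inv_val u⟩

/-- The embedding of `ℝˣ` as the diagonal torus of `SL(2, ℝ)`. -/
def diagHom : ℝˣ →* SL(2, ℝ) where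
  toFun := diagMat
  map_one' := by
    obtain ⟨h0, h1, h2, h3⟩ := diagMat_apply 1
    refine SL2_ext ?_ ?_ ?_ ?_ <;> simp [h0, h1, h2, h3]
  map_mul' u v := by
    obtain ⟨h0, h1, h2, h3⟩ := diagMat_apply u
    obtain ⟨k0, k1, k2, k3⟩ := diagMat_apply v
    obtain ⟨l0, l1, l2, l3⟩ := diagMat_apply (u * v)
    refine SL2_ext ?_ ?_ ?_ ?_ <;>
      simp only [SL2_mul_apply, h0, h1, h2, h3, k0, k1, k2, k3, l0, l1, l2, l3, Units.val_mul,
        mul_inv] <;> ring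

theorem diagHom_apply (u : ℝˣ) :
    diagHom u 0 0 = u ∧ diagHom u 0 1 = 0 ∧ diagHom u 1 0 = 0 ∧ diagHom u 1 1 = (u : ℝ)⁻¹ :=
  diagMat_apply u

theorem rowMul_diagHom (v : ℝ × ℝ) (u : ℝˣ) : rowMul v (diagHom u) = (v.1 * u, v.2 * (u : ℝ)⁻¹) := by
  obtain ⟨h0, h1, h2, h3⟩ := diagHom_apply u
  simp [rowMul, h0, h1, h2, h3]

/-- For x ≠ 0 the numbers qⁿx are distinct, so the matrices carrying them would be infinitely many.
-/
theorem eq_zero_of_finite_of_geometric {X : Set SL(2, ℝ)} (hX : X.Finite) {f : ℕ → SL(2, ℝ)}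
    (hf : ∀ n, f n ∈ X) {i j : Fin 2} {q x : ℝ} (hq : 0 < q) (hq1 : q < 1)
    (h : ∀ n, f n i j = q ^ n * x) : x = 0 := by
  by_contra hx
  have hinj : Function.Injective f := by
    intro m n hmn
    have h1 := h m
    rw [hmn, h n] at h1
    have h2 := mul_right_cancel₀ hx h1
    exact ((pow_right_injective₀ hq hq1.ne) h2).symm
  exact Set.infinite_range_of_injective hinj (hX.subset (Set.range_subset_iff.2 hf))

theorem exists_abs_apply_le (g : SL(2, ℝ)) : ∃ M : ℝ, ∀ i j, |g i j| ≤ M :=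
  ⟨∑ i, ∑ j, |g i j|, fun i j ↦
    (Finset.single_le_sum (f := fun j ↦ |g i j|) (fun _ _ ↦ abs_nonneg _)
      (Finset.mem_univ j)).trans
    (Finset.single_le_sum (f := fun i ↦ ∑ j, |g i j|)
      (fun _ _ ↦ Finset.sum_nonneg fun _ _ ↦ abs_nonneg _) (Finset.mem_univ i))⟩

theorem diagHom_mul_mul_apply (u v : ℝˣ) (g : SL(2, ℝ)) (k l : Fin 2) :
    (diagHom u * g * diagHom v) k l = diagHom u k k * diagHom v l l * g k l := by
  obtain ⟨-, h1, h2, -⟩ := diagHom_apply u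
  obtain ⟨-, k1, k2, -⟩ := diagHom_apply v
  simp only [SL2_mul_apply]
  fin_cases k <;> fin_cases l <;> simp only [Fin.zero_eta, Fin.mk_one, h1, h2, k1, k2] <;> ring

/-- In a discrete group containing a hyperbolic diagonal matrix, the vanishing of an entry implies
the vanishing of the opposite entry. -/
theorem entry_eq_zero_of_opposite {Λ : Subgroup SL(2, ℝ)}
    (hΛ : ∀ M : ℝ, {g : SL(2, ℝ) | g ∈ Λ ∧ ∀ i j, |g i j| ≤ M}.Finite)
    {u : ℝˣ} (hu : 1 < (u : ℝ)) (hD : diagHom u ∈ Λ) {g : SL(2, ℝ)} (hg : g ∈ Λ) {i j : Fin 2}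
    (h : g (1 - i) (1 - j) = 0) : g i j = 0 := by
  have hupos : 0 < (u : ℝ) := by linarith
  have hq : 0 < ((u : ℝ) ^ 2)⁻¹ := by positivity
  have hq1 : ((u : ℝ) ^ 2)⁻¹ < 1 := inv_lt_one_of_one_lt₀ (by nlinarith)
  obtain ⟨M, hM⟩ := exists_abs_apply_le g
  have hM0 : 0 ≤ M := (abs_nonneg _).trans (hM 0 0)
  -- the power of `u` that contracts the `k`-th coordinate
  let v : Fin 2 → ℕ → ℝˣ := fun k n ↦ if k = 0 then (u ^ n)⁻¹ else u ^ n
  have hv : ∀ k n, diagHom (v k n) k k = ((u : ℝ) ^ n)⁻¹ ∧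
      diagHom (v k n) (1 - k) (1 - k) = (u : ℝ) ^ n := by
    intro k n
    obtain ⟨h0, -, -, h3⟩ := diagHom_apply (v k n)
    fin_cases k
    · refine ⟨h0.trans ?_, h3.trans ?_⟩ <;> simp [v]
    · refine ⟨h3.trans ?_, h0.trans ?_⟩ <;> simp [v]
  have hvm : ∀ k n, diagHom (v k n) ∈ Λ := by
    intro k n
    by_cases hk : k = 0 <;> simp only [v, hk, if_true, if_false, map_inv, map_pow]
    · exact Λ.inv_mem (Λ.pow_mem hD _)
    · exact Λ.pow_mem hD _
  have hne : ∀ n : ℕ, (u : ℝ) ^ n ≠ 0 := fun n ↦ pow_ne_zero _ hupos.ne'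
  have hpow : ∀ n : ℕ, ((u : ℝ) ^ n)⁻¹ * ((u : ℝ) ^ n)⁻¹ = ((u : ℝ) ^ 2)⁻¹ ^ n := by
    intro n
    rw [inv_pow, ← pow_mul, ← mul_inv, ← pow_add]
    ring_nf
  -- Multiplying on both sides by suitable powers contracts the (i, j) entry, fixes the two adjacent
  -- ones and expands the opposite one, which is zero. The products stay bounded, so discreteness
  -- applies.
  have hij : ∀ n, (diagHom (v i n) * g * diagHom (v j n)) i j = ((u : ℝ) ^ 2)⁻¹ ^ n * g i j := by
    intro n
    rw [diagHom_mul_mul_apply, (hv i n).1, (hv j n).1, hpow]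
  refine eq_zero_of_finite_of_geometric (hΛ M) (f := fun n ↦ diagHom (v i n) * g * diagHom (v j n))
    (fun n ↦ ⟨Λ.mul_mem (Λ.mul_mem (hvm i n) hg) (hvm j n), fun k l ↦ ?_⟩) hq hq1 hij
  have hcases : ∀ k i : Fin 2, k = i ∨ k = 1 - i := by decide
  rcases hcases k i with rfl | rfl <;> rcases hcases l j with rfl | rfl
  · rw [hij, abs_mul, abs_of_pos (pow_pos hq n)]
    have h1 : ((u : ℝ) ^ 2)⁻¹ ^ n ≤ 1 := pow_le_one₀ hq.le hq1.le
    nlinarith [abs_nonneg (g k l), pow_pos hq n, hM k l]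
  · rw [diagHom_mul_mul_apply, (hv k n).1, (hv j n).2, inv_mul_cancel₀ (hne n), one_mul]
    exact hM _ _
  · rw [diagHom_mul_mul_apply, (hv i n).2, (hv l n).1, mul_inv_cancel₀ (hne n), one_mul]
    exact hM _ _
  · rw [diagHom_mul_mul_apply, h, mul_zero, abs_zero]
    exact hM0

/-- If a group containing a hyperbolic diagonal matrix has an orbit of row vectors that is locally
finite away from the origin and accumulates at the origin, then it preserves the pair of axes. -/
theorem diag_or_antidiag {Λ : Subgroup SL(2, ℝ)}
    (hΛ : ∀ M : ℝ, {g : SL(2, ℝ) | g ∈ Λ ∧ ∀ i j, |g i j| ≤ M}.Finite)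
    {u : ℝˣ} (hu : 1 < (u : ℝ)) (hD : diagHom u ∈ Λ) {V : Set (ℝ × ℝ)} (h0 : ∀ v ∈ V, v ≠ 0)
    (hV : ∀ v ∈ V, ∀ g ∈ Λ, rowMul v g ∈ V)
    (hfin : ∀ M : ℝ, {v ∈ V | 1 ≤ ‖v‖ ∧ ‖v‖ ≤ M}.Finite)
    (hacc : ∀ r > 0, ∃ v ∈ V, ‖v‖ < r) :
    ∀ g ∈ Λ, (g 0 1 = 0 ∧ g 1 0 = 0) ∨ (g 0 0 = 0 ∧ g 1 1 = 0) := by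
  have hupos : 0 < (u : ℝ) := by linarith
  -- The product of the coordinates is invariant under the diagonal matrix. A power of that matrix
  -- moves a vector with small nonzero product into the annulus 1 ≤ ‖v‖ ≤ u, where only finitely
  -- many products occur; `κ` is their least nonzero absolute value, capped at 1. Hence short
  -- vectors of `V` lie on the axes.
  obtain ⟨κ, hκ, hκV⟩ : ∃ κ > 0, ∀ w ∈ V, |w.1 * w.2| < κ → w.1 * w.2 = 0 := by
    set B := insert 1 ((fun v : ℝ × ℝ ↦ |v.1 * v.2|) '' {v ∈ V | 1 ≤ ‖v‖ ∧ ‖v‖ ≤ u} \ {0}) with hB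
    have hBf : B.Finite := (((hfin u).image _).sdiff).insert _
    obtain ⟨κ, hκB, hκ⟩ := Set.exists_min_image B id hBf ⟨1, Set.mem_insert _ _⟩
    have hκpos : 0 < κ := by
      rcases hκB with rfl | ⟨⟨v, -, rfl⟩, hv⟩
      · exact one_pos
      · exact lt_of_le_of_ne (abs_nonneg _) (Ne.symm hv)
    refine ⟨κ, hκpos, fun w hw hwκ ↦ ?_⟩
    by_contra hne
    have hw1 : w.1 ≠ 0 := left_ne_zero_of_mul hne
    obtain ⟨n, hn1, hn2⟩ := exists_mem_Ico_zpow (abs_pos.2 hw1) hu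
    set w' := rowMul w (diagHom (u ^ (-n))) with hw'
    have hmem : w' ∈ V := hV w hw _ (by rw [map_zpow]; exact Λ.zpow_mem hD _)
    have e : w' = (w.1 * (u : ℝ) ^ (-n), w.2 * ((u : ℝ) ^ (-n))⁻¹) := by
      rw [hw', rowMul_diagHom, Units.val_zpow_eq_zpow_val]
    have hprod : w'.1 * w'.2 = w.1 * w.2 := by
      rw [e]
      have : (u : ℝ) ^ (-n) ≠ 0 := zpow_ne_zero _ hupos.ne'
      field_simp
    have hup : 0 < (u : ℝ) ^ n := zpow_pos hupos n
    have h1 : 1 ≤ |w'.1| := by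
      rw [e]
      simp only [zpow_neg]
      rw [← div_eq_mul_inv, abs_div, abs_of_pos hup]
      rwa [one_le_div hup]
    have h2 : |w'.1| ≤ u := by
      rw [e]
      simp only [zpow_neg]
      rw [← div_eq_mul_inv, abs_div, abs_of_pos hup]
      rw [div_le_iff₀ hup, ← zpow_one_add₀ hupos.ne', add_comm]
      exact hn2.le
    have hκ1 : κ ≤ 1 := hκ 1 (Set.mem_insert _ _)
    have h3 : |w'.2| ≤ 1 := by
      have : |w'.1| * |w'.2| < 1 := by rw [← abs_mul, hprod]; linarith
      nlinarith [abs_nonneg w'.2]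
    have hA : w' ∈ {v ∈ V | 1 ≤ ‖v‖ ∧ ‖v‖ ≤ u} := by
      refine ⟨hmem, ?_, ?_⟩
      · exact h1.trans (norm_fst_le w')
      · rw [Prod.norm_def]
        exact max_le h2 (h3.trans hu.le)
    have := hκ |w'.1 * w'.2| (Set.mem_insert_of_mem _ ⟨⟨w', hA, rfl⟩, by
      simp only [Set.mem_singleton_iff, abs_eq_zero, hprod]; exact hne⟩)
    simp only [id] at this
    rw [hprod] at this
    linarith
  have hsmall : ∀ w ∈ V, ‖w‖ < min 1 κ → w.1 * w.2 = 0 := by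
    intro w hw hlt
    refine hκV w hw ?_
    rw [abs_mul]
    have h1 := norm_fst_le w
    have h2 := norm_snd_le w
    rw [Real.norm_eq_abs] at h1 h2
    have h3 := lt_min_iff.1 hlt
    nlinarith [abs_nonneg w.1, abs_nonneg w.2, norm_nonneg w]
  have hmin : 0 < min 1 κ := lt_min one_pos hκ
  have haxis : (∀ r > 0, ∃ v ∈ V, ‖v‖ < r ∧ v.2 = 0) ∨ (∀ r > 0, ∃ v ∈ V, ‖v‖ < r ∧ v.1 = 0) := by
    by_contra! hcon
    obtain ⟨⟨r₁, hr₁, h₁⟩, r₂, hr₂, h₂⟩ := hcon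
    obtain ⟨v, hv, hlt⟩ := hacc (min (min r₁ r₂) (min 1 κ)) (lt_min (lt_min hr₁ hr₂) hmin)
    simp only [lt_min_iff] at hlt
    rcases mul_eq_zero.1 (hsmall v hv (lt_min hlt.2.1 hlt.2.2)) with h | h
    · exact h₂ v hv hlt.1.2 h
    · exact h₁ v hv hlt.1.1 h
  intro g hg
  -- A vector on an axis, so short that its image under g is short too, has its image on an axis.
  -- This kills one entry of g, and `entry_eq_zero_of_opposite` kills the opposite one.
  obtain ⟨r, hr, hrg⟩ : ∃ r > 0, ∀ v : ℝ × ℝ, ‖v‖ < r → ‖rowMul v g‖ < min 1 κ := by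
    have h1 : rowMul 0 g = 0 := by simp [rowMul]
    obtain ⟨r, hr, h3⟩ := Metric.continuousAt_iff.1
      ((continuous_rowMul g).continuousAt (x := (0 : ℝ × ℝ))) (min 1 κ) hmin
    refine ⟨r, hr, fun v hv ↦ ?_⟩
    have := h3 (x := v) (by simpa using hv)
    simpa [h1] using this
  have c1 : g 0 1 = 0 → g 1 0 = 0 := fun h ↦ entry_eq_zero_of_opposite hΛ hu hD hg (i := 1) (j := 0) h
  have c2 : g 1 0 = 0 → g 0 1 = 0 := fun h ↦ entry_eq_zero_of_opposite hΛ hu hD hg (i := 0) (j := 1) h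
  have c3 : g 0 0 = 0 → g 1 1 = 0 := fun h ↦ entry_eq_zero_of_opposite hΛ hu hD hg (i := 1) (j := 1) h
  have c4 : g 1 1 = 0 → g 0 0 = 0 := fun h ↦ entry_eq_zero_of_opposite hΛ hu hD hg (i := 0) (j := 0) h
  rcases haxis with hax | hax
  · obtain ⟨v, hv, hvr, hv2⟩ := hax r hr
    have hv1 : v.1 ≠ 0 := fun h ↦ h0 v hv (Prod.ext h hv2)
    have := hsmall _ (hV v hv g hg) (hrg v hvr)
    simp only [rowMul, hv2, zero_mul, add_zero] at this
    rcases mul_eq_zero.1 this with h | h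
    · have := (mul_eq_zero.1 h).resolve_left hv1
      exact Or.inr ⟨this, c3 this⟩
    · have := (mul_eq_zero.1 h).resolve_left hv1
      exact Or.inl ⟨this, c1 this⟩
  · obtain ⟨v, hv, hvr, hv1⟩ := hax r hr
    have hv2 : v.2 ≠ 0 := fun h ↦ h0 v hv (Prod.ext hv1 h)
    have := hsmall _ (hV v hv g hg) (hrg v hvr)
    simp only [rowMul, hv1, zero_mul, zero_add] at this
    rcases mul_eq_zero.1 this with h | h
    · have := (mul_eq_zero.1 h).resolve_left hv2
      exact Or.inl ⟨c2 this, this⟩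
    · have := (mul_eq_zero.1 h).resolve_left hv2
      exact Or.inr ⟨c4 this, this⟩

/-- The two nonzero entries of g have product ±1 and lie in different rows, which the diagonal
matrix scales by inverse factors. Bringing the upper one into [1, u) makes the lower one at most 1.
-/
theorem exists_zpow_mul_bounded {u : ℝˣ} (hu : 1 < (u : ℝ)) {g : SL(2, ℝ)}
    (hg : (g 0 1 = 0 ∧ g 1 0 = 0) ∨ (g 0 0 = 0 ∧ g 1 1 = 0)) :
    ∃ m : ℤ, ∀ i j, |(diagHom u ^ m * g) i j| ≤ u := by
  have hupos : 0 < (u : ℝ) := by linarith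
  have key : ∀ x y : ℝ, |x * y| = 1 → ∃ m : ℤ, |(u : ℝ) ^ m * x| ≤ u ∧ |((u : ℝ) ^ m)⁻¹ * y| ≤ u := by
    intro x y hxy
    have hx : x ≠ 0 := by rintro rfl; simp at hxy
    obtain ⟨n, hn1, hn2⟩ := exists_mem_Ico_zpow (abs_pos.2 hx) hu
    have hup : 0 < (u : ℝ) ^ n := zpow_pos hupos n
    refine ⟨-n, ?_, ?_⟩
    · rw [zpow_neg, abs_mul, abs_inv, abs_of_pos hup, inv_mul_le_iff₀ hup,
        ← zpow_add_one₀ hupos.ne']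
      exact hn2.le
    · rw [zpow_neg, inv_inv, abs_mul, abs_of_pos hup]
      rw [abs_mul] at hxy
      nlinarith [abs_nonneg y]
  have hdet := SL2_det g
  have hent : ∀ m : ℤ, (diagHom u ^ m * g) 0 0 = (u : ℝ) ^ m * g 0 0 ∧
      (diagHom u ^ m * g) 0 1 = (u : ℝ) ^ m * g 0 1 ∧
      (diagHom u ^ m * g) 1 0 = ((u : ℝ) ^ m)⁻¹ * g 1 0 ∧
      (diagHom u ^ m * g) 1 1 = ((u : ℝ) ^ m)⁻¹ * g 1 1 := by
    intro m
    obtain ⟨h0, h1, h2, h3⟩ := diagHom_apply (u ^ m)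
    rw [map_zpow, Units.val_zpow_eq_zpow_val] at *
    simp only [SL2_mul_apply, h0, h1, h2, h3, zero_mul, add_zero, zero_add, and_self]
  rcases hg with ⟨h1, h2⟩ | ⟨h1, h2⟩
  · rw [h1, zero_mul, sub_zero] at hdet
    obtain ⟨m, hm1, hm2⟩ := key (g 0 0) (g 1 1) (by rw [hdet, abs_one])
    obtain ⟨e0, e1, e2, e3⟩ := hent m
    refine ⟨m, fun i j ↦ ?_⟩
    fin_cases i <;> fin_cases j <;> simp only [Fin.zero_eta, Fin.mk_one]
    · rwa [e0]
    · rw [e1, h1, mul_zero, abs_zero]; exact hupos.le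
    · rw [e2, h2, mul_zero, abs_zero]; exact hupos.le
    · rwa [e3]
  · rw [h1, zero_mul, zero_sub] at hdet
    obtain ⟨m, hm1, hm2⟩ := key (g 0 1) (g 1 0) (by rw [← abs_neg, hdet, abs_one])
    obtain ⟨e0, e1, e2, e3⟩ := hent m
    refine ⟨m, fun i j ↦ ?_⟩
    fin_cases i <;> fin_cases j <;> simp only [Fin.zero_eta, Fin.mk_one]
    · rw [e0, h1, mul_zero, abs_zero]; exact hupos.le
    · rwa [e1]
    · rwa [e2]
    · rw [e3, h2, mul_zero, abs_zero]; exact hupos.le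

theorem exists_row_eigenvector (h : SL(2, ℝ)) {μ : ℝ}
    (hμ : μ ^ 2 - (h 0 0 + h 1 1) * μ + 1 = 0) :
    ∃ p : ℝ × ℝ, p ≠ 0 ∧ rowMul p h = (μ * p.1, μ * p.2) := by
  have hdet := SL2_det h
  have h0 : ((h : Matrix (Fin 2) (Fin 2) ℝ) - Matrix.diagonal fun _ ↦ μ).det = 0 := by
    rw [Matrix.det_fin_two]
    simp only [Matrix.sub_apply, Matrix.diagonal_apply, Fin.isValue, if_true, zero_ne_one,
      one_ne_zero, if_false, sub_zero]
    linear_combination hμ + hdet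
  obtain ⟨v, hv, hv0⟩ := Matrix.exists_vecMul_eq_zero_iff.2 h0
  have e0 := congrFun hv0 0
  have e1 := congrFun hv0 1
  simp only [Matrix.vecMul, dotProduct, Fin.sum_univ_two, Matrix.sub_apply, Matrix.diagonal_apply,
    Fin.isValue, if_true, zero_ne_one, one_ne_zero, if_false, sub_zero, Pi.zero_apply] at e0 e1
  refine ⟨(v 0, v 1), fun hp ↦ hv ?_, ?_⟩
  · rw [Prod.mk_eq_zero] at hp
    ext i
    fin_cases i
    · exact hp.1
    · exact hp.2
  · simp only [rowMul, Prod.mk.injEq]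
    constructor <;> linarith

/-- A matrix in `SL(2, ℝ)` of trace greater than two is conjugate to a diagonal matrix. -/
theorem exists_conj_eq_diagHom (h : SL(2, ℝ)) (htr : 2 < h 0 0 + h 1 1) :
    ∃ (P : SL(2, ℝ)) (u : ℝˣ), 1 < (u : ℝ) ∧ P * h * P⁻¹ = diagHom u := by
  set t := h 0 0 + h 1 1 with ht
  have hD : 0 < t ^ 2 - 4 := by nlinarith
  set l := (t + √(t ^ 2 - 4)) / 2 with hl
  have hsq : √(t ^ 2 - 4) ^ 2 = t ^ 2 - 4 := Real.sq_sqrt hD.le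
  have hspos : 0 < √(t ^ 2 - 4) := Real.sqrt_pos.2 hD
  have hl1 : 1 < l := by rw [hl]; linarith
  have hlpos : 0 < l := by linarith
  have hlroot : l ^ 2 - t * l + 1 = 0 := by rw [hl]; nlinarith
  have hlinv : l⁻¹ ^ 2 - t * l⁻¹ + 1 = 0 := by
    field_simp
    linarith
  obtain ⟨p, hp, hpe⟩ := exists_row_eigenvector h hlroot
  obtain ⟨q, hq, hqe⟩ := exists_row_eigenvector h hlinv
  simp only [rowMul, Prod.mk.injEq] at hpe hqe
  have hlne : l - l⁻¹ ≠ 0 := by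
    have : l⁻¹ < 1 := inv_lt_one_of_one_lt₀ hl1
    linarith
  have hw : p.1 * q.2 - p.2 * q.1 ≠ 0 := by
    intro hw
    have k1 : p.1 * q.1 * (l - l⁻¹) = 0 := by
      linear_combination p.1 * hqe.1 - q.1 * hpe.1 - h 1 0 * hw
    have k2 : p.1 * q.2 * (l - l⁻¹) = 0 := by
      linear_combination p.1 * hqe.2 - q.1 * hpe.2 - h 1 1 * hw + l * hw
    have k3 : p.2 * q.1 * (l - l⁻¹) = 0 := by
      linear_combination k2 - (l - l⁻¹) * hw
    have k4 : p.2 * q.2 * (l - l⁻¹) = 0 := by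
      linear_combination p.2 * hqe.2 - q.2 * hpe.2 + h 0 1 * hw
    simp only [mul_eq_zero, hlne, or_false] at k1 k2 k3 k4
    by_cases hp1 : p.1 = 0
    · have hp2 : p.2 ≠ 0 := fun hp2 ↦ hp (Prod.ext hp1 hp2)
      exact hq (Prod.ext (k3.resolve_left hp2) (k4.resolve_left hp2))
    · exact hq (Prod.ext (k1.resolve_left hp1) (k2.resolve_left hp1))
  set w := p.1 * q.2 - p.2 * q.1 with hwdef
  let P : SL(2, ℝ) := ⟨!![p.1 / w, p.2 / w; q.1, q.2], by
    rw [Matrix.det_fin_two_of]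
    field_simp
    exact hwdef.symm⟩
  have P0 : P 0 0 = p.1 / w := rfl
  have P1 : P 0 1 = p.2 / w := rfl
  have P2 : P 1 0 = q.1 := rfl
  have P3 : P 1 1 = q.2 := rfl
  refine ⟨P, Units.mk0 l hlpos.ne', hl1, ?_⟩
  rw [mul_inv_eq_iff_eq_mul]
  obtain ⟨d0, d1, d2, d3⟩ := diagHom_apply (Units.mk0 l hlpos.ne')
  rw [Units.val_mk0] at d0 d3
  refine SL2_ext ?_ ?_ ?_ ?_ <;>
    simp only [SL2_mul_apply, d0, d1, d2, d3, P0, P1, P2, P3, zero_mul, add_zero, zero_add]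
  · rw [← mul_div_assoc, ← hpe.1]; ring
  · rw [← mul_div_assoc, ← hpe.2]; ring
  · exact hqe.1
  · exact hqe.2

theorem trace_conj (P g : SL(2, ℝ)) :
    (P * g * P⁻¹) 0 0 + (P * g * P⁻¹) 1 1 = g 0 0 + g 1 1 := by
  obtain ⟨i0, i1, i2, i3⟩ := SL2_inv_apply P
  have hdet := SL2_det P
  simp only [SL2_mul_apply, i0, i1, i2, i3]
  linear_combination (g 0 0 + g 1 1) * hdet

theorem abs_mul_apply_le {g h : SL(2, ℝ)} {M K : ℝ} (hg : ∀ i j, |g i j| ≤ M)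
    (hh : ∀ i j, |h i j| ≤ K) (i j : Fin 2) : |(g * h) i j| ≤ 2 * (M * K) := by
  rw [SL2_mul_apply]
  refine (abs_add_le _ _).trans ?_
  rw [abs_mul, abs_mul]
  have hM : 0 ≤ M := (abs_nonneg _).trans (hg 0 0)
  have h1 := mul_le_mul (hg i 0) (hh 0 j) (abs_nonneg _) hM
  have h2 := mul_le_mul (hg i 1) (hh 1 j) (abs_nonneg _) hM
  linarith

theorem finite_conj_of_bounded_entries (Γ : Subgroup SL(2, ℝ)) [DiscreteTopology Γ]
    (P : SL(2, ℝ)) (M : ℝ) :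
    {g : SL(2, ℝ) | g ∈ Γ ∧ ∀ i j, |(P * g * P⁻¹) i j| ≤ M}.Finite := by
  obtain ⟨K, hK⟩ := exists_abs_apply_le P
  obtain ⟨K', hK'⟩ := exists_abs_apply_le P⁻¹
  refine (finite_of_bounded_entries Γ (2 * (2 * (K' * M) * K))).subset ?_
  rintro g ⟨hg, h⟩
  refine ⟨hg, fun i j ↦ ?_⟩
  have e : g = P⁻¹ * (P * g * P⁻¹) * P := by group
  rw [e]
  exact abs_mul_apply_le (abs_mul_apply_le hK' h) hK i j

/-- The Poincaré series of a group that is a finite union of cosets of a hyperbolic cyclic group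
converges at `1 / 2`. -/
theorem summable_of_cyclic_cosets {Γ : Subgroup SL(2, ℝ)} {P h : SL(2, ℝ)} {u : ℝˣ}
    (hu : 1 < (u : ℝ)) (hP : P * h * P⁻¹ = diagHom u) {X : Set SL(2, ℝ)} (hX : X.Finite)
    (hcov : ∀ g ∈ Γ, ∃ m : ℤ, h ^ m * g ∈ X) :
    Summable fun γ : Γ ↦
      Real.exp (-(1 / 2) * dist UpperHalfPlane.I ((γ : SL(2, ℝ)) • UpperHalfPlane.I)) := by
  have hupos : 0 < (u : ℝ) := by linarith
  have htr : ∀ m : ℤ, (h ^ m) 0 0 + (h ^ m) 1 1 = (u : ℝ) ^ m + ((u : ℝ) ^ m)⁻¹ := by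
    intro m
    obtain ⟨d0, -, -, d3⟩ := diagHom_apply (u ^ m)
    rw [Units.val_zpow_eq_zpow_val] at d0 d3
    rw [← trace_conj P, ← conj_zpow, hP, ← map_zpow, d0, d3]
  have hexp : ∀ m : ℤ, Real.exp (-(1 / 2) * dist UpperHalfPlane.I (h ^ m • UpperHalfPlane.I)) ≤
      2 * ((u : ℝ)⁻¹) ^ m.natAbs := by
    intro m
    set d := dist UpperHalfPlane.I (h ^ m • UpperHalfPlane.I) with hd
    have h1 := cosh_dist_smul_I (h ^ m)
    have h2 : (u : ℝ) ^ m.natAbs ≤ (h ^ m) 0 0 + (h ^ m) 1 1 := by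
      rw [htr]
      have hp : 0 < (u : ℝ) ^ m := zpow_pos hupos m
      have hp' := inv_pos.2 hp
      rcases Int.natAbs_eq m with hm | hm
      · have : (u : ℝ) ^ m.natAbs = (u : ℝ) ^ m := by
          conv_rhs => rw [hm]
          rw [zpow_natCast]
        linarith
      · have : (u : ℝ) ^ m.natAbs = ((u : ℝ) ^ m)⁻¹ := by
          conv_rhs => rw [hm]
          rw [zpow_neg, inv_inv, zpow_natCast]
        linarith
    have hup : 0 < (u : ℝ) ^ m.natAbs := pow_pos hupos _
    -- The sum of squares of the entries is at least half the squared trace; since cosh d is half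
    -- that sum, d grows at least like 2|m| log u and the series is dominated by a geometric one.
    have h3 : ((u : ℝ) ^ m.natAbs) ^ 2 / 4 ≤ Real.cosh d := by
      rw [hd, h1]
      nlinarith [sq_nonneg ((h ^ m) 0 1), sq_nonneg ((h ^ m) 1 0),
        sq_nonneg ((h ^ m) 0 0 - (h ^ m) 1 1)]
    have h4 : Real.cosh d ≤ Real.exp d := by
      rw [Real.cosh_eq]
      have : Real.exp (-d) ≤ Real.exp d := Real.exp_le_exp.2 (by linarith [dist_nonneg.trans_eq hd.symm])
      linarith
    have h5 : Real.exp d = Real.exp (d / 2) ^ 2 := by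
      rw [← Real.exp_nat_mul]; congr 1; push_cast; ring
    have h6 : (u : ℝ) ^ m.natAbs / 2 ≤ Real.exp (d / 2) := by
      refine abs_le_of_sq_le_sq' ?_ (Real.exp_pos _).le |>.2
      rw [← h5]
      refine le_trans (le_of_eq ?_) (h3.trans h4)
      ring
    rw [show -(1 / 2) * d = -(d / 2) by ring, Real.exp_neg, inv_pow,
      show 2 * ((u : ℝ) ^ m.natAbs)⁻¹ = ((u : ℝ) ^ m.natAbs / 2)⁻¹ by rw [inv_div]; ring]
    exact inv_anti₀ (by positivity) h6
  have hsumZ : Summable fun m : ℤ ↦ 2 * ((u : ℝ)⁻¹) ^ m.natAbs := by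
    have hg : Summable fun n : ℕ ↦ ((u : ℝ)⁻¹) ^ n :=
      summable_geometric_of_lt_one (by positivity) (inv_lt_one_of_one_lt₀ hu)
    refine Summable.mul_left 2 (Summable.of_nat_of_neg ?_ ?_) <;> simpa using hg
  have := hX.to_subtype
  have := Fintype.ofFinite X
  have hXsum : Summable fun x : X ↦ Real.exp (1 / 2 * dist UpperHalfPlane.I (x.1 • UpperHalfPlane.I)) :=
    (hasSum_fintype _).summable
  have hprod := hsumZ.mul_of_nonneg hXsum (fun m ↦ by positivity) (fun x ↦ (Real.exp_pos _).le)
  choose m hm using hcov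
  let e : Γ → ℤ × X := fun γ ↦ (-(m γ.1 γ.2), ⟨h ^ m γ.1 γ.2 * γ.1, hm γ.1 γ.2⟩)
  have he : ∀ γ : Γ, γ.1 = h ^ (e γ).1 * (e γ).2.1 := by
    intro γ
    simp [e]
  have hinj : Function.Injective e := by
    intro a b hab
    apply Subtype.ext
    rw [he a, he b, hab]
  refine Summable.of_nonneg_of_le (fun γ ↦ (Real.exp_pos _).le) (fun γ ↦ ?_)
    (hprod.comp_injective hinj)
  simp only [Function.comp]
  refine le_trans ?_ (mul_le_mul_of_nonneg_right (hexp (e γ).1) (Real.exp_pos _).le)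
  rw [← Real.exp_add, Real.exp_le_exp]
  have htri := dist_triangle UpperHalfPlane.I (γ.1 • UpperHalfPlane.I)
    (h ^ (e γ).1 • UpperHalfPlane.I)
  have e2 : dist (γ.1 • UpperHalfPlane.I) (h ^ (e γ).1 • UpperHalfPlane.I) =
      dist UpperHalfPlane.I ((e γ).2.1 • UpperHalfPlane.I) := by
    conv_lhs => rw [he γ, mul_smul, dist_smul]
    rw [dist_comm]
  rw [e2] at htri
  linarith

/-- For a discrete group with critical exponent greater than `1 / 2`, bottom rows that are locally
finite away from the origin do not accumulate at the origin. -/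
theorem exists_le_norm_rowSet {Γ : Subgroup SL(2, ℝ)} [DiscreteTopology Γ]
    (hfin : ∀ r : ℝ, 0 < r → ∀ M : ℝ, {v ∈ rowSet Γ | r ≤ ‖v‖ ∧ ‖v‖ ≤ M}.Finite)
    (hδ : 1 / 2 < criticalExponent Γ) : ∃ r : ℝ, 0 < r ∧ ∀ v ∈ rowSet Γ, r ≤ ‖v‖ := by
  by_contra! hacc
  obtain ⟨h₀, hh₀, htr₀⟩ := exists_two_lt_abs_trace (Γ := Γ) fun r hr ↦ by
    obtain ⟨_, ⟨g, hg, rfl⟩, hlt⟩ := hacc r hr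
    rw [Prod.norm_mk, max_lt_iff] at hlt
    exact ⟨g, hg, hlt.1, hlt.2⟩
  -- Squaring makes the trace positive: tr(h₀²) = (tr h₀)² - 2 > 2.
  set h := h₀ * h₀ with hh
  have hhΓ : h ∈ Γ := Γ.mul_mem hh₀ hh₀
  have htr : 2 < h 0 0 + h 1 1 := by
    have hdet := SL2_det h₀
    have h4 : 4 < (h₀ 0 0 + h₀ 1 1) ^ 2 := by
      rw [← sq_abs]; nlinarith
    rw [hh, SL2_mul_apply, SL2_mul_apply]
    nlinarith
  obtain ⟨P, u, hu, hP⟩ := exists_conj_eq_diagHom h htr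
  set Λ := Γ.map (MulAut.conj P).toMonoidHom with hΛ
  have hΛmem : ∀ g, g ∈ Λ ↔ ∃ γ ∈ Γ, P * γ * P⁻¹ = g := by
    intro g; rw [hΛ, Subgroup.mem_map]; rfl
  have hΛfin : ∀ M : ℝ, {g : SL(2, ℝ) | g ∈ Λ ∧ ∀ i j, |g i j| ≤ M}.Finite := by
    intro M
    refine ((finite_conj_of_bounded_entries Γ P M).image fun g ↦ P * g * P⁻¹).subset ?_
    rintro g ⟨hg, hb⟩
    obtain ⟨γ, hγ, rfl⟩ := (hΛmem g).1 hg
    exact ⟨γ, ⟨hγ, hb⟩, rfl⟩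
  set V : Set (ℝ × ℝ) := (fun v ↦ rowMul v P⁻¹) '' rowSet Γ with hV
  have hback : ∀ v, rowMul (rowMul v P⁻¹) P = v := fun v ↦ by
    rw [← rowMul_mul, inv_mul_cancel, rowMul_one]
  have hbound : ∀ Q : SL(2, ℝ), ∃ K > 0, ∀ v, ‖rowMul v Q‖ ≤ K * ‖v‖ := by
    intro Q
    obtain ⟨K, hK⟩ := exists_abs_apply_le Q
    have hK0 : 0 ≤ K := (abs_nonneg _).trans (hK 0 0)
    refine ⟨2 * K + 1, by positivity, fun v ↦ ?_⟩
    have hx : ∀ j, |v.1 * Q 0 j + v.2 * Q 1 j| ≤ (2 * K + 1) * ‖v‖ := by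
      intro j
      have h1 : |v.1| ≤ ‖v‖ := norm_fst_le v
      have h2 : |v.2| ≤ ‖v‖ := norm_snd_le v
      have h3 := mul_le_mul h1 (hK 0 j) (abs_nonneg _) (norm_nonneg v)
      have h4 := mul_le_mul h2 (hK 1 j) (abs_nonneg _) (norm_nonneg v)
      refine (abs_add_le _ _).trans ?_
      rw [abs_mul, abs_mul]
      nlinarith [norm_nonneg v]
    rw [rowMul, Prod.norm_mk]
    exact max_le (hx 0) (hx 1)
  obtain ⟨K₁, hK₁, hb₁⟩ := hbound P
  obtain ⟨K₂, hK₂, hb₂⟩ := hbound P⁻¹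
  have haxes := diag_or_antidiag (Λ := Λ) hΛfin hu ((hΛmem _).2 ⟨h, hhΓ, hP⟩) (V := V)
    (by
      rintro _ ⟨v, hv, rfl⟩ h0
      simp only at h0
      apply rowSet_ne_zero hv
      rw [← hback v, h0]
      simp [rowMul])
    (by
      rintro _ ⟨v, hv, rfl⟩ g hg
      obtain ⟨γ, hγ, rfl⟩ := (hΛmem g).1 hg
      refine ⟨rowMul v γ, rowMul_mem_rowSet hv hγ, ?_⟩
      simp only [← rowMul_mul]
      congr 1
      group)
    (by
      intro M
      refine ((hfin (1 / K₂) (by positivity) (K₁ * M)).image fun v ↦ rowMul v P⁻¹).subset ?_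
      rintro _ ⟨⟨v, hv, rfl⟩, h1, h2⟩
      simp only at h1 h2
      refine ⟨v, ⟨hv, ?_, ?_⟩, rfl⟩
      · rw [div_le_iff₀ hK₂, mul_comm]
        exact h1.trans (hb₂ v)
      · calc ‖v‖ = ‖rowMul (rowMul v P⁻¹) P‖ := by rw [hback]
          _ ≤ K₁ * ‖rowMul v P⁻¹‖ := hb₁ _
          _ ≤ K₁ * M := mul_le_mul_of_nonneg_left h2 hK₁.le)
    (by
      intro r hr
      obtain ⟨v, hv, hlt⟩ := hacc (r / K₂) (by positivity)
      refine ⟨_, ⟨v, hv, rfl⟩, (hb₂ v).trans_lt ?_⟩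
      rwa [lt_div_iff₀ hK₂, mul_comm] at hlt)
  have hsum := summable_of_cyclic_cosets hu hP
    (finite_conj_of_bounded_entries Γ P u) (by
      intro g hg
      obtain ⟨m, hm⟩ := exists_zpow_mul_bounded hu (haxes _ ((hΛmem _).2 ⟨g, hg, rfl⟩))
      refine ⟨m, Γ.mul_mem (Γ.zpow_mem hhΓ m) hg, fun i j ↦ ?_⟩
      have e : P * (h ^ m * g) * P⁻¹ = diagHom u ^ m * (P * g * P⁻¹) := by
        rw [← hP, conj_zpow]; group
      rw [e]
      exact hm i j)
  have hle : criticalExponent Γ ≤ 1 / 2 :=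
    csInf_le ⟨0, fun s hs ↦ hs.1⟩ ⟨by norm_num, hsum⟩
  linarith

/-! ### The disc model and a connected neighbourhood of the orbit -/

/-- The Cayley transform, mapping the upper half plane to the unit disc and `i` to `0`. -/
noncomputable def cay (z : ℂ) : ℂ := (z - Complex.I) / (z + Complex.I)

theorem add_I_ne_zero (z : ℍ) : (z : ℂ) + Complex.I ≠ 0 := by
  intro h
  have := congrArg Complex.im h
  simp at this
  linarith [z.im_pos]

theorem one_sub_normSq_cay (z : ℍ) :
    1 - Complex.normSq (cay z) = 4 * z.im / Complex.normSq ((z : ℂ) + Complex.I) := by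
  have h := (Complex.normSq_pos.2 (add_I_ne_zero z)).ne'
  rw [cay, Complex.normSq_div, eq_div_iff h, sub_mul, div_mul_cancel₀ _ h]
  simp [Complex.normSq_apply]
  ring

theorem normSq_cay_sub (z w : ℍ) :
    Complex.normSq (cay z - cay w) = 4 * Complex.normSq ((z : ℂ) - w) /
      (Complex.normSq ((z : ℂ) + Complex.I) * Complex.normSq ((w : ℂ) + Complex.I)) := by
  have hz := add_I_ne_zero z
  have hw := add_I_ne_zero w
  have h : cay z - cay w =
      2 * Complex.I * (z - w) / (((z : ℂ) + Complex.I) * ((w : ℂ) + Complex.I)) := by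
    rw [cay, cay]
    field_simp
    ring
  rw [h, Complex.normSq_div, Complex.normSq_mul, Complex.normSq_mul, Complex.normSq_mul]
  simp
  norm_num

theorem exists_cay_eq {w : ℂ} (hw : Complex.normSq w < 1) : ∃ z : ℍ, cay z = w := by
  have h1 : (1 : ℂ) - w ≠ 0 := by
    intro h
    rw [sub_eq_zero] at h
    simp [← h] at hw
  have him : 0 < (Complex.I * (1 + w) / (1 - w)).im := by
    have e : (Complex.I * (1 + w) / (1 - w)).im =
        (1 - Complex.normSq w) / Complex.normSq (1 - w) := by
      rw [Complex.div_im]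
      simp [Complex.normSq_apply]
      ring
    rw [e]
    exact div_pos (by linarith) (Complex.normSq_pos.2 h1)
  refine ⟨⟨_, him⟩, ?_⟩
  have h2 : Complex.I * (1 + w) / (1 - w) + Complex.I ≠ 0 := add_I_ne_zero ⟨_, him⟩
  rw [UpperHalfPlane.coe_mk, cay, div_eq_iff h2]
  field_simp
  ring

/-- The image of a hyperbolic ball under the Cayley transform. -/
noncomputable def discBall (z₀ : ℍ) (ρ : ℝ) : Set ℂ :=
  {w | Complex.normSq (w - cay z₀) <
    (1 - Complex.normSq w) * ((1 - Complex.normSq (cay z₀)) * (Real.cosh ρ - 1) / 2)}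

theorem mem_discBall {w : ℂ} {z₀ : ℍ} {ρ : ℝ} : w ∈ discBall z₀ ρ ↔ Complex.normSq (w - cay z₀) <
    (1 - Complex.normSq w) * ((1 - Complex.normSq (cay z₀)) * (Real.cosh ρ - 1) / 2) := Iff.rfl

/-- In the disc, cosh d - 1 = 2|w - w₀|² / ((1 - |w|²)(1 - |w₀|²)), which is the inequality defining
`discBall` with denominators cleared. -/
theorem cay_mem_discBall {z z₀ : ℍ} {ρ : ℝ} (hρ : 0 ≤ ρ) :
    cay z ∈ discBall z₀ ρ ↔ dist z z₀ < ρ := by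
  have h1 : dist z z₀ < ρ ↔ Real.cosh (dist z z₀) < Real.cosh ρ := by
    rw [Real.cosh_lt_cosh, abs_of_nonneg dist_nonneg, abs_of_nonneg hρ]
  have hz := Complex.normSq_pos.2 (add_I_ne_zero z)
  have hw := Complex.normSq_pos.2 (add_I_ne_zero z₀)
  rw [h1, UpperHalfPlane.cosh_dist, Complex.dist_eq, ← Complex.normSq_eq_norm_sq, mem_discBall,
    normSq_cay_sub, one_sub_normSq_cay, one_sub_normSq_cay, div_lt_iff₀ (mul_pos hz hw)]
  have e : 4 * z.im / Complex.normSq ((z : ℂ) + Complex.I) *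
      (4 * z₀.im / Complex.normSq ((z₀ : ℂ) + Complex.I) * (Real.cosh ρ - 1) / 2) *
      (Complex.normSq ((z : ℂ) + Complex.I) * Complex.normSq ((z₀ : ℂ) + Complex.I)) =
      4 * ((Real.cosh ρ - 1) * (2 * z.im * z₀.im)) := by
    field_simp
    ring
  rw [e, mul_lt_mul_iff_right₀ (by norm_num : (0 : ℝ) < 4),
    ← div_lt_iff₀ (mul_pos (mul_pos two_pos z.im_pos) z₀.im_pos)]
  constructor <;> intro h <;> linarith

theorem normSq_cay_lt_one (z : ℍ) : Complex.normSq (cay z) < 1 := by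
  have h := one_sub_normSq_cay z
  have : 0 < 4 * z.im / Complex.normSq ((z : ℂ) + Complex.I) :=
    div_pos (mul_pos (by norm_num) z.im_pos) (Complex.normSq_pos.2 (add_I_ne_zero z))
  linarith

theorem normSq_lt_one_of_mem_discBall {w : ℂ} {z₀ : ℍ} {ρ : ℝ} (h : w ∈ discBall z₀ ρ) :
    Complex.normSq w < 1 := by
  rw [mem_discBall] at h
  have h1 := normSq_cay_lt_one z₀
  have h2 := Real.one_le_cosh ρ
  by_contra! h3
  have : (1 - Complex.normSq w) * ((1 - Complex.normSq (cay z₀)) * (Real.cosh ρ - 1) / 2) ≤ 0 :=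
    mul_nonpos_of_nonpos_of_nonneg (by linarith)
      (div_nonneg (mul_nonneg (by linarith) (by linarith)) two_pos.le)
  linarith [Complex.normSq_nonneg (w - cay z₀)]

/-- The condition reads |w - w₀|² + k|w|² < k with k ≥ 0, a sublevel set of a convex function.
Euclidean convexity makes each ball connected and lets it cut lines in intervals. -/
theorem convex_discBall (z₀ : ℍ) (ρ : ℝ) : Convex ℝ (discBall z₀ ρ) := by
  set k := (1 - Complex.normSq (cay z₀)) * (Real.cosh ρ - 1) / 2 with hk
  have hk0 : 0 ≤ k := div_nonneg (mul_nonneg (by linarith [normSq_cay_lt_one z₀])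
    (by linarith [Real.one_le_cosh ρ])) two_pos.le
  have hc1 : ConvexOn ℝ Set.univ fun w : ℂ ↦ (dist w (cay z₀)) ^ 2 :=
    (convexOn_univ_dist (cay z₀)).pow (fun _ _ ↦ dist_nonneg) 2
  have hc2 : ConvexOn ℝ Set.univ fun w : ℂ ↦ (dist w 0) ^ 2 :=
    (convexOn_univ_dist (0 : ℂ)).pow (fun _ _ ↦ dist_nonneg) 2
  have hc := hc1.add (hc2.smul hk0)
  have he : discBall z₀ ρ = {w ∈ Set.univ | ((fun w : ℂ ↦ (dist w (cay z₀)) ^ 2) +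
      k • fun w : ℂ ↦ (dist w 0) ^ 2) w < k} := by
    ext w
    rw [mem_discBall, ← hk]
    simp only [Complex.normSq_eq_norm_sq, dist_eq_norm, sub_zero]
    change _ ↔ _ ∧ ‖w - cay z₀‖ ^ 2 + k * ‖w‖ ^ 2 < k
    constructor
    · intro h
      exact ⟨Set.mem_univ _, by linarith⟩
    · rintro ⟨-, h⟩
      linarith
  rw [he]
  exact hc.convex_lt k

/-- The image of `γ⁻¹ ∞` under the Cayley transform. -/
noncomputable def boundaryPoint (g : SL(2, ℝ)) : ℂ :=
  (g 1 1 + g 1 0 * Complex.I) / (g 1 1 - g 1 0 * Complex.I)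

theorem row_complex_ne_zero (g : SL(2, ℝ)) :
    (g 1 1 : ℂ) + g 1 0 * Complex.I ≠ 0 ∧ (g 1 1 : ℂ) - g 1 0 * Complex.I ≠ 0 := by
  have h := row_sq_pos g
  constructor <;> intro h0 <;>
  · have h1 := congrArg Complex.re h0
    have h2 := congrArg Complex.im h0
    simp at h1 h2
    simp [h1, h2] at h

theorem norm_boundaryPoint (g : SL(2, ℝ)) : ‖boundaryPoint g‖ = 1 := by
  have h := row_complex_ne_zero g
  have e : (g 1 1 : ℂ) + g 1 0 * Complex.I =
      (starRingEnd ℂ) ((g 1 1 : ℂ) - g 1 0 * Complex.I) := by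
    simp
  rw [boundaryPoint, norm_div, e, Complex.norm_conj, div_self (norm_ne_zero_iff.2 h.2)]

/-- The quotient is the Cayley transform based at p = gi, and differs from z ↦ cay(g⁻¹z) by a
rotation. Letting z tend to infinity identifies that rotation as `boundaryPoint g`. -/
theorem cay_inv_smul (g : SL(2, ℝ)) (z : ℍ) :
    cay (g⁻¹ • z : ℍ) = boundaryPoint g *
      (((z : ℂ) - (g • UpperHalfPlane.I : ℍ)) /
        ((z : ℂ) - (starRingEnd ℂ) (g • UpperHalfPlane.I : ℍ))) := by
  obtain ⟨i0, i1, i2, i3⟩ := SL2_inv_apply g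
  obtain ⟨h1, h2⟩ := row_complex_ne_zero g
  have hz : ((z : ℂ) - (starRingEnd ℂ) (g • UpperHalfPlane.I : ℍ)) ≠ 0 := by
    intro h0
    have := congrArg Complex.im h0
    simp at this
    linarith [z.im_pos, (g • UpperHalfPlane.I : ℍ).im_pos]
  have hd : (-(g 1 0) * z + g 0 0 : ℂ) ≠ 0 := by
    intro h0
    have e1 := congrArg Complex.im h0
    have e2 := congrArg Complex.re h0
    simp at e1 e2
    have e3 : g 1 0 = 0 := by
      rcases e1 with h | h
      · exact h
      · exact absurd h z.im_pos.ne'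
    have := SL2_det g
    rw [e3] at e2 this
    simp at e2
    simp [e2] at this
  have hc : (starRingEnd ℂ) (g • UpperHalfPlane.I : ℍ) =
      (g 0 1 - g 0 0 * Complex.I) / (g 1 1 - g 1 0 * Complex.I) := by
    rw [coe_smul_I, map_div₀]
    congr 1 <;> simp <;> ring
  have hI : ((g • UpperHalfPlane.I : ℍ) : ℂ) =
      (g 0 1 + g 0 0 * Complex.I) / (g 1 1 + g 1 0 * Complex.I) := by
    rw [coe_smul_I]
    congr 1 <;> ring
  have hw : ((g⁻¹ • z : ℍ) : ℂ) = (g 1 1 * z - g 0 1) / (-(g 1 0) * z + g 0 0) := by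
    rw [UpperHalfPlane.coe_specialLinearGroup_apply, i0, i1, i2, i3]
    simp [sub_eq_add_neg]
  have hw' := add_I_ne_zero (g⁻¹ • z)
  rw [hc] at hz ⊢
  rw [hw] at hw' ⊢
  rw [hI, boundaryPoint, cay, div_sub' hd, div_add' _ _ _ hd, div_div_div_cancel_right₀ hd,
    sub_div' h1, sub_div' h2]
  rw [div_add' _ _ _ hd] at hw'
  rw [sub_div' h2] at hz
  have n1 := (div_ne_zero_iff.1 hw').1
  have n2 := (div_ne_zero_iff.1 hz).1
  rw [div_mul_div_comm, div_eq_div_iff n1 (mul_ne_zero h2 hz)]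
  field_simp
  ring

/-- Once ρ exceeds d(xi, i) for all generators x, the balls around gi and gxi overlap; the union is
then connected along the Cayley graph. -/
theorem isPreconnected_iUnion_discBall {Γ : Subgroup SL(2, ℝ)} (hfg : Γ.FG) :
    ∃ ρ : ℝ, 0 < ρ ∧ IsPreconnected (⋃ g : Γ, discBall ((g : SL(2, ℝ)) • UpperHalfPlane.I) ρ) := by
  obtain ⟨S, hS⟩ := hfg
  set ρ : ℝ := 1 + ∑ g ∈ S, dist (g • UpperHalfPlane.I) UpperHalfPlane.I with hρ
  have hρ0 : 0 < ρ := by positivity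
  have hlt : ∀ g ∈ S, dist (g • UpperHalfPlane.I) UpperHalfPlane.I < ρ := by
    intro g hg
    have := Finset.single_le_sum (f := fun g : SL(2, ℝ) ↦
      dist (g • UpperHalfPlane.I) UpperHalfPlane.I) (fun _ _ ↦ dist_nonneg) hg
    linarith
  refine ⟨ρ, hρ0, ?_⟩
  apply IsPreconnected.iUnion_of_reflTransGen
  · exact fun g ↦ (convex_discBall _ _).isPreconnected
  set r : Γ → Γ → Prop := fun i j ↦ (discBall ((i : SL(2, ℝ)) • UpperHalfPlane.I) ρ ∩
    discBall ((j : SL(2, ℝ)) • UpperHalfPlane.I) ρ).Nonempty with hr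
  have hsymm : Std.Symm r := ⟨fun i j h ↦ by
    simp only [hr] at h ⊢
    rwa [Set.inter_comm]⟩
  have key : ∀ x (hx : x ∈ Subgroup.closure (S : Set SL(2, ℝ))), ∀ g h : Γ,
      (h : SL(2, ℝ)) = g * x → Relation.ReflTransGen r g h := by
    intro x hx
    induction hx using Subgroup.closure_induction with
    | mem x hx =>
      intro g h hh
      apply Relation.ReflTransGen.single
      refine ⟨cay ((h : SL(2, ℝ)) • UpperHalfPlane.I : ℍ), ?_, ?_⟩
      · rw [cay_mem_discBall hρ0.le, hh, mul_smul, dist_smul]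
        exact hlt x hx
      · rw [cay_mem_discBall hρ0.le, dist_self]
        exact hρ0
    | one =>
      intro g h hh
      have : h = g := Subtype.ext (by simpa using hh)
      rw [this]
    | mul x y hx hy ihx ihy =>
      intro g h hh
      have hx' : x ∈ Γ := hS ▸ hx
      exact (ihx g ⟨g * x, Γ.mul_mem g.2 hx'⟩ rfl).trans
        (ihy _ h (by rw [hh, mul_assoc]))
    | inv x hx ihx =>
      intro g h hh
      exact symm_of (Relation.ReflTransGen r) (ihx h g (by rw [hh]; group))
  intro g h
  exact key (g⁻¹ * h) (by rw [hS]; exact Γ.mul_mem (Γ.inv_mem g.2) h.2) g h (mul_inv_cancel_left _ _).symm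

/-- A ball meeting a compact part of the disc has its centre at bounded distance from i, which
bounds the entries of g. -/
theorem finite_discBall_meets (Γ : Subgroup SL(2, ℝ)) [DiscreteTopology Γ] {ρ q : ℝ} (hρ : 0 ≤ ρ)
    (hq : q < 1) :
    {g : SL(2, ℝ) | g ∈ Γ ∧ ∃ w ∈ discBall (g • UpperHalfPlane.I) ρ, Complex.normSq w ≤ q}.Finite := by
  have hcI : cay (UpperHalfPlane.I : ℍ) = 0 := by simp [cay]
  obtain ⟨ρ', hρ'⟩ : ∃ ρ' : ℝ, 1 + 2 / (1 - q) < Real.cosh ρ' ∧ 0 ≤ ρ' :=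
    have h0 : 0 ≤ 1 + 2 / (1 - q) := add_nonneg zero_le_one (div_nonneg two_pos.le (by linarith))
    ⟨1 + 2 / (1 - q), (Real.self_le_sinh_iff.2 h0).trans_lt (Real.sinh_lt_cosh _), h0⟩
  set M := 2 * Real.cosh (ρ + ρ') with hM
  refine (finite_of_bounded_entries Γ M).subset ?_
  rintro g ⟨hg, w, hw, hwq⟩
  refine ⟨hg, ?_⟩
  obtain ⟨z, rfl⟩ := exists_cay_eq (normSq_lt_one_of_mem_discBall hw)
  rw [cay_mem_discBall hρ] at hw
  have hz : dist z UpperHalfPlane.I < ρ' := by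
    rw [← cay_mem_discBall hρ'.2, mem_discBall, hcI]
    simp only [sub_zero, map_zero, one_mul]
    have h1 : 1 < (1 - q) * ((Real.cosh ρ' - 1) / 2) := by
      have h2 : 0 < 1 - q := by linarith
      have := hρ'.1
      have h3 : 2 / (1 - q) < Real.cosh ρ' - 1 := by linarith
      rw [div_lt_iff₀ h2] at h3
      linarith
    have h4 : 0 ≤ (Real.cosh ρ' - 1) / 2 := by linarith [Real.one_le_cosh ρ']
    have := mul_le_mul_of_nonneg_right (show 1 - q ≤ 1 - Complex.normSq (cay z) by linarith) h4
    linarith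
  have hd : dist UpperHalfPlane.I (g • UpperHalfPlane.I) ≤ ρ + ρ' := by
    have := dist_triangle UpperHalfPlane.I z (g • UpperHalfPlane.I)
    rw [dist_comm UpperHalfPlane.I z] at this
    linarith
  have hc : Real.cosh (dist UpperHalfPlane.I (g • UpperHalfPlane.I)) ≤ Real.cosh (ρ + ρ') := by
    rw [Real.cosh_le_cosh, abs_of_nonneg dist_nonneg]
    exact hd.trans (le_abs_self _)
  rw [cosh_dist_smul_I] at hc
  have h1 := Real.one_le_cosh (ρ + ρ')
  intro i j
  apply abs_le_of_sq_le_sq _ (by linarith)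
  fin_cases i <;> fin_cases j <;> simp <;>
    nlinarith [sq_nonneg (g 0 0), sq_nonneg (g 0 1), sq_nonneg (g 1 0), sq_nonneg (g 1 1)]

/-! ### Boundedness of the orbit of i -/

/-- The stabilizer of infinity in a group with trivial unipotents, the lower rows of which stay
away from zero, consists of `±1`. -/
theorem eq_one_or_neg_one_of_apply_eq_zero {Γ : Subgroup SL(2, ℝ)} {r : ℝ} (hr : 0 < r)
    (hrow : ∀ v ∈ rowSet Γ, r ≤ ‖v‖) (hinf : HorocycleInfinite Γ) {g : SL(2, ℝ)} (hg : g ∈ Γ)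
    (hc : g 1 0 = 0) : g = 1 ∨ g = -1 := by
  have hdet := SL2_det g
  rw [hc, mul_zero, sub_zero] at hdet
  have hpow : ∀ h : SL(2, ℝ), h 1 0 = 0 → ∀ n : ℕ, (h ^ n) 1 0 = 0 ∧ (h ^ n) 1 1 = h 1 1 ^ n := by
    intro h hh n
    induction n with
    | zero => simp
    | succ n ih => simp [pow_succ, SL2_mul_apply, ih.1, ih.2, hh]
  -- The powers of h have bottom rows (0, dⁿ), which would tend to the origin if |d| < 1. Used for g
  -- and g⁻¹, this gives |d| = 1; then g² is unipotent, hence trivial.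
  have hge : ∀ h ∈ Γ, h 1 0 = 0 → 1 ≤ |h 1 1| := by
    intro h hh h0
    by_contra! hlt
    obtain ⟨n, hn⟩ := exists_pow_lt_of_lt_one hr hlt
    have := hrow _ ⟨h ^ n, Γ.pow_mem hh n, rfl⟩
    rw [(hpow h h0 n).1, (hpow h h0 n).2] at this
    simp only [Prod.norm_def, norm_zero, Real.norm_eq_abs, abs_pow] at this
    rw [max_eq_right (by positivity)] at this
    linarith
  have h1 := hge g hg hc
  obtain ⟨-, i1, i2, i3⟩ := SL2_inv_apply g
  have h2 := hge g⁻¹ (Γ.inv_mem hg) (by rw [i2, hc, neg_zero])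
  rw [i3] at h2
  have h3 : |g 0 0| * |g 1 1| = 1 := by rw [← abs_mul, hdet, abs_one]
  have h4 : |g 1 1| = 1 := by nlinarith
  have h5 : g 1 1 ^ 2 = 1 := by rw [← sq_abs, h4, one_pow]
  have h6 : g 0 0 = g 1 1 := by linear_combination (-g 0 0) * h5 + g 1 1 * hdet
  have hN : g * g = 1 := by
    have : g * g ∈ N ⊓ Γ := by
      refine ⟨?_, Γ.mul_mem hg hg⟩
      change g * g ∈ N
      rw [mem_N_iff, SL2_mul_apply, SL2_mul_apply, hc]
      constructor
      · ring
      · linear_combination h5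
    rw [hinf] at this
    exact Subgroup.mem_bot.1 this
  have h7 := congrArg (fun h : SL(2, ℝ) ↦ h 0 1) hN
  simp only [SL2_mul_apply, Matrix.SpecialLinearGroup.coe_one] at h7
  rw [Matrix.one_apply_ne (by decide), h6] at h7
  have h8 : g 0 1 = 0 := by
    have : g 1 1 ≠ 0 := by
      intro h
      simp [h] at h4
    have h9 : g 1 1 * g 0 1 = 0 := by linarith
    exact (mul_eq_zero.1 h9).resolve_left this
  rcases abs_eq (by norm_num : (0 : ℝ) ≤ 1) |>.1 h4 with h | h
  · left
    apply SL2_ext <;> simp [h6, h, h8, hc]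
  · right
    apply SL2_ext <;> simp [h6, h, h8, hc]

theorem im_smul_I_le {Γ : Subgroup SL(2, ℝ)} {r : ℝ} (hr : 0 < r)
    (hrow : ∀ v ∈ rowSet Γ, r ≤ ‖v‖) {g : SL(2, ℝ)} (hg : g ∈ Γ) :
    (g • UpperHalfPlane.I : ℍ).im ≤ 1 / r ^ 2 := by
  rw [im_smul_I]
  have h := hrow _ ⟨g, hg, rfl⟩
  apply one_div_le_one_div_of_le (by positivity)
  rw [Prod.norm_def, le_max_iff, Real.norm_eq_abs, Real.norm_eq_abs] at h
  rcases h with h | h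
  · have := pow_le_pow_left₀ hr.le h 2
    rw [sq_abs] at this
    nlinarith [sq_nonneg (g 1 1)]
  · have := pow_le_pow_left₀ hr.le h 2
    rw [sq_abs] at this
    nlinarith [sq_nonneg (g 1 0)]

/-- If the orbit of `i` is unbounded but of bounded height, then there are orbit points far out
above which the vertical ray avoids the `ρ`-neighbourhood of the orbit. -/
theorem exists_ray_avoiding_orbit {Γ : Subgroup SL(2, ℝ)} {B ρ : ℝ} (hρ : 0 < ρ)
    (hB : ∀ g ∈ Γ, (g • UpperHalfPlane.I : ℍ).im ≤ B)
    (hub : ∀ T : ℝ, ∃ g ∈ Γ, T < |(g • UpperHalfPlane.I : ℍ).re|) :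
    ∃ M : ℝ, 1 < M ∧ ∀ T : ℝ, ∃ g ∈ Γ, T < |(g • UpperHalfPlane.I : ℍ).re| ∧
      ∀ g' ∈ Γ, ∀ z : ℍ, z.re = (g • UpperHalfPlane.I : ℍ).re →
        M * (g • UpperHalfPlane.I : ℍ).im ≤ z.im → ρ ≤ dist z (g' • UpperHalfPlane.I) := by
  set E := Real.exp (ρ + 1) with hE
  have hE1 : 1 < E := Real.one_lt_exp_iff.2 (by linarith)
  have hE0 : 0 < E := by linarith
  refine ⟨2 * E ^ 2, by nlinarith, fun T ↦ ?_⟩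
  obtain ⟨g₀, hg₀, hT⟩ := hub (T + B * E)
  set t := (g₀ • UpperHalfPlane.I : ℍ).re with ht
  -- The heights at which the line Re = t comes within ρ + 1 of the orbit. Close to the supremum
  -- there is an orbit point p with |Re p - t| ≤ E · Im p. Above p, at heights from 2E² · Im p on,
  -- changing the real part to t moves a point by at most 1; a point within ρ of the orbit would
  -- thus put its height in `A`, beyond the supremum.
  set A : Set ℝ := {h | ∃ hh : 0 < h, ∃ g ∈ Γ,
    dist (⟨⟨t, h⟩, hh⟩ : ℍ) (g • UpperHalfPlane.I) ≤ ρ + 1} with hA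
  have hA0 : (g₀ • UpperHalfPlane.I : ℍ).im ∈ A := by
    refine ⟨(g₀ • UpperHalfPlane.I : ℍ).im_pos, g₀, hg₀, ?_⟩
    have : (⟨⟨t, (g₀ • UpperHalfPlane.I : ℍ).im⟩, (g₀ • UpperHalfPlane.I : ℍ).im_pos⟩ : ℍ) =
        g₀ • UpperHalfPlane.I := by
      ext
      rfl
    rw [this, dist_self]
    linarith
  have hbdd : BddAbove A := by
    refine ⟨B * E, ?_⟩
    rintro h ⟨hh, g, hg, hd⟩
    have h1 := UpperHalfPlane.im_le_im_mul_exp_dist (⟨⟨t, h⟩, hh⟩ : ℍ) (g • UpperHalfPlane.I)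
    have h2 : Real.exp (dist (⟨⟨t, h⟩, hh⟩ : ℍ) (g • UpperHalfPlane.I)) ≤ E :=
      Real.exp_le_exp.2 hd
    calc h ≤ _ := h1
      _ ≤ B * E := mul_le_mul (hB g hg) h2 (Real.exp_pos _).le
        ((g • UpperHalfPlane.I : ℍ).im_pos.le.trans (hB g hg))
  have hH : 0 < sSup A := (g₀ • UpperHalfPlane.I : ℍ).im_pos.trans_le (le_csSup hbdd hA0)
  obtain ⟨h, ⟨hh, g, hg, hd⟩, hlt⟩ := exists_lt_of_lt_csSup ⟨_, hA0⟩ (half_lt_self hH)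
  set p : ℍ := g • UpperHalfPlane.I with hp
  set q : ℍ := ⟨⟨t, h⟩, hh⟩ with hq
  have hqre : q.re = t := rfl
  have hqim : q.im = h := rfl
  have hpB := hB g hg
  have hp0 := p.im_pos
  have hexp : Real.exp (dist q p) ≤ E := Real.exp_le_exp.2 hd
  have hre : |t - p.re| ≤ p.im * E := by
    have h1 := UpperHalfPlane.dist_coe_le q p
    have h2 : |t - p.re| ≤ dist (q : ℂ) p := by
      rw [Complex.dist_eq]
      simpa [hqre] using Complex.abs_re_le_norm ((q : ℂ) - p)
    refine h2.trans (h1.trans (mul_le_mul_of_nonneg_left (by linarith) hp0.le))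
  have him : h ≤ p.im * E := (UpperHalfPlane.im_le_im_mul_exp_dist q p).trans
    (mul_le_mul_of_nonneg_left hexp hp0.le)
  refine ⟨g, hg, ?_, ?_⟩
  · have h1 : |t| ≤ |t - p.re| + |p.re| := by simpa using abs_add_le (t - p.re) p.re
    have h2 : p.im * E ≤ B * E := mul_le_mul_of_nonneg_right hpB hE0.le
    linarith
  · intro g' hg' z hz hzM
    by_contra! hcon
    set z' : ℍ := ⟨⟨t, z.im⟩, z.im_pos⟩ with hz'
    have h1 : dist z' z ≤ 1 := by
      have h2 := UpperHalfPlane.dist_le_dist_coe_div_sqrt z' z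
      have h3 : z'.im = z.im := rfl
      have h4 : dist (z' : ℂ) z = |t - p.re| := by
        rw [Complex.dist_eq, ← hz]
        have : (z' : ℂ) - z = ((t - z.re : ℝ) : ℂ) := by
          apply Complex.ext <;> simp [hz']
        rw [this, Complex.norm_real, Real.norm_eq_abs]
      rw [h3, Real.sqrt_mul_self z.im_pos.le, h4] at h2
      refine h2.trans ((div_le_one z.im_pos).2 (hre.trans (le_trans ?_ hzM)))
      nlinarith [mul_pos hp0 hE0]
    have h5 : z.im ∈ A := by
      refine ⟨z.im_pos, g', hg', ?_⟩
      have := dist_triangle z' z (g' • UpperHalfPlane.I)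
      linarith
    have h6 := le_csSup hbdd h5
    nlinarith [mul_pos hp0 hE0]

/-- The element g carries the radius ending at `boundaryPoint g` to the vertical ray above gi, the
parameter r going to the height factor (1 + r)/(1 - r), which is at least M exactly for r ≥ (M -
1)/(M + 1). -/
theorem boundaryPoint_ray_not_mem {Γ : Subgroup SL(2, ℝ)} {ρ M : ℝ} (hρ : 0 < ρ) (hM : 1 < M)
    {g : SL(2, ℝ)} (hg : g ∈ Γ)
    (hray : ∀ g' ∈ Γ, ∀ z : ℍ, z.re = (g • UpperHalfPlane.I : ℍ).re →
        M * (g • UpperHalfPlane.I : ℍ).im ≤ z.im → ρ ≤ dist z (g' • UpperHalfPlane.I))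
    {r : ℝ} (hr : (M - 1) / (M + 1) ≤ r) {g' : SL(2, ℝ)} (hg' : g' ∈ Γ) :
    (r : ℂ) * boundaryPoint g ∉ discBall (g' • UpperHalfPlane.I) ρ := by
  intro hmem
  have h0 : 0 ≤ r := le_trans (div_nonneg (by linarith) (by linarith)) hr
  have h1 : r < 1 := by
    have := normSq_lt_one_of_mem_discBall hmem
    rw [Complex.normSq_mul, Complex.normSq_ofReal, Complex.normSq_eq_norm_sq, norm_boundaryPoint]
      at this
    nlinarith
  set p : ℍ := g • UpperHalfPlane.I with hp
  have h2 : 0 < 1 - r := by linarith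
  set η := (1 + r) / (1 - r) with hη
  have hηM : M ≤ η := by
    rw [div_le_iff₀ (by linarith)] at hr
    rw [hη, le_div_iff₀ h2]
    linarith
  have hη0 : 0 < η := by linarith
  set z : ℍ := ⟨⟨p.re, η * p.im⟩, mul_pos hη0 p.im_pos⟩ with hz
  have h3 : cay (g⁻¹ • z : ℍ) = r * boundaryPoint g := by
    rw [cay_inv_smul, mul_comm]
    congr 1
    have e1 : (z : ℂ) - p = ((η - 1) * p.im : ℝ) * Complex.I := by
      apply Complex.ext <;> simp [hz]
      ring
    have e2 : (z : ℂ) - (starRingEnd ℂ) p = ((η + 1) * p.im : ℝ) * Complex.I := by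
      apply Complex.ext <;> simp [hz]
      ring
    rw [e1, e2, mul_div_mul_right _ _ Complex.I_ne_zero, ← Complex.ofReal_div]
    congr 1
    rw [mul_div_mul_right _ _ p.im_pos.ne', hη]
    field_simp
    ring
  rw [← h3, cay_mem_discBall hρ.le] at hmem
  have h4 := hray (g * g') (Γ.mul_mem hg hg') z rfl (mul_le_mul_of_nonneg_right hηM p.im_pos.le)
  rw [← dist_smul g, smul_inv_smul, ← mul_smul] at hmem
  linarith

/-- An interval missing Z leaves every point of Z on one of its two sides, so an infinite part of Z
lies on a single side. Repeat for the finitely many intervals. -/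
theorem exists_infinite_subset_avoiding {ι : Type*} {J : Set ι} (hJ : J.Finite) (I : ι → Set ℝ)
    (hI : ∀ i ∈ J, (I i).OrdConnected) {Z : Set ℝ} (hZ : Z.Infinite)
    (hd : ∀ i ∈ J, ∀ z ∈ Z, z ∉ I i) :
    ∃ Z' ⊆ Z, Z'.Infinite ∧ ∀ i ∈ J, ∀ a ∈ Z', ∀ b ∈ Z', ∀ x ∈ Set.Icc a b, x ∉ I i := by
  induction J, hJ using Set.Finite.induction_on with
  | empty => exact ⟨Z, subset_rfl, hZ, by simp⟩
  | @insert j J hj hJ ih =>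
    obtain ⟨Z₁, hsub, hinf, h1⟩ := ih (fun i hi ↦ hI i (Set.mem_insert_of_mem _ hi))
      (fun i hi ↦ hd i (Set.mem_insert_of_mem _ hi))
    have hor : ∀ z ∈ Z₁, (∀ x ∈ I j, z < x) ∨ (∀ x ∈ I j, x < z) := by
      intro z hz
      by_contra! h
      obtain ⟨⟨x, hx, hxz⟩, y, hy, hzy⟩ := h
      exact hd j (Set.mem_insert _ _) z (hsub hz)
        ((hI j (Set.mem_insert _ _)).out hx hy ⟨hxz, hzy⟩)
    have hun : Z₁ = {z ∈ Z₁ | ∀ x ∈ I j, z < x} ∪ {z ∈ Z₁ | ∀ x ∈ I j, x < z} := by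
      ext z
      constructor
      · intro hz
        rcases hor z hz with h | h
        · exact Or.inl ⟨hz, h⟩
        · exact Or.inr ⟨hz, h⟩
      · rintro (h | h) <;> exact h.1
    rw [hun, Set.infinite_union] at hinf
    rcases hinf with hinf | hinf
    · refine ⟨_, fun z hz ↦ hsub hz.1, hinf, ?_⟩
      intro i hi a ha b hb x hx hxI
      rcases hi with rfl | hi
      · exact absurd (hb.2 x hxI) (not_lt.2 hx.2)
      · exact h1 i hi a ha.1 b hb.1 x hx hxI
    · refine ⟨_, fun z hz ↦ hsub hz.1, hinf, ?_⟩
      intro i hi a ha b hb x hx hxI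
      rcases hi with rfl | hi
      · exact absurd (ha.2 x hxI) (not_lt.2 hx.1)
      · exact h1 i hi a ha.1 b hb.1 x hx hxI

/-- A connected set containing the origin that misses the boundary of a truncated sector misses the
truncated sector. -/
theorem not_mem_of_mem_truncated_sector {W : Set ℂ} (hW : IsPreconnected W) (h0 : (0 : ℂ) ∈ W)
    {c σ₁ σ₃ : ℝ} (hc : 0 < c)
    (h1 : ∀ w ∈ W, c ≤ w.re → w.im ≠ σ₁ * w.re) (h3 : ∀ w ∈ W, c ≤ w.re → w.im ≠ σ₃ * w.re)
    (h2 : ∀ w ∈ W, w.re = c → ¬ (σ₁ * w.re ≤ w.im ∧ w.im ≤ σ₃ * w.re)) :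
    ∀ w ∈ W, ¬ (c < w.re ∧ σ₁ * w.re < w.im ∧ w.im < σ₃ * w.re) := by
  set P : Set ℂ := {w | w.re < c ∨ w.im < σ₁ * w.re ∨ σ₃ * w.re < w.im} with hP
  set Q : Set ℂ := {w | c < w.re ∧ σ₁ * w.re < w.im ∧ w.im < σ₃ * w.re} with hQ
  have oP : IsOpen P := by
    have e1 := Complex.continuous_re
    have e2 := Complex.continuous_im
    exact (isOpen_lt e1 continuous_const).union
      ((isOpen_lt e2 (continuous_const.mul e1)).union (isOpen_lt (continuous_const.mul e1) e2))
  have oQ : IsOpen Q := by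
    have e1 := Complex.continuous_re
    have e2 := Complex.continuous_im
    exact (isOpen_lt continuous_const e1).inter
      ((isOpen_lt (continuous_const.mul e1) e2).inter (isOpen_lt e2 (continuous_const.mul e1)))
  have hdis : Disjoint P Q := by
    rw [Set.disjoint_left]
    rintro w (h | h | h) ⟨q1, q2, q3⟩ <;> linarith
  have hcov : W ⊆ P ∪ Q := by
    intro w hw
    by_contra hcon
    have hp : ¬ (w.re < c ∨ w.im < σ₁ * w.re ∨ σ₃ * w.re < w.im) := fun h ↦ hcon (Or.inl h)
    have hq : ¬ (c < w.re ∧ σ₁ * w.re < w.im ∧ w.im < σ₃ * w.re) := fun h ↦ hcon (Or.inr h)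
    push Not at hp
    obtain ⟨p1, p2, p3⟩ := hp
    rcases p1.eq_or_lt with h | h
    · exact h2 w hw h.symm ⟨p2, p3⟩
    · exact hq ⟨h, lt_of_le_of_ne p2 (h1 w hw p1).symm, lt_of_le_of_ne p3 (h3 w hw p1)⟩
  have hsub : W ⊆ P := hW.subset_left_of_subset_union oP oQ hdis hcov ⟨0, h0, Or.inl (by simpa)⟩
  intro w hw hq
  exact Set.disjoint_left.1 hdis (hsub hw) hq

theorem SL2_neg_smul (g : SL(2, ℝ)) (z : ℍ) : (-g) • z = g • z := by
  apply UpperHalfPlane.ext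
  rw [UpperHalfPlane.coe_specialLinearGroup_apply, UpperHalfPlane.coe_specialLinearGroup_apply]
  simp only [Matrix.SpecialLinearGroup.coe_neg, Matrix.neg_apply, map_neg, Complex.ofReal_neg]
  rw [neg_mul, neg_mul, ← neg_add, ← neg_add, neg_div_neg_eq]

/-- Equal boundary points mean that gh⁻¹ fixes infinity, so g = ±h. -/
theorem smul_I_eq_of_boundaryPoint_eq {Γ : Subgroup SL(2, ℝ)} {r : ℝ} (hr : 0 < r)
    (hrow : ∀ v ∈ rowSet Γ, r ≤ ‖v‖) (hinf : HorocycleInfinite Γ) {g h : SL(2, ℝ)} (hg : g ∈ Γ)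
    (hh : h ∈ Γ) (he : boundaryPoint g = boundaryPoint h) :
    (g • UpperHalfPlane.I : ℍ) = h • UpperHalfPlane.I := by
  rw [boundaryPoint, boundaryPoint, div_eq_div_iff (row_complex_ne_zero g).2
    (row_complex_ne_zero h).2] at he
  have him := congrArg Complex.im he
  simp at him
  obtain ⟨i0, i1, i2, i3⟩ := SL2_inv_apply h
  have h0 : (g * h⁻¹) 1 0 = 0 := by
    rw [SL2_mul_apply, i0, i2]
    linarith
  rcases eq_one_or_neg_one_of_apply_eq_zero hr hrow hinf (Γ.mul_mem hg (Γ.inv_mem hh)) h0 with h1 | h1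
  · rw [mul_inv_eq_one.1 h1]
  · have : g = -h := by
      rw [mul_inv_eq_iff_eq_mul] at h1
      rw [h1]
      simp
    rw [this, SL2_neg_smul]

/-- A finitely generated group has a bounded orbit, as soon as its lower rows stay away from zero
and it contains no unipotent fixing infinity. -/
theorem exists_norm_smul_I_le {Γ : Subgroup SL(2, ℝ)} [DiscreteTopology Γ] (hfg : Γ.FG) {r : ℝ}
    (hr : 0 < r) (hrow : ∀ v ∈ rowSet Γ, r ≤ ‖v‖) (hinf : HorocycleInfinite Γ) :
    ∃ R : ℝ, ∀ g ∈ Γ, ‖((g • UpperHalfPlane.I : ℍ) : ℂ)‖ ≤ R := by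
  by_contra! hcon
  set B := 1 / r ^ 2 with hB
  have hBle : ∀ g ∈ Γ, (g • UpperHalfPlane.I : ℍ).im ≤ B := fun g hg ↦ im_smul_I_le hr hrow hg
  have hub : ∀ T : ℝ, ∃ g ∈ Γ, T < |(g • UpperHalfPlane.I : ℍ).re| := by
    intro T
    obtain ⟨g, hg, h⟩ := hcon (T + B)
    refine ⟨g, hg, ?_⟩
    have h1 := Complex.norm_le_abs_re_add_abs_im ((g • UpperHalfPlane.I : ℍ) : ℂ)
    rw [UpperHalfPlane.coe_re, UpperHalfPlane.coe_im,
      abs_of_pos (g • UpperHalfPlane.I : ℍ).im_pos] at h1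
    linarith [hBle g hg]
  obtain ⟨ρ, hρ, hconn⟩ := isPreconnected_iUnion_discBall hfg
  set W : Set ℂ := ⋃ g : Γ, discBall ((g : SL(2, ℝ)) • UpperHalfPlane.I) ρ with hW
  have hWmem : ∀ w, w ∈ W ↔ ∃ g ∈ Γ, w ∈ discBall (g • UpperHalfPlane.I) ρ := by
    intro w
    simp [hW]
  have hcayW : ∀ g ∈ Γ, cay (g • UpperHalfPlane.I : ℍ) ∈ W := by
    intro g hg
    rw [hWmem]
    exact ⟨g, hg, by rw [cay_mem_discBall hρ.le, dist_self]; exact hρ⟩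
  have h0W : (0 : ℂ) ∈ W := by
    have h := hcayW 1 Γ.one_mem
    rw [one_smul] at h
    simpa [cay] using h
  obtain ⟨M, hM, hgood⟩ := exists_ray_avoiding_orbit hρ hBle hub
  set c := (M - 1) / (M + 1) with hc
  have hc0 : 0 < c := div_pos (by linarith) (by linarith)
  have hc1 : c < 1 := (div_lt_one (by linarith)).2 (by linarith)
  set G : Set SL(2, ℝ) := {g | g ∈ Γ ∧ ∀ g' ∈ Γ, ∀ z : ℍ, z.re = (g • UpperHalfPlane.I : ℍ).re →
        M * (g • UpperHalfPlane.I : ℍ).im ≤ z.im → ρ ≤ dist z (g' • UpperHalfPlane.I)} with hG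
  have hGray : ∀ g ∈ G, ∀ x : ℝ, c ≤ x → (x : ℂ) * boundaryPoint g ∉ W := by
    intro g hg x hx hmem
    obtain ⟨g', hg', h⟩ := (hWmem _).1 hmem
    exact boundaryPoint_ray_not_mem hρ hM hg.1 hg.2 hx hg' h
  -- Finitely many endpoints would give finitely many orbit points gi with g in `G`, but these have
  -- unbounded real part.
  have hΘ : (boundaryPoint '' G).Infinite := by
    intro hfin
    have hfin' : ((fun g : SL(2, ℝ) ↦ (g • UpperHalfPlane.I : ℍ)) '' G).Finite := by
      classical
      refine (hfin.image fun e ↦ if h : ∃ g ∈ G, boundaryPoint g = e then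
        h.choose • UpperHalfPlane.I else UpperHalfPlane.I).subset ?_
      rintro _ ⟨g, hg, rfl⟩
      refine ⟨boundaryPoint g, ⟨g, hg, rfl⟩, ?_⟩
      have h : ∃ g' ∈ G, boundaryPoint g' = boundaryPoint g := ⟨g, hg, rfl⟩
      simp only [dif_pos h]
      exact smul_I_eq_of_boundaryPoint_eq hr hrow hinf h.choose_spec.1.1 hg.1 h.choose_spec.2
    obtain ⟨T, hT⟩ := (hfin'.image fun z : ℍ ↦ |z.re|).bddAbove
    obtain ⟨g, hg, hlt, hray⟩ := hgood T
    have := hT ⟨_, ⟨g, ⟨hg, hray⟩, rfl⟩, rfl⟩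
    simp only at this
    linarith
  obtain ⟨e, he, hacc⟩ := hΘ.exists_accPt_of_subset_isCompact (isCompact_sphere (0 : ℂ) 1) (by
    rintro _ ⟨g, -, rfl⟩
    simp [norm_boundaryPoint])
  have he1 : ‖e‖ = 1 := by simpa using he
  have hee : e * (starRingEnd ℂ) e = 1 := by
    rw [Complex.mul_conj, Complex.normSq_eq_norm_sq, he1]
    simp
  -- Rotates the accumulation point e of the endpoints to 1, so that radii near e can be
  -- parametrised by their slopes.
  set T : ℂ → ℂ := fun w ↦ w * (starRingEnd ℂ) e with hTdef
  have hTc : Continuous T := continuous_id.mul continuous_const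
  have hTn : ∀ w, ‖T w‖ = ‖w‖ := fun w ↦ by simp [hTdef, he1]
  have hTe : ∀ w, e * T w = w := fun w ↦ by
    simp only [hTdef]
    linear_combination w * hee
  have hTe' : ∀ w, T (e * w) = w := fun w ↦ by
    simp only [hTdef]
    linear_combination w * hee
  have hTinj : Function.Injective T := fun a b hab ↦ by rw [← hTe a, ← hTe b, hab]
  set V : Set ℂ := {w | (1 + c) / 2 < (T w).re} with hV
  have hVn : V ∈ 𝓝 e := by
    apply (isOpen_lt continuous_const (Complex.continuous_re.comp hTc)).mem_nhds
    change (1 + c) / 2 < (T e).re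
    simp only [hTdef, hee, Complex.one_re]
    linarith
  have hinfΘ : (V ∩ boundaryPoint '' G).Infinite := Set.Infinite.of_accPt (hacc.nhds_inter hVn)
  set slope : ℂ → ℝ := fun w ↦ (T w).im / (T w).re with hslope
  have hinj : Set.InjOn slope (V ∩ boundaryPoint '' G) := by
    rintro a ⟨haV, g, hg, rfl⟩ b ⟨hbV, h, hh, rfl⟩ hab
    apply hTinj
    have na := hTn (boundaryPoint g)
    have nb := hTn (boundaryPoint h)
    rw [norm_boundaryPoint] at na nb
    have pa : 0 < (T (boundaryPoint g)).re := lt_trans (by linarith) haV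
    have pb : 0 < (T (boundaryPoint h)).re := lt_trans (by linarith) hbV
    have hab' : (T (boundaryPoint g)).im / (T (boundaryPoint g)).re =
      (T (boundaryPoint h)).im / (T (boundaryPoint h)).re := hab
    rw [div_eq_div_iff pa.ne' pb.ne'] at hab'
    have sa : (T (boundaryPoint g)).re ^ 2 + (T (boundaryPoint g)).im ^ 2 = 1 := by
      rw [← one_pow 2, ← na, ← Complex.normSq_eq_norm_sq, Complex.normSq_apply]
      ring
    have sb : (T (boundaryPoint h)).re ^ 2 + (T (boundaryPoint h)).im ^ 2 = 1 := by
      rw [← one_pow 2, ← nb, ← Complex.normSq_eq_norm_sq, Complex.normSq_apply]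
      ring
    generalize T (boundaryPoint g) = u at *
    generalize T (boundaryPoint h) = v at *
    have hre : u.re = v.re := by
      have : u.re ^ 2 = v.re ^ 2 := by
        linear_combination v.re ^ 2 * sa - u.re ^ 2 * sb -
          (u.im * v.re + v.im * u.re) * hab'
      exact (pow_left_inj₀ pa.le pb.le two_ne_zero).1 this
    apply Complex.ext hre
    rw [hre] at hab'
    exact mul_right_cancel₀ pb.ne' hab'
  set Z := slope '' (V ∩ boundaryPoint '' G) with hZ
  have hZinf : Z.Infinite := hinfΘ.image hinj
  have hTray : ∀ g ∈ G, boundaryPoint g ∈ V → ∀ w ∈ T '' W, c ≤ w.re →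
      w.im ≠ slope (boundaryPoint g) * w.re := by
    rintro g hg hgV _ ⟨w, hw, rfl⟩ hcw him
    have pa : 0 < (T (boundaryPoint g)).re := lt_trans (by linarith) hgV
    have pa1 : (T (boundaryPoint g)).re ≤ 1 := by
      have := Complex.re_le_norm (T (boundaryPoint g))
      rwa [hTn, norm_boundaryPoint] at this
    refine hGray g hg ((T w).re / (T (boundaryPoint g)).re) ?_ ?_
    · rw [le_div_iff₀ pa]
      nlinarith
    · convert hw using 1
      apply hTinj
      have : T (((T w).re / (T (boundaryPoint g)).re : ℝ) * boundaryPoint g) =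
          ((T w).re / (T (boundaryPoint g)).re : ℝ) * T (boundaryPoint g) := by
        simp only [hTdef]
        ring
      rw [this]
      apply Complex.ext
      · rw [Complex.re_ofReal_mul]
        field_simp
      · rw [Complex.im_ofReal_mul, him, hslope]
        simp only
        ring
  -- In `V` the rotated endpoints have real part above (1 + c)/2. Their radii therefore cross the
  -- line Re = c at modulus below 2c/(1 + c) < 1, in a compact part of the disc met by finitely many
  -- balls only.
  set q := (2 * c / (1 + c)) ^ 2 with hq
  have hq1 : q < 1 := by
    have : 2 * c / (1 + c) < 1 := (div_lt_one (by linarith)).2 (by linarith)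
    have h0 : 0 ≤ 2 * c / (1 + c) := by positivity
    rw [hq]
    nlinarith
  have hFin := finite_discBall_meets Γ hρ.le hq1
  set line : ℝ → ℂ := fun σ ↦ e * ⟨c, σ * c⟩ with hline
  have hlineq : ∀ σ, Complex.normSq (line σ) = c ^ 2 * (1 + σ ^ 2) := by
    intro σ
    simp only [hline]
    rw [Complex.normSq_mul, Complex.normSq_eq_norm_sq e, he1, Complex.normSq_mk]
    ring
  have hZq : ∀ σ ∈ Z, Complex.normSq (line σ) ≤ q := by
    rintro _ ⟨_, ⟨haV, g, hg, rfl⟩, rfl⟩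
    have na := hTn (boundaryPoint g)
    rw [norm_boundaryPoint] at na
    have haV' : (1 + c) / 2 < (T (boundaryPoint g)).re := haV
    have pa : 0 < (T (boundaryPoint g)).re := lt_trans (by linarith) haV
    have sa : (T (boundaryPoint g)).re ^ 2 + (T (boundaryPoint g)).im ^ 2 = 1 := by
      rw [← one_pow 2, ← na, ← Complex.normSq_eq_norm_sq, Complex.normSq_apply]
      ring
    rw [hlineq, hslope, hq]
    simp only
    have e1 : 1 + ((T (boundaryPoint g)).im / (T (boundaryPoint g)).re) ^ 2 =
        (1 / (T (boundaryPoint g)).re) ^ 2 := by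
      field_simp
      exact sa
    rw [e1, ← mul_pow]
    apply pow_le_pow_left₀ (by positivity)
    rw [mul_one_div, div_le_div_iff₀ pa (by linarith)]
    nlinarith
  -- Each of these balls cuts the transversal in an interval of slopes that contains no slope in
  -- `Z`. After thinning, `W` does not meet the transversal between any two slopes of `Z'`.
  obtain ⟨Z', hZ'Z, hZ'inf, hZ'⟩ := exists_infinite_subset_avoiding hFin
    (fun g ↦ {σ | line σ ∈ discBall (g • UpperHalfPlane.I) ρ}) (by
      intro g hg
      refine Convex.ordConnected fun x hx y hy a b ha hb hab ↦ ?_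
      have : line (a • x + b • y) = a • line x + b • line y := by
        simp only [hline]
        rw [← mul_smul_comm, ← mul_smul_comm, ← mul_add]
        congr 1
        apply Complex.ext
        · simp
          linear_combination (-c) * hab
        · simp
          ring
      change line (a • x + b • y) ∈ discBall (g • UpperHalfPlane.I) ρ
      rw [this]
      exact convex_discBall _ _ hx hy ha hb hab) hZinf (by
      rintro g ⟨hg, -⟩ _ ⟨_, ⟨haV, g', hg', rfl⟩, rfl⟩ hmem
      have := hTray g' hg' haV (T (line (slope (boundaryPoint g'))))
        ⟨_, (hWmem _).2 ⟨g, hg, hmem⟩, rfl⟩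
      rw [hline] at this
      simp only [hTe'] at this
      exact this le_rfl rfl)
  -- The outer two slopes and the transversal bound a sector that `W` cannot enter; the middle slope
  -- supplies an endpoint in its interior.
  obtain ⟨t, htZ, htc⟩ := hZ'inf.exists_subset_card_eq 3
  set o := t.orderEmbOfFin htc with ho
  have hoZ : ∀ i, o i ∈ Z' := fun i ↦ htZ (t.orderEmbOfFin_mem htc i)
  have h01 : o 0 < o 1 := o.lt_iff_lt.2 (by decide)
  have h12 : o 1 < o 2 := o.lt_iff_lt.2 (by decide)
  have hsector := not_mem_of_mem_truncated_sector (hconn.image T hTc.continuousOn)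
    ⟨0, h0W, by simp [hTdef]⟩ (σ₁ := o 0) (σ₃ := o 2) hc0 (by
      obtain ⟨_, ⟨haV, g, hg, rfl⟩, h⟩ := hZ'Z (hoZ 0)
      rw [← h]
      exact hTray g hg haV) (by
      obtain ⟨_, ⟨haV, g, hg, rfl⟩, h⟩ := hZ'Z (hoZ 2)
      rw [← h]
      exact hTray g hg haV) (by
      rintro _ ⟨w, hw, rfl⟩ hre ⟨hl, hu⟩
      obtain ⟨g, hg, hmem⟩ := (hWmem _).1 hw
      have hle : line ((T w).im / c) = w := by
        rw [← hTe w, hline]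
        simp only
        congr 1
        apply Complex.ext
        · simp [hre]
        · simp [hTe]
          field_simp
      rw [hre] at hl hu
      have hl' : o 0 ≤ (T w).im / c := (le_div_iff₀ hc0).2 hl
      have hu' : (T w).im / c ≤ o 2 := (div_le_iff₀ hc0).2 hu
      refine hZ' g ⟨hg, w, hmem, ?_⟩ _ (hoZ 0) _ (hoZ 2) _ ⟨hl', hu'⟩ (by
        change line ((T w).im / c) ∈ discBall (g • UpperHalfPlane.I) ρ
        rwa [hle])
      rw [← hle, hlineq]
      have b0 := hZq _ (hZ'Z (hoZ 0))
      have b2 := hZq _ (hZ'Z (hoZ 2))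
      rw [hlineq] at b0 b2
      have hc2 : 0 < c ^ 2 := by positivity
      rcases le_total 0 ((T w).im / c) with hs | hs
      · refine le_trans (mul_le_mul_of_nonneg_left ?_ hc2.le) b2
        nlinarith
      · refine le_trans (mul_le_mul_of_nonneg_left ?_ hc2.le) b0
        nlinarith)
  obtain ⟨_, ⟨haV, g, hg, rfl⟩, hslope1⟩ := hZ'Z (hoZ 1)
  have pa : (1 + c) / 2 < (T (boundaryPoint g)).re := haV
  have hopen : IsOpen {w : ℂ | c < (T w).re ∧ o 0 * (T w).re < (T w).im ∧
      (T w).im < o 2 * (T w).re} := by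
    have e1 := Complex.continuous_re.comp hTc
    have e2 := Complex.continuous_im.comp hTc
    exact (isOpen_lt continuous_const e1).inter
      ((isOpen_lt (continuous_const.mul e1) e2).inter (isOpen_lt e2 (continuous_const.mul e1)))
  have hmem1 : boundaryPoint g ∈ {w : ℂ | c < (T w).re ∧ o 0 * (T w).re < (T w).im ∧
      (T w).im < o 2 * (T w).re} := by
    have p0 : 0 < (T (boundaryPoint g)).re := by linarith
    have him : (T (boundaryPoint g)).im = o 1 * (T (boundaryPoint g)).re := by
      rw [← hslope1, hslope]
      field_simp
    refine ⟨by linarith, ?_, ?_⟩ <;> rw [him] <;> exact mul_lt_mul_of_pos_right (by assumption) p0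
  obtain ⟨η, hη, hball⟩ := Metric.isOpen_iff.1 hopen _ hmem1
  set p : ℍ := g • UpperHalfPlane.I with hp
  -- The distance of cay(g⁻¹z) from `boundaryPoint g` is 2 Im p / |z - p̄|, so an orbit point z this
  -- far out would land in the forbidden ball of radius η.
  obtain ⟨g', hg', hfar⟩ := hcon (2 * p.im / η + ‖(p : ℂ)‖)
  set z : ℍ := g' • UpperHalfPlane.I with hz
  have hnot : cay (g⁻¹ • z : ℍ) ∉ Metric.ball (boundaryPoint g) η := by
    intro hb
    refine hsector _ ⟨_, hcayW (g⁻¹ * g') (Γ.mul_mem (Γ.inv_mem hg.1) hg'), rfl⟩ ?_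
    rw [mul_smul]
    exact hball hb
  have hzp : ((z : ℂ) - (starRingEnd ℂ) (p : ℂ)) ≠ 0 := by
    intro h0
    have := congrArg Complex.im h0
    simp at this
    linarith [z.im_pos, p.im_pos]
  have hnorm : ‖(z : ℂ) - (starRingEnd ℂ) (p : ℂ)‖ * η ≤ 2 * p.im := by
    rw [Metric.mem_ball, not_lt, dist_eq_norm, cay_inv_smul, ← hp] at hnot
    have e3 : boundaryPoint g * (((z : ℂ) - p) / ((z : ℂ) - (starRingEnd ℂ) (p : ℂ))) -
        boundaryPoint g = boundaryPoint g *
          ((-(2 * p.im : ℝ) * Complex.I) / ((z : ℂ) - (starRingEnd ℂ) (p : ℂ))) := by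
      have e4 : (-(2 * p.im : ℝ) * Complex.I : ℂ) = (starRingEnd ℂ) (p : ℂ) - p := by
        apply Complex.ext <;> simp
        ring
      rw [e4]
      field_simp
      ring
    rw [e3, norm_mul, norm_boundaryPoint, one_mul, norm_div, le_div_iff₀ (norm_pos_iff.2 hzp)]
      at hnot
    have e5 : ‖(-(2 * p.im : ℝ) * Complex.I : ℂ)‖ = 2 * p.im := by
      rw [norm_mul, norm_neg, Complex.norm_real, Complex.norm_I, mul_one, Real.norm_eq_abs,
        abs_of_pos (by linarith [p.im_pos])]
    rw [e5] at hnot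
    linarith
  rw [← le_div_iff₀ hη] at hnorm
  have h5 := norm_sub_norm_le (z : ℂ) ((starRingEnd ℂ) (p : ℂ))
  rw [Complex.norm_conj] at h5
  linarith

/-! ### A neighbourhood of infinity that injects into the quotient -/

/-- Isometric circles: gz = a/c - 1/(c²(z + d/c)), and |z + d/c| ≥ 1 when |z| > R. -/
theorem norm_smul_le_of_lt_norm {g : SL(2, ℝ)} (hc : g 1 0 ≠ 0) {R : ℝ}
    (hR : |g 0 0 / g 1 0| + |g 1 1 / g 1 0| + 1 / g 1 0 ^ 2 + 1 ≤ R) {z : ℍ} (hz : R < ‖(z : ℂ)‖) :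
    ‖((g • z : ℍ) : ℂ)‖ ≤ R := by
  have hdet := SL2_det g
  have hcC : (g 1 0 : ℂ) ≠ 0 := by exact_mod_cast hc
  have hden : (z : ℂ) + (g 1 1 / g 1 0 : ℝ) ≠ 0 := by
    intro h0
    have := congrArg Complex.im h0
    simp at this
    exact z.im_ne_zero this
  have e : ((g • z : ℍ) : ℂ) = (g 0 0 / g 1 0 : ℝ) -
      (1 / g 1 0 ^ 2 : ℝ) / ((z : ℂ) + (g 1 1 / g 1 0 : ℝ)) := by
    rw [UpperHalfPlane.coe_specialLinearGroup_apply]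
    simp only [Algebra.algebraMap_self, RingHom.id_apply]
    have hdetC : (g 0 0 : ℂ) * g 1 1 - g 0 1 * g 1 0 = 1 := by exact_mod_cast hdet
    push_cast at hden ⊢
    have hd2 : (g 1 0 : ℂ) * z + g 1 1 ≠ 0 := by
      intro h0
      apply hden
      field_simp
      linear_combination h0
    have hd3 : (z : ℂ) + g 1 1 / g 1 0 = (g 1 0 * z + g 1 1) / g 1 0 := by
      field_simp
    rw [hd3, div_div_eq_mul_div, eq_sub_iff_add_eq, ← add_div, div_eq_div_iff hd2 hcC]
    field_simp
    linear_combination (-1 : ℂ) * hdetC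
  have h1 : 1 ≤ ‖(z : ℂ) + (g 1 1 / g 1 0 : ℝ)‖ := by
    have h2 := norm_sub_le ((z : ℂ) + (g 1 1 / g 1 0 : ℝ)) ((g 1 1 / g 1 0 : ℝ) : ℂ)
    rw [add_sub_cancel_right, Complex.norm_real, Real.norm_eq_abs] at h2
    have h3 : 0 ≤ 1 / g 1 0 ^ 2 := by positivity
    linarith [abs_nonneg (g 0 0 / g 1 0)]
  rw [e]
  refine (norm_sub_le _ _).trans ?_
  rw [norm_div, Complex.norm_real, Complex.norm_real, Real.norm_eq_abs, Real.norm_eq_abs]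
  have h3 : 0 ≤ 1 / g 1 0 ^ 2 := by positivity
  have h4 := div_le_self h3 h1
  rw [abs_of_nonneg h3]
  linarith [abs_nonneg (g 1 1 / g 1 0)]

/-- If the orbit of `i` is bounded then infinity has a neighbourhood which is precisely invariant
under the trivial group. -/
theorem exists_forall_lt_norm_imp_eq_one {Γ : Subgroup SL(2, ℝ)} [DiscreteTopology Γ] {R₀ : ℝ}
    (hR₀ : ∀ g ∈ Γ, ‖((g • UpperHalfPlane.I : ℍ) : ℂ)‖ ≤ R₀)
    (hstab : ∀ g ∈ Γ, g 1 0 = 0 → g = 1 ∨ g = -1) :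
    ∃ R : ℝ, 1 ≤ R ∧ ∀ g ∈ Γ, ∀ z : ℍ, R < ‖(z : ℂ)‖ → R < ‖((g • z : ℍ) : ℂ)‖ →
      g = 1 ∨ g = -1 := by
  set K := 1 + R₀ ^ 2 with hK
  have hK1 : 1 ≤ K := by nlinarith [sq_nonneg R₀]
  set S : SL(2, ℝ) → ℝ := fun g ↦ g 0 0 ^ 2 + g 0 1 ^ 2 + g 1 0 ^ 2 + g 1 1 ^ 2 with hS
  have hrow : ∀ g ∈ Γ, S g ≤ K * (g 1 0 ^ 2 + g 1 1 ^ 2) := by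
    intro g hg
    have h1 := pow_le_pow_left₀ (norm_nonneg _) (hR₀ g hg) 2
    rw [← Complex.normSq_eq_norm_sq, normSq_smul_I, div_le_iff₀ (row_sq_pos g)] at h1
    simp only [hS, hK]
    linarith
  have hcol : ∀ g ∈ Γ, S g ≤ K * (g 0 0 ^ 2 + g 1 0 ^ 2) := by
    intro g hg
    have h1 := hrow g⁻¹ (Γ.inv_mem hg)
    obtain ⟨i0, i1, i2, i3⟩ := SL2_inv_apply g
    simp only [hS, i0, i1, i2, i3] at h1 ⊢
    linarith
  -- Multiply the row and column bounds. Since ad - bc = 1, (a² + c²)(c² + d²) = c²S + 1 + 2bc,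
  -- which is at most (|c|√S + 1)².
  have hkey : ∀ g ∈ Γ, S g ≤ K * (|g 1 0| * √(S g) + 1) := by
    intro g hg
    have hS0 : 0 ≤ S g := by positivity
    have hsq := Real.sq_sqrt hS0
    have h01 : |g 0 1| ≤ √(S g) := Real.abs_le_sqrt (by
      simp only [hS]
      nlinarith [sq_nonneg (g 0 0), sq_nonneg (g 1 0), sq_nonneg (g 1 1)])
    have h2 : (g 0 0 ^ 2 + g 1 0 ^ 2) * (g 1 0 ^ 2 + g 1 1 ^ 2) ≤ (|g 1 0| * √(S g) + 1) ^ 2 := by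
      have hdet := SL2_det g
      have e1 : (g 0 0 ^ 2 + g 1 0 ^ 2) * (g 1 0 ^ 2 + g 1 1 ^ 2) =
          g 1 0 ^ 2 * S g + 1 + 2 * (g 0 1 * g 1 0) := by
        simp only [hS]
        linear_combination (g 0 0 * g 1 1 + g 0 1 * g 1 0 + 1) * hdet
      have e2 : g 0 1 * g 1 0 ≤ |g 1 0| * √(S g) := by
        calc g 0 1 * g 1 0 ≤ |g 0 1 * g 1 0| := le_abs_self _
          _ = |g 1 0| * |g 0 1| := by rw [abs_mul, mul_comm]
          _ ≤ _ := mul_le_mul_of_nonneg_left h01 (abs_nonneg _)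
      have e3 : (|g 1 0| * √(S g) + 1) ^ 2 = g 1 0 ^ 2 * S g + 2 * (|g 1 0| * √(S g)) + 1 := by
        rw [add_sq, mul_pow, sq_abs, hsq]
        ring
      rw [e1, e3]
      linarith
    have h3 : S g ^ 2 ≤ (K * (|g 1 0| * √(S g) + 1)) ^ 2 := by
      calc S g ^ 2 = S g * S g := sq _
        _ ≤ (K * (g 0 0 ^ 2 + g 1 0 ^ 2)) * (K * (g 1 0 ^ 2 + g 1 1 ^ 2)) :=
          mul_le_mul (hcol g hg) (hrow g hg) hS0 (by positivity)
        _ = K ^ 2 * ((g 0 0 ^ 2 + g 1 0 ^ 2) * (g 1 0 ^ 2 + g 1 1 ^ 2)) := by ring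
        _ ≤ K ^ 2 * (|g 1 0| * √(S g) + 1) ^ 2 := mul_le_mul_of_nonneg_left h2 (by positivity)
        _ = _ := by ring
    exact (sq_le_sq₀ hS0 (by positivity)).1 h3
  set ρ : SL(2, ℝ) → ℝ := fun g ↦ |g 0 0 / g 1 0| + |g 1 1 / g 1 0| + 1 / g 1 0 ^ 2 + 1 with hρ
  have hfin : {g : SL(2, ℝ) | g ∈ Γ ∧ S g ≤ 2 * K}.Finite := by
    refine (finite_of_bounded_entries Γ (2 * K)).subset ?_
    rintro g ⟨hg, h⟩
    refine ⟨hg, fun i j ↦ ?_⟩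
    apply abs_le_of_sq_le_sq _ (by linarith)
    simp only [hS] at h
    fin_cases i <;> fin_cases j <;> simp <;>
      nlinarith [sq_nonneg (g 0 0), sq_nonneg (g 0 1), sq_nonneg (g 1 0), sq_nonneg (g 1 1)]
  obtain ⟨R₁, hR₁⟩ := (hfin.image ρ).bddAbove
  -- If S > 2K then √S ≤ 2K|c|, so |a/c|, |d/c| and 1/c² are each at most 2K, whence 6K + 1. The
  -- finitely many g with S ≤ 2K are covered by `R₁`.
  refine ⟨max (max 1 R₁) (6 * K + 1), le_max_of_le_left (le_max_left _ _), fun g hg z hz hgz ↦ ?_⟩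
  by_cases hc : g 1 0 = 0
  · exact hstab g hg hc
  exfalso
  refine absurd (norm_smul_le_of_lt_norm hc ?_ hz) (not_le.2 hgz)
  rcases le_or_gt (S g) (2 * K) with h | h
  · exact le_max_of_le_left (le_max_of_le_right (hR₁ ⟨g, ⟨hg, h⟩, rfl⟩))
  · apply le_max_of_le_right
    have hS0 : 0 < S g := by linarith
    have hsq := Real.sq_sqrt hS0.le
    have hs0 : 0 < √(S g) := Real.sqrt_pos.2 hS0
    have h1 := hkey g hg
    have hcp : 0 < |g 1 0| := abs_pos.2 hc
    have h2 : √(S g) ≤ 2 * K * |g 1 0| := by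
      have h3 : √(S g) * √(S g) ≤ (2 * K * |g 1 0|) * √(S g) := by nlinarith
      exact le_of_mul_le_mul_right h3 hs0
    have ha : |g 0 0 / g 1 0| ≤ 2 * K := by
      rw [abs_div, div_le_iff₀ hcp]
      refine le_trans (Real.abs_le_sqrt ?_) h2
      simp only [hS]
      nlinarith [sq_nonneg (g 0 1), sq_nonneg (g 1 0), sq_nonneg (g 1 1)]
    have hd : |g 1 1 / g 1 0| ≤ 2 * K := by
      rw [abs_div, div_le_iff₀ hcp]
      refine le_trans (Real.abs_le_sqrt ?_) h2
      simp only [hS]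
      nlinarith [sq_nonneg (g 0 1), sq_nonneg (g 1 0), sq_nonneg (g 0 0)]
    have hcc : 1 / g 1 0 ^ 2 ≤ 2 * K := by
      have hc2 : 0 < g 1 0 ^ 2 := by positivity
      rw [div_le_iff₀ hc2]
      have h3 : S g ≤ (2 * K) ^ 2 * g 1 0 ^ 2 := by
        rw [← hsq, ← sq_abs (g 1 0), ← mul_pow]
        exact pow_le_pow_left₀ hs0.le h2 2
      nlinarith
    linarith

theorem exists_radius (Γ : Subgroup SL(2, ℝ)) [DiscreteTopology Γ] (hfg : Γ.FG)
    (hδ : 1 / 2 < criticalExponent Γ) (hclosed : HorocycleClosed Γ) (hinf : HorocycleInfinite Γ) :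
    ∃ R : ℝ, 1 ≤ R ∧ ∀ g ∈ Γ, ∀ z : ℍ, R < ‖(z : ℂ)‖ → R < ‖((g • z : ℍ) : ℂ)‖ →
      ∀ w : ℍ, g • w = w := by
  obtain ⟨r, hr, hrow⟩ := exists_le_norm_rowSet
    (fun r hr M ↦ finite_rowSet_annulus hclosed hr M) hδ
  obtain ⟨R₀, hR₀⟩ := exists_norm_smul_I_le hfg hr hrow hinf
  obtain ⟨R, hR1, hR⟩ := exists_forall_lt_norm_imp_eq_one hR₀
    fun g hg hc ↦ eq_one_or_neg_one_of_apply_eq_zero hr hrow hinf hg hc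
  refine ⟨R, hR1, fun g hg z h1 h2 w ↦ ?_⟩
  rcases hR g hg z h1 h2 with rfl | rfl
  · exact one_smul _ _
  · rw [SL2_neg_smul, one_smul]

/-! ### Unfolding the L² norm -/

open MeasureTheory Pointwise in
-- Distinct transformations move `U` to disjoint sets, so moving the pieces of `U` into `F` covers
-- each point of `F` at most once.
theorem setLIntegral_le_of_precisely_invariant {Γ : Subgroup SL(2, ℝ)} [DiscreteTopology Γ]
    {F : Set ℍ} (hF : IsFundDomain Γ F) {f : ℍ → ENNReal} (hf : ∀ g ∈ Γ, ∀ z : ℍ, f (g • z) = f z)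
    {U : Set ℍ} (hU : MeasurableSet U)
    (hinv : ∀ g ∈ Γ, ∀ z ∈ U, g • z ∈ U → ∀ w : ℍ, g • w = w) :
    ∫⁻ z in U, f z ≤ ∫⁻ z in F, f z := by
  have hmem : ∀ g : transformationGroup Γ, ∃ γ ∈ Γ, ∀ z : ℍ, g • z = γ • z := by
    rintro ⟨_, γ, hγ, rfl⟩
    exact ⟨γ, hγ, fun z ↦ rfl⟩
  have hcont : ∀ g : transformationGroup Γ, Measurable fun z : ℍ ↦ g • z := by
    intro g
    obtain ⟨γ, -, h⟩ := hmem g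
    simp only [h]
    exact (isometry_smul ℍ γ).continuous.measurable
  have : Countable Γ := countable_of_discrete Γ
  have : Countable (transformationGroup Γ) := by
    have h : Function.Surjective fun γ : Γ ↦
        (⟨MulAction.toPermHom SL(2, ℝ) ℍ γ, ⟨γ, γ.2, rfl⟩⟩ : transformationGroup Γ) := by
      rintro ⟨_, γ, hγ, rfl⟩
      exact ⟨⟨γ, hγ⟩, rfl⟩
    exact h.countable
  have : MeasurableConstSMul (transformationGroup Γ) ℍ := ⟨hcont⟩
  have : SMulInvariantMeasure (transformationGroup Γ) ℍ volume := by
    refine ⟨fun g s hs ↦ ?_⟩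
    obtain ⟨γ, -, h⟩ := hmem g
    simp only [h]
    exact measure_preimage_smul (μ := (volume : Measure ℍ))
      (Matrix.SpecialLinearGroup.toGL γ : GL (Fin 2) ℝ) s
  have hF' : IsFundamentalDomain (transformationGroup Γ) F (volume : Measure ℍ) := hF
  rw [hF'.setLIntegral_eq_tsum' f U]
  have hmeas : ∀ g : transformationGroup Γ, MeasurableSet (g • U) := fun g ↦ hU.const_smul g
  have e1 : ∀ g : transformationGroup Γ, ∫⁻ x in g • U ∩ F, f (g⁻¹ • x) =
      ∫⁻ x in g • U, f x ∂(volume.restrict F) := by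
    intro g
    obtain ⟨γ, hγ, h⟩ := hmem g⁻¹
    rw [Measure.restrict_restrict (hmeas g)]
    simp only [h, hf γ hγ]
  simp only [e1]
  rw [← lintegral_iUnion hmeas]
  · exact setLIntegral_le_lintegral _ _
  · intro g g' hne
    rw [Function.onFun, Set.disjoint_left]
    rintro z ⟨u, hu, rfl⟩ ⟨v, hv, hvz⟩
    apply hne
    simp only at hvz
    obtain ⟨γ, hγ, h⟩ := hmem (g'⁻¹ * g)
    have h1 : γ • u = v := by rw [← h, mul_smul, ← hvz, inv_smul_smul]
    have h2 : g'⁻¹ * g = 1 := by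
      apply Subtype.ext
      apply Equiv.ext
      intro w
      have := h w
      rw [hinv γ hγ u hu (h1 ▸ hv) w] at this
      exact this
    exact (inv_mul_eq_one.1 h2).symm

open MeasureTheory in
-- Passes from hyperbolic area to Lebesgue measure on ℂ, with density 1/y², where the analysis takes
-- place.
theorem integrableOn_normSq_div_im_sq {φ : ℍ → ℂ}
    (hφ : ContinuousOn (fun w : ℂ ↦ φ (UpperHalfPlane.ofComplex w)) {w : ℂ | 0 < w.im}) {R : ℝ}
    (hfin : ∫⁻ z in {z : ℍ | R < ‖(z : ℂ)‖}, ‖φ z‖ₑ ^ 2 < ⊤) :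
    IntegrableOn (fun w : ℂ ↦ ‖φ (UpperHalfPlane.ofComplex w)‖ ^ 2 / w.im ^ 2)
      {w : ℂ | 0 < w.im ∧ R < ‖w‖} := by
  set V := {w : ℂ | 0 < w.im ∧ R < ‖w‖} with hV
  have hVo : IsOpen V := (isOpen_lt continuous_const Complex.continuous_im).inter
    (isOpen_lt continuous_const continuous_norm)
  have himage : V = UpperHalfPlane.coe '' {z : ℍ | R < ‖(z : ℂ)‖} := by
    ext w
    constructor
    · rintro ⟨h, h'⟩
      exact ⟨⟨w, h⟩, h', rfl⟩
    · rintro ⟨z, h, rfl⟩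
      exact ⟨z.im_pos, h⟩
  have hemb := UpperHalfPlane.measurableEmbedding_coe
  have hcts : ContinuousOn (fun w : ℂ ↦ ‖φ (UpperHalfPlane.ofComplex w)‖ ^ 2 / w.im ^ 2) V := by
    apply ContinuousOn.div
    · exact ((hφ.mono fun w hw ↦ hw.1).norm).pow 2
    · exact (Complex.continuous_im.pow 2).continuousOn
    · exact fun w hw ↦ pow_ne_zero 2 hw.1.ne'
  have hφc : Continuous φ := by
    have h : φ = (fun w : ℂ ↦ φ (UpperHalfPlane.ofComplex w)) ∘ UpperHalfPlane.coe := by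
      ext z
      simp
    rw [h]
    exact hφ.comp_continuous UpperHalfPlane.continuous_coe fun z ↦ z.im_pos
  refine ⟨hcts.aestronglyMeasurable hVo.measurableSet, ?_⟩
  rw [hasFiniteIntegral_iff_enorm]
  refine lt_of_eq_of_lt ?_ hfin
  have hpres : MeasurePreserving UpperHalfPlane.coe (volume.comap UpperHalfPlane.coe)
      (volume.restrict (.range UpperHalfPlane.coe)) :=
    ⟨UpperHalfPlane.measurable_coe, by rw [hemb.map_comap]⟩
  have hUm : MeasurableSet {z : ℍ | R < ‖(z : ℂ)‖} :=
    (isOpen_lt continuous_const UpperHalfPlane.continuous_coe.norm).measurableSet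
  have hdens : Measurable fun z : ℍ ↦
      (((1 / NNReal.mk z.im z.im_pos.le : NNReal) ^ 2 : NNReal) : ENNReal) := by
    apply Measurable.coe_nnreal_ennreal
    apply Measurable.pow_const
    apply Measurable.div measurable_const
    exact (UpperHalfPlane.continuous_im.subtype_mk _).measurable
  rw [UpperHalfPlane.volume_def, restrict_withDensity hUm,
    lintegral_withDensity_eq_lintegral_mul _ hdens (hφc.measurable.enorm.pow_const 2),
    himage, ← Set.inter_eq_self_of_subset_left (Set.image_subset_range UpperHalfPlane.coe _),
    ← Measure.restrict_restrict' hemb.measurableSet_range,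
    ← hpres.setLIntegral_comp_emb hemb]
  apply lintegral_congr
  intro z
  rw [Pi.mul_apply, UpperHalfPlane.ofComplex_apply, Real.enorm_of_nonneg (by positivity),
    UpperHalfPlane.coe_im, div_eq_inv_mul, ENNReal.ofReal_mul (by positivity),
    ← ofReal_norm, ENNReal.ofReal_pow (norm_nonneg _), ENNReal.ofReal]
  congr 2
  ext
  simp
  positivity

theorem integrableOn_outer {Γ : Subgroup SL(2, ℝ)} [DiscreteTopology Γ] {F : Set ℍ}
    (hF : IsFundDomain Γ F) {φ : ℍ → ℂ} {l : ℝ} (hφ : IsEigenfunction Γ φ l)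
    (hL2 : MeasureTheory.MemLp φ 2 (MeasureTheory.volume.restrict F)) {R : ℝ}
    (hR : ∀ g ∈ Γ, ∀ z : ℍ, R < ‖(z : ℂ)‖ → R < ‖((g • z : ℍ) : ℂ)‖ → ∀ w : ℍ, g • w = w) :
    MeasureTheory.IntegrableOn (fun w : ℂ ↦ ‖φ (UpperHalfPlane.ofComplex w)‖ ^ 2 / w.im ^ 2)
      {w : ℂ | 0 < w.im ∧ R < ‖w‖} := by
  apply integrableOn_normSq_div_im_sq hφ.contDiff.continuousOn
  refine (setLIntegral_le_of_precisely_invariant hF (f := fun z ↦ ‖φ z‖ₑ ^ 2)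
    (fun g hg z ↦ by simp only [hφ.invariant g hg z])
    (isOpen_lt continuous_const UpperHalfPlane.continuous_coe.norm).measurableSet hR).trans_lt ?_
  have h := MeasureTheory.lintegral_rpow_enorm_lt_top_of_eLpNorm_lt_top two_ne_zero
    ENNReal.ofNat_ne_top hL2.2
  simpa using h

/-! ### Calculus of first derivatives and Laplacians -/

/-- `f` is of class `C²` at `z`, with partial derivatives `a`, `b` and Laplacian `l`. -/
structure Jet (f : ℂ → ℝ) (z : ℂ) (a b l : ℝ) : Prop where
  contDiffAt : ContDiffAt ℝ 2 f z
  dx : fderiv ℝ f z 1 = a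
  dy : fderiv ℝ f z Complex.I = b
  lap : Laplacian.laplacian f z = l

section Directional

variable {f g : ℂ → ℝ} {z : ℂ}

theorem contDiffAt_fderiv_apply (hf : ContDiffAt ℝ 2 f z) (v : ℂ) :
    ContDiffAt ℝ 1 (fun w ↦ fderiv ℝ f w v) z :=
  (hf.fderiv_right (m := 1) (by norm_num)).clm_apply contDiffAt_const

theorem eventually_differentiableAt (hf : ContDiffAt ℝ 2 f z) :
    ∀ᶠ w in 𝓝 z, DifferentiableAt ℝ f w := by
  filter_upwards [hf.eventually (by simp)] with w hw
  exact hw.differentiableAt (by simp)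

theorem laplacian_eq_fderiv_fderiv (hf : ContDiffAt ℝ 2 f z) :
    Laplacian.laplacian f z = fderiv ℝ (fun w ↦ fderiv ℝ f w 1) z 1 +
      fderiv ℝ (fun w ↦ fderiv ℝ f w Complex.I) z Complex.I := by
  have h : DifferentiableAt ℝ (fderiv ℝ f) z :=
    (hf.fderiv_right (m := 1) (by norm_num)).differentiableAt (by simp)
  rw [InnerProductSpace.laplacian_eq_iteratedFDeriv_complexPlane]
  simp only [iteratedFDeriv_two_apply]
  rw [fderiv_clm_apply h (differentiableAt_const _), fderiv_clm_apply h (differentiableAt_const _)]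
  simp

theorem fderiv_fderiv_mul (hf : ContDiffAt ℝ 2 f z) (hg : ContDiffAt ℝ 2 g z) (v : ℂ) :
    fderiv ℝ (fun w ↦ fderiv ℝ (fun u ↦ f u * g u) w v) z v =
      f z * fderiv ℝ (fun w ↦ fderiv ℝ g w v) z v + g z * fderiv ℝ (fun w ↦ fderiv ℝ f w v) z v +
        2 * (fderiv ℝ f z v * fderiv ℝ g z v) := by
  have he : (fun w ↦ fderiv ℝ (fun u ↦ f u * g u) w v) =ᶠ[𝓝 z]
      fun w ↦ f w * fderiv ℝ g w v + g w * fderiv ℝ f w v := by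
    filter_upwards [eventually_differentiableAt hf, eventually_differentiableAt hg] with w h1 h2
    rw [fderiv_fun_mul h1 h2]
    simp
  have df := hf.differentiableAt (by simp)
  have dg := hg.differentiableAt (by simp)
  have df' := (contDiffAt_fderiv_apply hf v).differentiableAt (by simp)
  have dg' := (contDiffAt_fderiv_apply hg v).differentiableAt (by simp)
  rw [he.fderiv_eq, fderiv_fun_add (df.fun_mul dg') (dg.fun_mul df'), fderiv_fun_mul df dg',
    fderiv_fun_mul dg df']
  simp
  ring

theorem fderiv_fderiv_comp (hf : ContDiffAt ℝ 2 f z) {F F' : ℝ → ℝ} {F'' : ℝ}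
    (h1 : ∀ᶠ t in 𝓝 (f z), HasDerivAt F (F' t) t) (h2 : HasDerivAt F' F'' (f z)) (v : ℂ) :
    fderiv ℝ (fun w ↦ fderiv ℝ (fun u ↦ F (f u)) w v) z v =
      F' (f z) * fderiv ℝ (fun w ↦ fderiv ℝ f w v) z v + F'' * fderiv ℝ f z v ^ 2 := by
  have he : (fun w ↦ fderiv ℝ (fun u ↦ F (f u)) w v) =ᶠ[𝓝 z]
      fun w ↦ F' (f w) * fderiv ℝ f w v := by
    filter_upwards [eventually_differentiableAt hf, hf.continuousAt.eventually h1] with w hw1 hw2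
    have := (hw2.comp_hasFDerivAt w hw1.hasFDerivAt).fderiv
    simp only [Function.comp_def] at this
    rw [this]
    simp
  have df := hf.differentiableAt (by simp)
  have df' := (contDiffAt_fderiv_apply hf v).differentiableAt (by simp)
  have hc := h2.comp_hasFDerivAt z df.hasFDerivAt
  have hc' : HasFDerivAt (fun w ↦ F' (f w)) (F'' • fderiv ℝ f z) z := hc
  rw [he.fderiv_eq, fderiv_fun_mul hc'.differentiableAt df', hc'.fderiv]
  simp
  ring

end Directional

namespace Jet

variable {f g : ℂ → ℝ} {z : ℂ} {a b l a' b' l' : ℝ}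

theorem of_contDiffAt (hf : ContDiffAt ℝ 2 f z) :
    Jet f z (fderiv ℝ f z 1) (fderiv ℝ f z Complex.I) (Laplacian.laplacian f z) :=
  ⟨hf, rfl, rfl, rfl⟩

theorem congr (h : Jet f z a b l) (he : g =ᶠ[𝓝 z] f) : Jet g z a b l :=
  ⟨h.contDiffAt.congr_of_eventuallyEq he, by rw [he.fderiv_eq, h.dx], by rw [he.fderiv_eq, h.dy],
    by rw [(InnerProductSpace.laplacian_congr_nhds he).eq_of_nhds, h.lap]⟩

theorem cast (h : Jet f z a b l) (ha : a = a') (hb : b = b') (hl : l = l') : Jet f z a' b' l' := by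
  subst ha hb hl
  exact h

theorem mul (hf : Jet f z a b l) (hg : Jet g z a' b' l') :
    Jet (fun w ↦ f w * g w) z (f z * a' + g z * a) (f z * b' + g z * b)
      (f z * l' + g z * l + 2 * (a * a' + b * b')) := by
  have df := hf.contDiffAt.differentiableAt (by simp)
  have dg := hg.contDiffAt.differentiableAt (by simp)
  have hc := hf.contDiffAt.mul hg.contDiffAt
  refine ⟨hc, ?_, ?_, ?_⟩
  · rw [fderiv_fun_mul df dg]
    simp [hf.dx, hg.dx]
  · rw [fderiv_fun_mul df dg]
    simp [hf.dy, hg.dy]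
  · rw [laplacian_eq_fderiv_fderiv hc, fderiv_fderiv_mul hf.contDiffAt hg.contDiffAt,
      fderiv_fderiv_mul hf.contDiffAt hg.contDiffAt, ← hf.lap, ← hg.lap, ← hf.dx, ← hf.dy, ← hg.dx,
      ← hg.dy, laplacian_eq_fderiv_fderiv hf.contDiffAt, laplacian_eq_fderiv_fderiv hg.contDiffAt]
    ring

theorem comp (hf : Jet f z a b l) {F F' : ℝ → ℝ} {F'' : ℝ} (hF : ContDiffAt ℝ 2 F (f z))
    (h1 : ∀ᶠ t in 𝓝 (f z), HasDerivAt F (F' t) t) (h2 : HasDerivAt F' F'' (f z)) :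
    Jet (fun w ↦ F (f w)) z (F' (f z) * a) (F' (f z) * b)
      (F' (f z) * l + F'' * (a ^ 2 + b ^ 2)) := by
  have df := hf.contDiffAt.differentiableAt (by simp)
  have hc : ContDiffAt ℝ 2 (fun w ↦ F (f w)) z := hF.comp z hf.contDiffAt
  have hd : HasFDerivAt (fun w ↦ F (f w)) (F' (f z) • fderiv ℝ f z) z :=
    h1.self_of_nhds.comp_hasFDerivAt z df.hasFDerivAt
  refine ⟨hc, ?_, ?_, ?_⟩
  · rw [hd.fderiv]
    simp [hf.dx]
  · rw [hd.fderiv]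
    simp [hf.dy]
  · rw [laplacian_eq_fderiv_fderiv hc, fderiv_fderiv_comp hf.contDiffAt h1 h2,
      fderiv_fderiv_comp hf.contDiffAt h1 h2, ← hf.lap, ← hf.dx, ← hf.dy,
      laplacian_eq_fderiv_fderiv hf.contDiffAt]
    ring

theorem add (hf : Jet f z a b l) (hg : Jet g z a' b' l') :
    Jet (fun w ↦ f w + g w) z (a + a') (b + b') (l + l') := by
  have df := hf.contDiffAt.differentiableAt (by simp)
  have dg := hg.contDiffAt.differentiableAt (by simp)
  refine ⟨hf.contDiffAt.add hg.contDiffAt, ?_, ?_, ?_⟩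
  · rw [fderiv_fun_add df dg]
    simp [hf.dx, hg.dx]
  · rw [fderiv_fun_add df dg]
    simp [hf.dy, hg.dy]
  · have := hf.contDiffAt.laplacian_add hg.contDiffAt
    rw [hf.lap, hg.lap] at this
    exact this

theorem const (c : ℝ) (z : ℂ) : Jet (fun _ ↦ c) z 0 0 0 := by
  refine ⟨contDiffAt_const, by simp, by simp, ?_⟩
  rw [laplacian_eq_fderiv_fderiv contDiffAt_const]
  simp

theorem re (z : ℂ) : Jet (fun w ↦ w.re) z 1 0 0 := by
  have hd : ∀ w, fderiv ℝ (fun w : ℂ ↦ w.re) w = Complex.reCLM := fun w ↦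
    Complex.reCLM.hasFDerivAt.fderiv
  have hc : ContDiffAt ℝ 2 (fun w : ℂ ↦ w.re) z := Complex.reCLM.contDiff.contDiffAt
  refine ⟨hc, by rw [hd]; simp, by rw [hd]; simp, ?_⟩
  rw [laplacian_eq_fderiv_fderiv hc]
  simp [hd]

theorem im (z : ℂ) : Jet (fun w ↦ w.im) z 0 1 0 := by
  have hd : ∀ w, fderiv ℝ (fun w : ℂ ↦ w.im) w = Complex.imCLM := fun w ↦
    Complex.imCLM.hasFDerivAt.fderiv
  have hc : ContDiffAt ℝ 2 (fun w : ℂ ↦ w.im) z := Complex.imCLM.contDiff.contDiffAt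
  refine ⟨hc, by rw [hd]; simp, by rw [hd]; simp, ?_⟩
  rw [laplacian_eq_fderiv_fderiv hc]
  simp [hd]

theorem const_mul (hf : Jet f z a b l) (c : ℝ) :
    Jet (fun w ↦ c * f w) z (c * a) (c * b) (c * l) :=
  ((const c z).mul hf).cast (by ring) (by ring) (by ring)

theorem log (hf : Jet f z a b l) (h : 0 < f z) :
    Jet (fun w ↦ Real.log (f w)) z (a / f z) (b / f z)
      (l / f z - (a ^ 2 + b ^ 2) / f z ^ 2) := by
  refine (hf.comp (F := Real.log) (F' := fun t ↦ t⁻¹) (F'' := -(f z ^ 2)⁻¹)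
    (Real.contDiffAt_log.2 h.ne') ?_ (hasDerivAt_inv h.ne')).cast ?_ ?_ ?_
  · filter_upwards [lt_mem_nhds h] with t ht using Real.hasDerivAt_log ht.ne'
  all_goals field_simp
  ring

theorem exp (hf : Jet f z a b l) :
    Jet (fun w ↦ Real.exp (f w)) z (Real.exp (f z) * a) (Real.exp (f z) * b)
      (Real.exp (f z) * (l + (a ^ 2 + b ^ 2))) :=
  (hf.comp (F := Real.exp) (F' := Real.exp) Real.contDiff_exp.contDiffAt
    (Filter.Eventually.of_forall Real.hasDerivAt_exp) (Real.hasDerivAt_exp _)).cast rfl rfl (by ring)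

end Jet

theorem contDiff_two_of_hasDerivAt {F F' F'' : ℝ → ℝ} (h1 : ∀ t, HasDerivAt F (F' t) t)
    (h2 : ∀ t, HasDerivAt F' (F'' t) t) (h3 : Continuous F'') : ContDiff ℝ 2 F := by
  have e1 : deriv F = F' := funext fun t ↦ (h1 t).deriv
  have e2 : deriv F' = F'' := funext fun t ↦ (h2 t).deriv
  have hF' : ContDiff ℝ 1 F' := by
    rw [contDiff_one_iff_deriv]
    exact ⟨fun t ↦ (h2 t).differentiableAt, by rwa [e2]⟩
  rw [show (2 : WithTop ℕ∞) = 1 + 1 by norm_num, contDiff_succ_iff_deriv]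
  exact ⟨fun t ↦ (h1 t).differentiableAt, by simp, by rwa [e1]⟩

theorem hasDerivAt_max_pow (n : ℕ) (t : ℝ) :
    HasDerivAt (fun t : ℝ ↦ max t 0 ^ (n + 2)) ((n + 2) * max t 0 ^ (n + 1)) t := by
  rcases lt_trichotomy t 0 with h | rfl | h
  · rw [max_eq_right h.le]
    have he : (fun t : ℝ ↦ max t 0 ^ (n + 2)) =ᶠ[𝓝 t] fun _ ↦ 0 := by
      filter_upwards [gt_mem_nhds h] with x hx
      rw [max_eq_right hx.le]
      simp
    simpa using (hasDerivAt_const t (0 : ℝ)).congr_of_eventuallyEq he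
  · have hb : (fun t : ℝ ↦ max t 0 ^ (n + 2)) =O[𝓝 0] fun t ↦ ‖t - 0‖ ^ (n + 2) := by
      apply Asymptotics.IsBigO.of_bound 1
      filter_upwards with t
      rw [sub_zero, one_mul, norm_pow, norm_pow, norm_norm]
      apply pow_le_pow_left₀ (norm_nonneg _)
      rw [Real.norm_eq_abs, Real.norm_eq_abs, abs_of_nonneg (le_max_right _ _)]
      exact max_le (le_abs_self _) (abs_nonneg _)
    have := (hb.hasFDerivAt (𝕜 := ℝ) (by omega)).hasDerivAt
    simpa using this
  · rw [max_eq_left h.le]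
    have he : (fun t : ℝ ↦ max t 0 ^ (n + 2)) =ᶠ[𝓝 t] fun t ↦ t ^ (n + 2) := by
      filter_upwards [lt_mem_nhds h] with x hx
      rw [max_eq_left hx.le]
    have := (hasDerivAt_pow (n + 2) t).congr_of_eventuallyEq he
    simpa using this

theorem hasDerivAt_max_cube (t : ℝ) :
    HasDerivAt (fun t : ℝ ↦ max t 0 ^ 3) (3 * max t 0 ^ 2) t := by
  convert hasDerivAt_max_pow 1 t using 1
  norm_num

theorem hasDerivAt_max_sq (t : ℝ) :
    HasDerivAt (fun t : ℝ ↦ 3 * max t 0 ^ 2) (6 * max t 0) t := by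
  refine ((hasDerivAt_max_pow 0 t).const_mul 3).congr_deriv ?_
  norm_num
  ring

/-- The cube is the least integer power whose truncation at 0 is C², as Green's identity needs for
kernel and cutoff. -/
theorem contDiff_max_cube : ContDiff ℝ 2 fun t : ℝ ↦ max t 0 ^ 3 :=
  contDiff_two_of_hasDerivAt hasDerivAt_max_cube hasDerivAt_max_sq (by fun_prop)

theorem Jet.max_cube {f : ℂ → ℝ} {z : ℂ} {a b l : ℝ} (hf : Jet f z a b l) :
    Jet (fun w ↦ max (f w) 0 ^ 3) z (3 * max (f z) 0 ^ 2 * a) (3 * max (f z) 0 ^ 2 * b)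
      (3 * max (f z) 0 ^ 2 * l + 6 * max (f z) 0 * (a ^ 2 + b ^ 2)) :=
  hf.comp contDiff_max_cube.contDiffAt (Filter.Eventually.of_forall hasDerivAt_max_cube)
    (hasDerivAt_max_sq _)

/-! ### The divergence theorem and Green's identity -/

open MeasureTheory in
theorem integral_fderiv_eq_zero_of_contDiff {Ξ : ℂ → ℝ} (h : ContDiff ℝ 1 Ξ)
    (hc : HasCompactSupport Ξ) (v : ℂ) :
    Integrable (fun z ↦ fderiv ℝ Ξ z v) ∧ ∫ z, fderiv ℝ Ξ z v = 0 := by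
  have hi : Integrable (fun z ↦ fderiv ℝ Ξ z v) :=
    ((h.continuous_fderiv (by simp)).clm_apply continuous_const).integrable_of_hasCompactSupport
      (hc.fderiv_apply (𝕜 := ℝ) v)
  refine ⟨hi, ?_⟩
  have := integral_mul_fderiv_eq_neg_fderiv_mul_of_integrable (μ := (volume : Measure ℂ))
    (f := fun _ : ℂ ↦ (1 : ℝ)) (g := Ξ) (v := v) (by simp) (by simpa using hi)
    (by simpa using h.continuous.integrable_of_hasCompactSupport hc)
    (fun _ _ ↦ differentiableAt_const _) (fun z _ ↦ (h.differentiable (by simp)) z)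
  simpa using this

open MeasureTheory in
/-- The integral of the divergence of a `C¹` vector field with support in a compact subset `K` of an
open set `U` vanishes. -/
theorem setIntegral_divergence_eq_zero {U K : Set ℂ} (hU : IsOpen U) (hK : IsCompact K)
    (hKU : K ⊆ U) {P Q : ℂ → ℝ} (hP : ∀ z ∈ U, ContDiffAt ℝ 1 P z)
    (hQ : ∀ z ∈ U, ContDiffAt ℝ 1 Q z) (hP0 : ∀ z ∈ U, z ∉ K → P z = 0)
    (hQ0 : ∀ z ∈ U, z ∉ K → Q z = 0) :
    IntegrableOn (fun z ↦ fderiv ℝ P z 1 + fderiv ℝ Q z Complex.I) K ∧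
      ∫ z in K, (fderiv ℝ P z 1 + fderiv ℝ Q z Complex.I) = 0 := by
  have key : ∀ (A : ℂ → ℝ) (v : ℂ), (∀ z ∈ U, ContDiffAt ℝ 1 A z) →
      (∀ z ∈ U, z ∉ K → A z = 0) → IntegrableOn (fun z ↦ fderiv ℝ A z v) K ∧
        ∫ z in K, fderiv ℝ A z v = 0 := by
    intro A v hA hA0
    -- `A` is controlled only on `U`; since it vanishes on `U` outside `K`, extension by zero is C¹
    -- on all of ℂ with compact support.
    set B : ℂ → ℝ := U.indicator A with hB
    have hBU : ∀ z ∈ U, B =ᶠ[𝓝 z] A := by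
      intro z hz
      filter_upwards [hU.mem_nhds hz] with w hw
      rw [hB, Set.indicator_of_mem hw]
    have hBK : ∀ z, z ∉ K → B z = 0 := by
      intro z hz
      by_cases hzU : z ∈ U
      · rw [hB, Set.indicator_of_mem hzU, hA0 z hzU hz]
      · rw [hB, Set.indicator_of_notMem hzU]
    have hBK' : ∀ z, z ∉ K → B =ᶠ[𝓝 z] fun _ ↦ 0 := by
      intro z hz
      filter_upwards [hK.isClosed.isOpen_compl.mem_nhds hz] with w hw using hBK w hw
    have hBc : ContDiff ℝ 1 B := by
      rw [contDiff_iff_contDiffAt]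
      intro z
      by_cases hzK : z ∈ K
      · exact (hA z (hKU hzK)).congr_of_eventuallyEq (hBU z (hKU hzK))
      · exact contDiffAt_const.congr_of_eventuallyEq (hBK' z hzK)
    have hBs : HasCompactSupport B := HasCompactSupport.intro hK hBK
    obtain ⟨h1, h2⟩ := integral_fderiv_eq_zero_of_contDiff hBc hBs v
    have hcongr : Set.EqOn (fun z ↦ fderiv ℝ B z v) (fun z ↦ fderiv ℝ A z v) K := fun z hz ↦ by
      simp only [(hBU z (hKU hz)).fderiv_eq]
    have hsupp : ∀ z, z ∉ K → fderiv ℝ B z v = 0 := fun z hz ↦ by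
      rw [(hBK' z hz).fderiv_eq]
      simp
    constructor
    · exact h1.integrableOn.congr_fun hcongr hK.measurableSet
    · rw [← setIntegral_congr_fun hK.measurableSet hcongr, 
        setIntegral_eq_integral_of_forall_compl_eq_zero hsupp, h2]
  obtain ⟨p1, p2⟩ := key P 1 hP hP0
  obtain ⟨q1, q2⟩ := key Q Complex.I hQ hQ0
  exact ⟨p1.add q1, by rw [integral_add p1 q1, p2, q2, add_zero]⟩

open MeasureTheory in
/-- Green's identity for the operator `div (ω ∇)`. -/
theorem setIntegral_green {U K : Set ℂ} (hU : IsOpen U) (hK : IsCompact K)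
    (hKU : K ⊆ U) {ω E G : ℂ → ℝ} (hω : ∀ z ∈ U, ContDiffAt ℝ 2 ω z)
    (hE : ∀ z ∈ U, ContDiffAt ℝ 2 E z) (hG : ∀ z ∈ U, ContDiffAt ℝ 2 G z)
    (hE0 : ∀ z ∈ U, z ∉ K → E z = 0) :
    IntegrableOn (fun z ↦ E z * (ω z * Laplacian.laplacian G z + (fderiv ℝ ω z 1 * fderiv ℝ G z 1 +
        fderiv ℝ ω z Complex.I * fderiv ℝ G z Complex.I)) -
      G z * (ω z * Laplacian.laplacian E z + (fderiv ℝ ω z 1 * fderiv ℝ E z 1 +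
        fderiv ℝ ω z Complex.I * fderiv ℝ E z Complex.I))) K ∧
    ∫ z in K, (E z * (ω z * Laplacian.laplacian G z + (fderiv ℝ ω z 1 * fderiv ℝ G z 1 +
        fderiv ℝ ω z Complex.I * fderiv ℝ G z Complex.I)) -
      G z * (ω z * Laplacian.laplacian E z + (fderiv ℝ ω z 1 * fderiv ℝ E z 1 +
        fderiv ℝ ω z Complex.I * fderiv ℝ E z Complex.I))) = 0 := by
  have hcd : ∀ v : ℂ, ∀ z ∈ U, ContDiffAt ℝ 1
      (fun z ↦ ω z * (E z * fderiv ℝ G z v - G z * fderiv ℝ E z v)) z := fun v z hz ↦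
    ((hω z hz).of_le (by norm_num)).mul
      ((((hE z hz).of_le (by norm_num)).mul (contDiffAt_fderiv_apply (hG z hz) v)).sub
        (((hG z hz).of_le (by norm_num)).mul (contDiffAt_fderiv_apply (hE z hz) v)))
  have hzero : ∀ v : ℂ, ∀ z ∈ U, z ∉ K →
      ω z * (E z * fderiv ℝ G z v - G z * fderiv ℝ E z v) = 0 := by
    intro v z hz hzK
    have he : E =ᶠ[𝓝 z] fun _ ↦ 0 := by
      filter_upwards [hK.isClosed.isOpen_compl.mem_nhds hzK, hU.mem_nhds hz] with w h1 h2
        using hE0 w h2 h1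
    rw [he.fderiv_eq, hE0 z hz hzK]
    simp
  have hder : ∀ v : ℂ, ∀ z ∈ U, fderiv ℝ
      (fun z ↦ ω z * (E z * fderiv ℝ G z v - G z * fderiv ℝ E z v)) z v =
      ω z * (E z * fderiv ℝ (fun w ↦ fderiv ℝ G w v) z v -
        G z * fderiv ℝ (fun w ↦ fderiv ℝ E w v) z v) +
      fderiv ℝ ω z v * (E z * fderiv ℝ G z v - G z * fderiv ℝ E z v) := by
    intro v z hz
    have dω := (hω z hz).differentiableAt (by simp)
    have dE := (hE z hz).differentiableAt (by simp)
    have dG := (hG z hz).differentiableAt (by simp)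
    have dE' := (contDiffAt_fderiv_apply (hE z hz) v).differentiableAt (by simp)
    have dG' := (contDiffAt_fderiv_apply (hG z hz) v).differentiableAt (by simp)
    rw [fderiv_fun_mul dω ((dE.fun_mul dG').fun_sub (dG.fun_mul dE')),
      fderiv_fun_sub (dE.fun_mul dG') (dG.fun_mul dE'), fderiv_fun_mul dE dG',
      fderiv_fun_mul dG dE']
    simp
    ring
  obtain ⟨h1, h2⟩ := setIntegral_divergence_eq_zero hU hK hKU (hcd 1) (hcd Complex.I) (hzero 1)
    (hzero Complex.I)
  suffices h : Set.EqOn (fun z ↦ fderiv ℝ (fun z ↦ ω z * (E z * fderiv ℝ G z 1 -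
      G z * fderiv ℝ E z 1)) z 1 + fderiv ℝ (fun z ↦ ω z * (E z * fderiv ℝ G z Complex.I -
      G z * fderiv ℝ E z Complex.I)) z Complex.I) _ K from
    ⟨h1.congr_fun h hK.measurableSet, by rw [← setIntegral_congr_fun hK.measurableSet h, h2]⟩
  intro z hz
  simp only
  rw [hder 1 z (hKU hz), hder Complex.I z (hKU hz), laplacian_eq_fderiv_fderiv (hE z (hKU hz)),
    laplacian_eq_fderiv_fderiv (hG z (hKU hz))]
  ring

/-! ### The local mean value inequality and boundedness -/

/-- The squared distance to `z₀`, in units of the height of `z₀`. -/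
noncomputable def relDistSq (z₀ z : ℂ) : ℝ := ((z.re - z₀.re) ^ 2 + (z.im - z₀.im) ^ 2) / z₀.im ^ 2

theorem jet_relDistSq (z₀ z : ℂ) : Jet (relDistSq z₀) z (2 * (z.re - z₀.re) / z₀.im ^ 2)
    (2 * (z.im - z₀.im) / z₀.im ^ 2) (4 / z₀.im ^ 2) := by
  have h1 := (Jet.re z).add (Jet.const (-z₀.re) z)
  have h2 := (Jet.im z).add (Jet.const (-z₀.im) z)
  have h3 := (((h1.mul h1).add (h2.mul h2)).mul (Jet.const (1 / z₀.im ^ 2) z))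
  refine (h3.cast ?_ ?_ ?_).congr (Filter.Eventually.of_forall fun w ↦ ?_)
  · ring
  · ring
  · ring
  · simp only [relDistSq]
    ring

theorem relDistSq_nonneg (z₀ z : ℂ) : 0 ≤ relDistSq z₀ z := by
  unfold relDistSq
  positivity

theorem relDistSq_eq (z₀ z : ℂ) : relDistSq z₀ z = dist z z₀ ^ 2 / z₀.im ^ 2 := by
  rw [relDistSq, Complex.dist_eq, ← Complex.normSq_eq_norm_sq, Complex.normSq_apply]
  simp [sq]

/-- A truncated and regularized logarithmic fundamental solution. -/
noncomputable def logKernel (k δ : ℝ) (z₀ z : ℂ) : ℝ :=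
  max (1 - k * relDistSq z₀ z) 0 ^ 3 * -Real.log (relDistSq z₀ z + δ)

theorem jet_logKernel {k δ : ℝ} (hδ : 0 < δ) {z₀ z : ℂ} {a b l : ℝ}
    (hJ : Jet (relDistSq z₀) z a b l) :
    ∃ a' b', Jet (logKernel k δ z₀) z a' b'
      (max (1 - k * relDistSq z₀ z) 0 ^ 3 * ((a ^ 2 + b ^ 2) / (relDistSq z₀ z + δ) ^ 2 -
          l / (relDistSq z₀ z + δ)) +
        -Real.log (relDistSq z₀ z + δ) * (6 * max (1 - k * relDistSq z₀ z) 0 * k ^ 2 *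
          (a ^ 2 + b ^ 2) - 3 * max (1 - k * relDistSq z₀ z) 0 ^ 2 * k * l) +
        6 * max (1 - k * relDistSq z₀ z) 0 ^ 2 * k * ((a ^ 2 + b ^ 2) / (relDistSq z₀ z + δ))) := by
  have hpd : 0 < relDistSq z₀ z + δ := by linarith [relDistSq_nonneg z₀ z]
  have h1 := ((Jet.const 1 z).add (hJ.const_mul (-k))).max_cube
  have h2 := ((hJ.add (Jet.const δ z)).log hpd).const_mul (-1)
  refine ⟨_, _, ((h1.mul h2).cast rfl rfl ?_).congr (Filter.Eventually.of_forall fun w ↦ ?_)⟩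
  · rw [show 1 + -k * relDistSq z₀ z = 1 - k * relDistSq z₀ z by ring]
    generalize relDistSq z₀ z + δ = q
    generalize max (1 - k * relDistSq z₀ z) 0 = m
    ring
  · simp only [logKernel, neg_mul, one_mul, sub_eq_add_neg]

/-- The first term on the right is minus a smoothed point mass. The zero order term K m³L, with L =
-log(p + δ), is not bounded uniformly in δ; it is absorbed by -12k m²L, which comes from
differentiating the truncation twice, whence K ≤ 12k. The rest is bounded by pL ≤ 1 and p/(p + δ) ≤
1, independently of δ. -/
theorem exists_jet_logKernel {k δ K : ℝ} (hδ : 0 < δ) (hk : 0 < k) (hK : K ≤ 12 * k) (hK0 : 0 ≤ K)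
    {z₀ : ℂ} (hz₀ : 0 < z₀.im) {z : ℂ} (hz : relDistSq z₀ z + δ ≤ 1) :
    ContDiffAt ℝ 2 (logKernel k δ z₀) z ∧
      z₀.im ^ 2 * Laplacian.laplacian (logKernel k δ z₀) z + K * logKernel k δ z₀ z ≤
      -(4 * max (1 - k * relDistSq z₀ z) 0 ^ 3 * δ / (relDistSq z₀ z + δ) ^ 2) +
        (24 * k ^ 2 + 24 * k) := by
  have hp0 := relDistSq_nonneg z₀ z
  have hpd : 0 < relDistSq z₀ z + δ := by linarith
  obtain ⟨a', b', hJ⟩ := jet_logKernel (k := k) hδ (jet_relDistSq z₀ z)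
  refine ⟨hJ.contDiffAt, ?_⟩
  rw [hJ.lap, logKernel]
  have hS : (2 * (z.re - z₀.re) / z₀.im ^ 2) ^ 2 + (2 * (z.im - z₀.im) / z₀.im ^ 2) ^ 2 =
      4 * relDistSq z₀ z / z₀.im ^ 2 := by
    rw [relDistSq]
    field_simp
    ring
  rw [hS]
  set p := relDistSq z₀ z with hpdef
  set m := max (1 - k * p) 0 with hm
  set L := -Real.log (p + δ) with hL
  have hm0 : 0 ≤ m := le_max_right _ _
  have hm1 : m ≤ 1 := max_le (by nlinarith [mul_nonneg hk.le hp0]) zero_le_one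
  have hL0 : 0 ≤ L := neg_nonneg.2 (Real.log_nonpos hpd.le hz)
  have hpd1 : p / (p + δ) ≤ 1 := by
    rw [div_le_one hpd]
    linarith
  have hpd2 : 0 ≤ p / (p + δ) := by positivity
  have hpL : p * L ≤ 1 := by
    have h3 := Real.log_le_sub_one_of_pos (inv_pos.2 hpd)
    rw [Real.log_inv, ← hL] at h3
    have h4 : p * L ≤ p * (p + δ)⁻¹ := mul_le_mul_of_nonneg_left (by linarith) hp0
    rw [← div_eq_mul_inv] at h4
    linarith
  have hpL0 : 0 ≤ p * L := mul_nonneg hp0 hL0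
  have hmain : z₀.im ^ 2 * (m ^ 3 * (4 * p / z₀.im ^ 2 / (p + δ) ^ 2 - 4 / z₀.im ^ 2 / (p + δ)) +
      L * (6 * m * k ^ 2 * (4 * p / z₀.im ^ 2) - 3 * m ^ 2 * k * (4 / z₀.im ^ 2)) +
      6 * m ^ 2 * k * (4 * p / z₀.im ^ 2 / (p + δ))) + K * (m ^ 3 * L) =
      -(4 * m ^ 3 * δ / (p + δ) ^ 2) + (m ^ 2 * L) * (K * m - 12 * k) +
        24 * k ^ 2 * (m * (p * L)) + 24 * k * (m ^ 2 * (p / (p + δ))) := by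
    clear_value p m L
    field_simp
    ring
  rw [hmain]
  clear_value p m L
  have t1 : (m ^ 2 * L) * (K * m - 12 * k) ≤ 0 :=
    mul_nonpos_of_nonneg_of_nonpos (by positivity)
      (by nlinarith [mul_le_mul_of_nonneg_left hm1 hK0])
  have t2 : m * (p * L) ≤ 1 := mul_le_one₀ hm1 hpL0 hpL
  have t3 : m ^ 2 * (p / (p + δ)) ≤ 1 := mul_le_one₀ (pow_le_one₀ hm0 hm1) hpd2 hpd1
  have t4 : 24 * k ^ 2 * (m * (p * L)) ≤ 24 * k ^ 2 * 1 :=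
    mul_le_mul_of_nonneg_left t2 (by positivity)
  have t5 : 24 * k * (m ^ 2 * (p / (p + δ))) ≤ 24 * k * 1 :=
    mul_le_mul_of_nonneg_left t3 (by positivity)
  linarith

theorem im_mem_of_mem_closedBall {z₀ z : ℂ} (hz : z ∈ Metric.closedBall z₀ (z₀.im / 4)) :
    3 / 4 * z₀.im ≤ z.im ∧ z.im ≤ 5 / 4 * z₀.im := by
  rw [Metric.mem_closedBall, Complex.dist_eq] at hz
  have h := (Complex.abs_im_le_norm (z - z₀)).trans hz
  rw [Complex.sub_im, abs_le] at h
  constructor <;> linarith [h.1, h.2]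

/-- The square of an eigenfunction is almost subharmonic. -/
theorem neg_mul_sq_le_laplacian_sq {f : ℂ → ℝ} {l : ℝ} {z₀ z : ℂ} (hz₀ : 0 < z₀.im)
    (hf : ContDiffAt ℝ 2 f z) (heq : z.im ^ 2 * Laplacian.laplacian f z = -l * f z)
    (hz : 3 / 4 * z₀.im ≤ z.im) :
    ContDiffAt ℝ 2 (fun w ↦ f w * f w) z ∧
      -(4 * |l|) * (f z * f z) ≤ z₀.im ^ 2 * Laplacian.laplacian (fun w ↦ f w * f w) z := by
  have hJ := (Jet.of_contDiffAt hf).mul (Jet.of_contDiffAt hf)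
  refine ⟨hJ.contDiffAt, ?_⟩
  rw [hJ.lap]
  have hz0 : 0 < z.im := by linarith
  have hl : Laplacian.laplacian f z = -l * f z / z.im ^ 2 := by
    rw [eq_div_iff (by positivity), mul_comm, heq]
  rw [hl]
  set t := z₀.im ^ 2 / z.im ^ 2 with ht
  have ht0 : 0 ≤ t := by positivity
  have ht2 : t ≤ 2 := by
    rw [ht, div_le_iff₀ (by positivity)]
    nlinarith
  have h1 : z₀.im ^ 2 * (f z * (-l * f z / z.im ^ 2) + f z * (-l * f z / z.im ^ 2) +
      2 * (fderiv ℝ f z 1 * fderiv ℝ f z 1 + fderiv ℝ f z Complex.I * fderiv ℝ f z Complex.I)) =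
      -2 * (l * t) * (f z * f z) + 2 * z₀.im ^ 2 * (fderiv ℝ f z 1 * fderiv ℝ f z 1 +
        fderiv ℝ f z Complex.I * fderiv ℝ f z Complex.I) := by
    rw [ht]
    field_simp
    ring
  rw [h1]
  have h2 : l * t ≤ 2 * |l| := by
    calc l * t ≤ |l| * t := mul_le_mul_of_nonneg_right (le_abs_self l) ht0
      _ ≤ |l| * 2 := mul_le_mul_of_nonneg_left ht2 (abs_nonneg l)
      _ = 2 * |l| := mul_comm _ _
  have h3 : 0 ≤ f z * f z := mul_self_nonneg _
  have h4 : 0 ≤ 2 * z₀.im ^ 2 * (fderiv ℝ f z 1 * fderiv ℝ f z 1 +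
      fderiv ℝ f z Complex.I * fderiv ℝ f z Complex.I) :=
    mul_nonneg (by positivity) (add_nonneg (mul_self_nonneg _) (mul_self_nonneg _))
  nlinarith

open MeasureTheory in
-- Green's identity for f², which is almost subharmonic, against the truncated logarithmic kernel.
-- The radius is proportional to the height, so on the disc the weight y² is comparable to a
-- constant and C does not depend on z₀.
theorem sq_le_setIntegral_of_eigen {l : ℝ} {f : ℂ → ℝ} (hf : ∀ z : ℂ, 0 < z.im → ContDiffAt ℝ 2 f z)
    (heq : ∀ z : ℂ, 0 < z.im → z.im ^ 2 * Laplacian.laplacian f z = -l * f z) {z₀ : ℂ}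
    (hz₀ : 0 < z₀.im) :
    f z₀ * f z₀ ≤ (16 / Real.pi * (24 * (16 + |l|) ^ 2 + 24 * (16 + |l|))) / z₀.im ^ 2 *
      ∫ z in Metric.closedBall z₀ (z₀.im / 4), f z * f z := by
  set k := 16 + |l| with hk
  have hl0 := abs_nonneg l
  have hk0 : 0 < k := by linarith
  set C := 24 * k ^ 2 + 24 * k with hC
  have hC0 : 0 < C := by positivity
  set B := Metric.closedBall z₀ (z₀.im / 4) with hB
  have hBc : IsCompact B := isCompact_closedBall _ _
  have hy2 : 0 < z₀.im ^ 2 := by positivity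
  have hU : IsOpen {z : ℂ | 0 < z.im} := isOpen_lt continuous_const Complex.continuous_im
  have hBU : B ⊆ {z : ℂ | 0 < z.im} := by
    intro z hz
    have := (im_mem_of_mem_closedBall hz).1
    change 0 < z.im
    linarith
  have hgc : ContinuousOn (fun z ↦ f z * f z) B := fun z hz ↦
    ((hf z (hBU hz)).continuousAt.mul (hf z (hBU hz)).continuousAt).continuousWithinAt
  have hgi : IntegrableOn (fun z ↦ f z * f z) B := hgc.integrableOn_compact hBc
  have hI0 : 0 ≤ ∫ z in B, f z * f z := integral_nonneg fun z ↦ mul_self_nonneg _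
  rcases (mul_self_nonneg (f z₀)).eq_or_lt with h0 | hpos
  · rw [← h0]
    have := Real.pi_pos
    positivity
  obtain ⟨ε, hε, hball⟩ : ∃ ε > 0, ∀ z ∈ Metric.ball z₀ ε, f z₀ * f z₀ / 2 < f z * f z := by
    have hc := (hf z₀ hz₀).continuousAt.mul (hf z₀ hz₀).continuousAt
    exact Metric.eventually_nhds_iff_ball.1 (hc.eventually (lt_mem_nhds (half_lt_self hpos)))
  -- On the disc of radius r · z₀.im, f² keeps half of its central value, and the truncation factor
  -- is at least 1/2 because k r² ≤ 1/2.
  obtain ⟨r, hr0, hrε, hr1, hr2⟩ : ∃ r : ℝ, 0 < r ∧ r * z₀.im ≤ ε ∧ r ≤ 1 / 4 ∧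
      2 * k * r ^ 2 ≤ 1 := by
    refine ⟨min (ε / z₀.im) (1 / (2 * k)), lt_min (div_pos hε hz₀) (by positivity), ?_, ?_, ?_⟩
    · rw [← le_div_iff₀ hz₀]
      exact min_le_left _ _
    · refine (min_le_right _ _).trans ?_
      rw [div_le_div_iff₀ (by positivity) (by norm_num)]
      linarith
    · have h1 : min (ε / z₀.im) (1 / (2 * k)) ≤ 1 / (2 * k) := min_le_right _ _
      have h2 : 0 < min (ε / z₀.im) (1 / (2 * k)) := lt_min (div_pos hε hz₀) (by positivity)
      have h3 : 2 * k * min (ε / z₀.im) (1 / (2 * k)) ≤ 1 := by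
        rw [mul_comm, ← le_div_iff₀ (by positivity)]
        exact h1
      have h4 : min (ε / z₀.im) (1 / (2 * k)) ≤ 1 := by
        refine h1.trans ?_
        rw [div_le_one (by positivity)]
        linarith
      nlinarith
  set δ := r ^ 2 with hδdef
  have hδ : 0 < δ := by positivity
  have hδ1 : δ ≤ 1 / 16 := by nlinarith
  have hrel : ∀ z ∈ B, relDistSq z₀ z ≤ 1 / 16 := by
    intro z hz
    rw [relDistSq_eq, div_le_iff₀ hy2]
    have h1 : dist z z₀ ≤ z₀.im / 4 := hz
    have h2 := pow_le_pow_left₀ dist_nonneg h1 2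
    linarith
  have hcont : ∀ z : ℂ, ContDiffAt ℝ 2 (logKernel k δ z₀) z := fun z ↦ by
    obtain ⟨_, _, h⟩ := jet_logKernel (k := k) hδ (jet_relDistSq z₀ z)
    exact h.contDiffAt
  obtain ⟨hi, hint⟩ := setIntegral_green hU hBc hBU (ω := fun _ ↦ 1) (E := logKernel k δ z₀)
    (G := fun z ↦ f z * f z) (fun _ _ ↦ contDiffAt_const) (fun z _ ↦ hcont z)
    (fun z hz ↦ (hf z hz).mul (hf z hz)) (by
      intro z _ hzB
      have h1 : z₀.im / 4 < dist z z₀ := not_le.1 hzB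
      have h2 : 1 / 16 ≤ relDistSq z₀ z := by
        rw [relDistSq_eq, le_div_iff₀ hy2]
        have := pow_le_pow_left₀ (by positivity) h1.le 2
        linarith
      rw [logKernel, max_eq_right (by nlinarith)]
      ring)
  set ψ : ℂ → ℝ := fun z ↦ 4 * max (1 - k * relDistSq z₀ z) 0 ^ 3 * δ / (relDistSq z₀ z + δ) ^ 2
    with hψ
  have hrelc : Continuous (relDistSq z₀) := by
    unfold relDistSq
    fun_prop
  have hψc : Continuous ψ := by
    apply Continuous.div
    · fun_prop
    · fun_prop
    · intro z
      have := relDistSq_nonneg z₀ z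
      positivity
  have hψ0 : ∀ z, 0 ≤ ψ z := fun z ↦ by positivity
  have hpt : ∀ z ∈ B, f z * f z * ψ z / z₀.im ^ 2 - C / z₀.im ^ 2 * (f z * f z) ≤
      logKernel k δ z₀ z * (1 * Laplacian.laplacian (fun z ↦ f z * f z) z +
        (fderiv ℝ (fun _ : ℂ ↦ (1 : ℝ)) z 1 * fderiv ℝ (fun z ↦ f z * f z) z 1 +
        fderiv ℝ (fun _ : ℂ ↦ (1 : ℝ)) z Complex.I *
          fderiv ℝ (fun z ↦ f z * f z) z Complex.I)) -
      f z * f z * (1 * Laplacian.laplacian (logKernel k δ z₀) z +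
        (fderiv ℝ (fun _ : ℂ ↦ (1 : ℝ)) z 1 * fderiv ℝ (logKernel k δ z₀) z 1 +
        fderiv ℝ (fun _ : ℂ ↦ (1 : ℝ)) z Complex.I *
          fderiv ℝ (logKernel k δ z₀) z Complex.I)) := by
    intro z hz
    have hle1 : relDistSq z₀ z + δ ≤ 1 := by linarith [hrel z hz]
    have h1 := (exists_jet_logKernel (K := 4 * |l|) hδ hk0 (by linarith) (by linarith) hz₀ hle1).2
    have h2 := (neg_mul_sq_le_laplacian_sq hz₀ (hf z (hBU hz)) (heq z (hBU hz))
      (im_mem_of_mem_closedBall hz).1).2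
    have hE : 0 ≤ logKernel k δ z₀ z := by
      have := relDistSq_nonneg z₀ z
      exact mul_nonneg (by positivity)
        (neg_nonneg.2 (Real.log_nonpos (by linarith) hle1))
    have hg := mul_self_nonneg (f z)
    simp only [fderiv_fun_const, Pi.zero_apply, _root_.zero_apply, zero_mul, add_zero,
      one_mul]
    have h3 := mul_le_mul_of_nonneg_left h1 hg
    have h4 := mul_le_mul_of_nonneg_left h2 hE
    have e : f z * f z * ψ z / z₀.im ^ 2 - C / z₀.im ^ 2 * (f z * f z) =
      (f z * f z * ψ z - C * (f z * f z)) / z₀.im ^ 2 := by ring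
    rw [e, div_le_iff₀ hy2]
    simp only [hψ]
    nlinarith
  have hgψ : IntegrableOn (fun z ↦ f z * f z * ψ z) B :=
    (hgc.mul hψc.continuousOn).integrableOn_compact hBc
  have h5 := setIntegral_mono_on ((hgψ.div_const (z₀.im ^ 2)).sub (hgi.const_mul (C / z₀.im ^ 2)))
    hi hBc.measurableSet hpt
  rw [hint, integral_sub' (hgψ.div_const _) (hgi.const_mul _), integral_div, integral_const_mul] at h5
  have h6 : ∫ z in B, f z * f z * ψ z ≤ C * ∫ z in B, f z * f z := by
    have : (∫ z in B, f z * f z * ψ z) / z₀.im ^ 2 ≤ (C * ∫ z in B, f z * f z) / z₀.im ^ 2 := by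
      rw [mul_div_right_comm]
      linarith
    exact (div_le_div_iff_of_pos_right hy2).1 this
  have hsub : Metric.ball z₀ (r * z₀.im) ⊆ B := by
    refine (Metric.ball_subset_ball ?_).trans Metric.ball_subset_closedBall
    nlinarith
  -- There the smoothed mass is at least 1/(8δ), and the area of the disc is πδ · z₀.im², so δ
  -- cancels and no limit is needed.
  have h7 : ∫ z in Metric.ball z₀ (r * z₀.im), f z₀ * f z₀ / 2 * (1 / (8 * δ)) ≤
      ∫ z in B, f z * f z * ψ z := by
    refine le_trans (setIntegral_mono_on (integrableOn_const (by
      exact measure_ball_lt_top.ne)) (hgψ.mono_set hsub)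
      Metric.isOpen_ball.measurableSet ?_) (setIntegral_mono_set hgψ (Filter.Eventually.of_forall
        fun z ↦ mul_nonneg (mul_self_nonneg _) (hψ0 z)) hsub.eventuallyLE)
    intro z hz
    have hp : relDistSq z₀ z ≤ δ := by
      rw [relDistSq_eq, div_le_iff₀ hy2, hδdef, ← mul_pow]
      exact pow_le_pow_left₀ dist_nonneg (le_of_lt hz) 2
    have hp0 := relDistSq_nonneg z₀ z
    refine mul_le_mul (hball z (Metric.ball_subset_ball hrε hz)).le ?_ (by positivity)
      (mul_self_nonneg _)
    have hm : 1 / 2 ≤ max (1 - k * relDistSq z₀ z) 0 := le_max_of_le_left (by nlinarith)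
    have hm3 : 1 / 8 ≤ max (1 - k * relDistSq z₀ z) 0 ^ 3 := by
      have := pow_le_pow_left₀ (by norm_num) hm 3
      linarith
    simp only [hψ]
    rw [div_le_div_iff₀ (by positivity) (by positivity)]
    have h8 : (relDistSq z₀ z + δ) ^ 2 ≤ (2 * δ) ^ 2 := pow_le_pow_left₀ (by positivity) (by linarith) 2
    nlinarith [mul_le_mul_of_nonneg_right hm3 (by positivity : 0 ≤ δ * δ)]
  rw [setIntegral_const, smul_eq_mul, Measure.real, Complex.volume_ball, ENNReal.toReal_mul,
    ENNReal.toReal_pow, ENNReal.toReal_ofReal (by positivity), ENNReal.coe_toReal] at h7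
  have h9 : (r * z₀.im) ^ 2 * Real.pi * (f z₀ * f z₀ / 2 * (1 / (8 * δ))) =
      Real.pi * z₀.im ^ 2 / 16 * (f z₀ * f z₀) := by
    rw [hδdef]
    field_simp
    ring
  have h10 : Real.pi * z₀.im ^ 2 / 16 * (f z₀ * f z₀) ≤ C * ∫ z in B, f z * f z := by
    rw [← h9]
    exact h7.trans h6
  have hpi := Real.pi_pos
  have h11 : 16 / Real.pi * C / z₀.im ^ 2 * ∫ z in B, f z * f z =
      (C * ∫ z in B, f z * f z) / (Real.pi * z₀.im ^ 2 / 16) := by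
    field_simp
  rw [h11, le_div_iff₀ (by positivity)]
  linarith

open MeasureTheory in
/-- Square integrable eigenfunctions are bounded. -/
theorem exists_abs_le_of_eigen {l R : ℝ} (hR : 0 < R) {f : ℂ → ℝ}
    (hf : ∀ z : ℂ, 0 < z.im → ContDiffAt ℝ 2 f z)
    (heq : ∀ z : ℂ, 0 < z.im → z.im ^ 2 * Laplacian.laplacian f z = -l * f z)
    (hint : IntegrableOn (fun z ↦ f z ^ 2 / z.im ^ 2) {z : ℂ | 0 < z.im ∧ R < ‖z‖}) :
    ∃ M : ℝ, 0 ≤ M ∧ ∀ z : ℂ, 0 < z.im → 2 * R ≤ ‖z‖ → |f z| ≤ M := by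
  set C := 16 / Real.pi * (24 * (16 + |l|) ^ 2 + 24 * (16 + |l|)) with hC
  have hC0 : 0 ≤ C := by
    have := Real.pi_pos
    positivity
  set J := ∫ z in {z : ℂ | 0 < z.im ∧ R < ‖z‖}, f z ^ 2 / z.im ^ 2 with hJ
  refine ⟨√(C * 2 * J), Real.sqrt_nonneg _, fun z₀ hz₀ hn ↦ Real.abs_le_sqrt ?_⟩
  rw [sq]
  refine (sq_le_setIntegral_of_eigen hf heq hz₀).trans ?_
  rw [← hC]
  have hy2 : 0 < z₀.im ^ 2 := by positivity
  have hsub : Metric.closedBall z₀ (z₀.im / 4) ⊆ {z : ℂ | 0 < z.im ∧ R < ‖z‖} := by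
    intro z hz
    refine ⟨by linarith [(im_mem_of_mem_closedBall hz).1], ?_⟩
    have h1 : dist z z₀ ≤ z₀.im / 4 := hz
    rw [dist_comm, dist_eq_norm] at h1
    have h2 := norm_sub_norm_le z₀ z
    have h3 := (le_abs_self z₀.im).trans (Complex.abs_im_le_norm z₀)
    linarith
  have h1 : ∫ z in Metric.closedBall z₀ (z₀.im / 4), f z * f z ≤
      ∫ z in Metric.closedBall z₀ (z₀.im / 4), 2 * z₀.im ^ 2 * (f z ^ 2 / z.im ^ 2) := by
    apply setIntegral_mono_on
    · refine ContinuousOn.integrableOn_compact (isCompact_closedBall _ _) fun z hz ↦ ?_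
      have := (hf z (hsub hz).1).continuousAt
      exact (this.mul this).continuousWithinAt
    · exact (hint.mono_set hsub).const_mul _
    · exact Metric.isClosed_closedBall.measurableSet
    · intro z hz
      have h2 := im_mem_of_mem_closedBall hz
      have h3 : 0 < z.im := (hsub hz).1
      rw [mul_div_assoc', le_div_iff₀ (by positivity)]
      have h4 : z.im ^ 2 ≤ 2 * z₀.im ^ 2 := by nlinarith
      nlinarith [sq_nonneg (f z)]
  have h2 : ∫ z in Metric.closedBall z₀ (z₀.im / 4), f z ^ 2 / z.im ^ 2 ≤ J :=
    setIntegral_mono_set hint (Filter.Eventually.of_forall fun z ↦ by positivity) hsub.eventuallyLE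
  rw [integral_const_mul] at h1
  calc C / z₀.im ^ 2 * ∫ z in Metric.closedBall z₀ (z₀.im / 4), f z * f z
      ≤ C / z₀.im ^ 2 * (2 * z₀.im ^ 2 * J) := by
        apply mul_le_mul_of_nonneg_left _ (by positivity)
        exact h1.trans (mul_le_mul_of_nonneg_left h2 (by positivity))
    _ = C * 2 * J := by
        field_simp

/-! ### The barrier -/

/-- The logarithm of `y / (|z - b| |z|)`. -/
noncomputable def logBarrier (b : ℝ) (z : ℂ) : ℝ :=
  Real.log z.im - (Real.log ((z.re - b) ^ 2 + z.im ^ 2) + Real.log (z.re ^ 2 + z.im ^ 2)) / 2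

/-- The function `(y / (|z - b| |z|)) ^ s`, a supersolution of the eigenvalue equation which is
concentrated near the real points `0` and `b`. -/
noncomputable def barrier (s b : ℝ) (z : ℂ) : ℝ := Real.exp (s * logBarrier b z)

theorem jet_log_normSq (b : ℝ) {z : ℂ} (hz : 0 < z.im) :
    Jet (fun w ↦ Real.log ((w.re - b) ^ 2 + w.im ^ 2)) z
      (2 * (z.re - b) / ((z.re - b) ^ 2 + z.im ^ 2)) (2 * z.im / ((z.re - b) ^ 2 + z.im ^ 2)) 0 := by
  have h1 := (Jet.re z).add (Jet.const (-b) z)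
  have h2 := (h1.mul h1).add ((Jet.im z).mul (Jet.im z))
  have h3 : Jet (fun w ↦ (w.re - b) ^ 2 + w.im ^ 2) z (2 * (z.re - b)) (2 * z.im) 4 :=
    (h2.cast (by ring) (by ring) (by ring)).congr
      (Filter.Eventually.of_forall fun w ↦ by simp only; ring)
  have hpos : 0 < (z.re - b) ^ 2 + z.im ^ 2 := by positivity
  refine (h3.log hpos).cast rfl rfl ?_
  field_simp
  ring

theorem laplacian_barrier_le {s b : ℝ} {z : ℂ} (hz : 0 < z.im) :
    ContDiffAt ℝ 2 (barrier s b) z ∧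
      z.im ^ 2 * Laplacian.laplacian (barrier s b) z ≤ -(s * (1 - s)) * barrier s b z := by
  have h0 : Jet (fun w : ℂ ↦ Real.log (w.re ^ 2 + w.im ^ 2)) z
      (2 * z.re / (z.re ^ 2 + z.im ^ 2)) (2 * z.im / (z.re ^ 2 + z.im ^ 2)) 0 := by
    simpa using jet_log_normSq 0 hz
  have h1 := jet_log_normSq b hz
  have h2 := (((Jet.im z).log hz).add ((h1.add h0).const_mul (-1 / 2))).const_mul s
  have hJ := h2.exp.congr (g := barrier s b) (Filter.Eventually.of_forall fun w ↦ by
    simp only [barrier, logBarrier]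
    congr 1
    ring)
  refine ⟨hJ.contDiffAt, ?_⟩
  have hv : Real.exp (s * (Real.log z.im + -1 / 2 * (Real.log ((z.re - b) ^ 2 + z.im ^ 2) +
      Real.log (z.re ^ 2 + z.im ^ 2)))) = barrier s b z := by
    simp only [barrier, logBarrier]
    congr 1
    ring
  rw [hJ.lap, hv]
  have hB : 0 < barrier s b z := Real.exp_pos _
  generalize barrier s b z = H at *
  have hq1 : 0 < (z.re - b) ^ 2 + z.im ^ 2 := by positivity
  have hq2 : 0 < z.re ^ 2 + z.im ^ 2 := by positivity
  -- The functions log|z - b| and log|z| are harmonic, so the Laplacian of the exponent comes from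
  -- log y alone. The squared gradient contributes the cross terms, whose total deviation from the
  -- eigenvalue equation has a sign and vanishes for b = 0.
  have key : z.im ^ 2 * (H * (s * (0 / z.im - (0 ^ 2 + 1 ^ 2) / z.im ^ 2 + -1 / 2 * (0 + 0)) +
      ((s * (0 / z.im + -1 / 2 * (2 * (z.re - b) / ((z.re - b) ^ 2 + z.im ^ 2) +
        2 * z.re / (z.re ^ 2 + z.im ^ 2)))) ^ 2 +
      (s * (1 / z.im + -1 / 2 * (2 * z.im / ((z.re - b) ^ 2 + z.im ^ 2) +
        2 * z.im / (z.re ^ 2 + z.im ^ 2)))) ^ 2))) =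
      -(s * (1 - s)) * H - H * s ^ 2 * (z.im ^ 2 * b ^ 2 /
        (((z.re - b) ^ 2 + z.im ^ 2) * (z.re ^ 2 + z.im ^ 2))) := by
    field_simp
    ring
  rw [key]
  have : 0 ≤ H * s ^ 2 * (z.im ^ 2 * b ^ 2 /
        (((z.re - b) ^ 2 + z.im ^ 2) * (z.re ^ 2 + z.im ^ 2))) := by positivity
  linarith

theorem barrier_eq_rpow {s b : ℝ} {z : ℂ} (hz : 0 < z.im) :
    barrier s b z = (z.im / (√((z.re - b) ^ 2 + z.im ^ 2) * √(z.re ^ 2 + z.im ^ 2))) ^ s := by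
  have hq1 : 0 < (z.re - b) ^ 2 + z.im ^ 2 := by positivity
  have hq2 : 0 < z.re ^ 2 + z.im ^ 2 := by positivity
  rw [Real.rpow_def_of_pos (by positivity), barrier, logBarrier, Real.log_div hz.ne' (by positivity),
    Real.log_mul (by positivity) (by positivity), Real.log_sqrt hq1.le, Real.log_sqrt hq2.le]
  congr 1
  ring

theorem barrier_pos (s b : ℝ) (z : ℂ) : 0 < barrier s b z := Real.exp_pos _

/-- On the half circle of radius `R`, one of the barriers with poles at `±R` is large. -/
theorem le_barrier_add_barrier {s R : ℝ} (hs : 0 < s) (hR : 0 < R) {z : ℂ} (hz : 0 < z.im)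
    (hn : z.re ^ 2 + z.im ^ 2 = R ^ 2) :
    (1 / (2 * R)) ^ s ≤ barrier s R z + barrier s (-R) z := by
  -- On the quarter circle on the side of b, |z - b| ≤ 2y, so y/(|z - b||z|) ≥ 1/(2R) even at the
  -- end where y tends to 0.
  have key : ∀ b : ℝ, b ^ 2 = R ^ 2 → 0 ≤ z.re * b → (1 / (2 * R)) ^ s ≤ barrier s b z := by
    intro b hb hzb
    rw [barrier_eq_rpow hz]
    apply Real.rpow_le_rpow (by positivity) _ hs.le
    rw [hn, Real.sqrt_sq hR.le]
    have hq1 : 0 < (z.re - b) ^ 2 + z.im ^ 2 := by positivity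
    have h1 : √((z.re - b) ^ 2 + z.im ^ 2) ≤ 2 * z.im := by
      rw [Real.sqrt_le_left (by positivity)]
      have e : (z.re - b) ^ 2 + z.im ^ 2 = 2 * (R ^ 2 - z.re * b) := by
        linear_combination hn + hb
      have h2 : (z.re * b) ^ 2 = z.re ^ 2 * R ^ 2 := by rw [mul_pow, hb]
      have h3 : (R ^ 2 - z.re * b) * (R ^ 2 + z.re * b) = z.im ^ 2 * R ^ 2 := by
        linear_combination -h2 + (-R ^ 2) * hn
      have h4 : 0 < R ^ 2 - z.re * b := by linarith
      have h5 : (R ^ 2 - z.re * b) * R ^ 2 ≤ z.im ^ 2 * R ^ 2 := by nlinarith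
      have h6 := le_of_mul_le_mul_right h5 (by positivity)
      rw [e]
      nlinarith
    have h7 : 0 < √((z.re - b) ^ 2 + z.im ^ 2) := Real.sqrt_pos.2 hq1
    rw [div_le_div_iff₀ (by positivity) (by positivity)]
    nlinarith
  rcases le_total 0 z.re with h | h
  · have := key R rfl (mul_nonneg h hR.le)
    linarith [barrier_pos s (-R) z]
  · have := key (-R) (by ring) (mul_nonneg_of_nonpos_of_nonpos h (by linarith))
    linarith [barrier_pos s R z]

/-- For |z| ≥ 2R the moved pole is harmless: |z - b| ≥ |z|/2, at the cost of a factor 2^s. -/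
theorem barrier_le {s R b : ℝ} (hs : 0 < s) (hb : |b| = R) {z : ℂ} (hz : 0 < z.im)
    (hn : 2 * R ≤ √(z.re ^ 2 + z.im ^ 2)) :
    barrier s b z ≤ 2 ^ s * (z.im / (z.re ^ 2 + z.im ^ 2)) ^ s := by
  have hq1 : 0 < (z.re - b) ^ 2 + z.im ^ 2 := by positivity
  have hq2 : 0 < z.re ^ 2 + z.im ^ 2 := by positivity
  rw [barrier_eq_rpow hz, ← Real.mul_rpow (by norm_num) (by positivity)]
  apply Real.rpow_le_rpow (by positivity) _ hs.le
  have e1 : ‖z‖ = √(z.re ^ 2 + z.im ^ 2) := by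
    rw [← Real.sqrt_sq (norm_nonneg z), ← Complex.normSq_eq_norm_sq, Complex.normSq_apply]
    congr 1
    ring
  have e2 : ‖z - b‖ = √((z.re - b) ^ 2 + z.im ^ 2) := by
    rw [← Real.sqrt_sq (norm_nonneg (z - b)), ← Complex.normSq_eq_norm_sq, Complex.normSq_apply]
    congr 1
    simp
    ring
  have h1 : √(z.re ^ 2 + z.im ^ 2) ≤ 2 * √((z.re - b) ^ 2 + z.im ^ 2) := by
    rw [← e1, ← e2]
    have := norm_sub_norm_le z (b : ℂ)
    rw [Complex.norm_real, Real.norm_eq_abs, hb] at this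
    rw [← e1] at hn
    linarith
  have h2 : 0 < √((z.re - b) ^ 2 + z.im ^ 2) := Real.sqrt_pos.2 hq1
  have h3 : 0 < √(z.re ^ 2 + z.im ^ 2) := Real.sqrt_pos.2 hq2
  have h4 := Real.sq_sqrt hq2.le
  rw [mul_div_assoc', div_le_div_iff₀ (by positivity) hq2]
  have h5 : z.re ^ 2 + z.im ^ 2 ≤ 2 * (√((z.re - b) ^ 2 + z.im ^ 2) * √(z.re ^ 2 + z.im ^ 2)) := by
    rw [← h4, Real.sqrt_sq h3.le]
    nlinarith
  nlinarith

/-! ### A smooth positive part and the substitution u = √y w -/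

/-- A convex `C²` function, vanishing on the negative half line and of quadratic growth. -/
noncomputable def penalty (t : ℝ) : ℝ := max t 0 ^ 3 * (√(1 + t ^ 2))⁻¹

/-- The derivative of `penalty`. -/
noncomputable def penaltyDeriv (t : ℝ) : ℝ :=
  3 * max t 0 ^ 2 * (√(1 + t ^ 2))⁻¹ - max t 0 ^ 3 * (t * (√(1 + t ^ 2))⁻¹ ^ 3)

/-- The second derivative of `penalty`. -/
noncomputable def penaltyDeriv₂ (t : ℝ) : ℝ :=
  6 * max t 0 * (√(1 + t ^ 2))⁻¹ - 6 * max t 0 ^ 2 * (t * (√(1 + t ^ 2))⁻¹ ^ 3) -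
    max t 0 ^ 3 * ((√(1 + t ^ 2))⁻¹ ^ 3 - 3 * t ^ 2 * (√(1 + t ^ 2))⁻¹ ^ 5)

theorem hasDerivAt_inv_sqrt_one_add_sq (t : ℝ) :
    HasDerivAt (fun t : ℝ ↦ (√(1 + t ^ 2))⁻¹) (-(t * (√(1 + t ^ 2))⁻¹ ^ 3)) t := by
  have hpos : 0 < 1 + t ^ 2 := by positivity
  have h1 : HasDerivAt (fun t : ℝ ↦ 1 + t ^ 2) (2 * t) t := by
    simpa using (hasDerivAt_pow 2 t).const_add 1
  refine ((h1.sqrt hpos.ne').inv (Real.sqrt_pos.2 hpos).ne').congr_deriv ?_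
  have := Real.sqrt_pos.2 hpos
  field_simp

theorem hasDerivAt_penalty (t : ℝ) : HasDerivAt penalty (penaltyDeriv t) t := by
  refine ((hasDerivAt_max_cube t).mul (hasDerivAt_inv_sqrt_one_add_sq t)).congr_deriv ?_
  rw [penaltyDeriv]
  ring

theorem hasDerivAt_penaltyDeriv (t : ℝ) : HasDerivAt penaltyDeriv (penaltyDeriv₂ t) t := by
  have hr := hasDerivAt_inv_sqrt_one_add_sq t
  have h1 := (hasDerivAt_max_sq t).mul hr
  have h2 := (hasDerivAt_max_cube t).mul ((hasDerivAt_id t).mul (hr.pow 3))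
  refine (h1.sub h2).congr_deriv ?_
  rw [penaltyDeriv₂]
  simp
  ring

theorem continuous_penaltyDeriv₂ : Continuous penaltyDeriv₂ := by
  have h : Continuous fun t : ℝ ↦ (√(1 + t ^ 2))⁻¹ :=
    continuous_iff_continuousAt.2 fun t ↦ (hasDerivAt_inv_sqrt_one_add_sq t).continuousAt
  unfold penaltyDeriv₂
  fun_prop

theorem contDiff_penalty : ContDiff ℝ 2 penalty :=
  contDiff_two_of_hasDerivAt hasDerivAt_penalty hasDerivAt_penaltyDeriv continuous_penaltyDeriv₂

theorem inv_sqrt_one_add_sq (t : ℝ) : 0 < (√(1 + t ^ 2))⁻¹ ∧ (√(1 + t ^ 2))⁻¹ ≤ 1 ∧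
    t ^ 2 * (√(1 + t ^ 2))⁻¹ ^ 2 ≤ 1 ∧ t * (√(1 + t ^ 2))⁻¹ ≤ 1 := by
  have hpos : 0 < 1 + t ^ 2 := by positivity
  have h1 := Real.sqrt_pos.2 hpos
  have h2 := Real.sq_sqrt hpos.le
  have h3 : t ^ 2 * (√(1 + t ^ 2))⁻¹ ^ 2 ≤ 1 := by
    rw [inv_pow, h2, ← div_eq_mul_inv, div_le_one hpos]
    linarith
  refine ⟨inv_pos.2 h1, inv_le_one_of_one_le₀ ?_, h3, ?_⟩
  · rw [Real.one_le_sqrt]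
    nlinarith [sq_nonneg t]
  · rw [← mul_pow] at h3
    nlinarith

theorem penalty_of_nonpos {t : ℝ} (ht : t ≤ 0) : penalty t = 0 := by
  simp [penalty, max_eq_right ht]

theorem penalty_pos {t : ℝ} (ht : 0 < t) : 0 < penalty t := by
  rw [penalty, max_eq_left ht.le]
  have := (inv_sqrt_one_add_sq t).1
  positivity

theorem penalty_nonneg (t : ℝ) : 0 ≤ penalty t := by
  rw [penalty]
  positivity

/-- Quadratic growth is all that the L² bound can control, while the truncated square itself is not
C²; hence the cube divided by √(1 + t²). -/
theorem penalty_le_sq {t : ℝ} (ht : 0 ≤ t) : penalty t ≤ t ^ 2 := by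
  rw [penalty, max_eq_left ht]
  have h := (inv_sqrt_one_add_sq t).2.2.2
  calc t ^ 3 * (√(1 + t ^ 2))⁻¹ = t ^ 2 * (t * (√(1 + t ^ 2))⁻¹) := by ring
    _ ≤ t ^ 2 * 1 := mul_le_mul_of_nonneg_left h (sq_nonneg t)
    _ = t ^ 2 := mul_one _

theorem penaltyDeriv_nonneg (t : ℝ) : 0 ≤ penaltyDeriv t := by
  rcases le_or_gt t 0 with ht | ht
  · simp [penaltyDeriv, max_eq_right ht]
  · obtain ⟨h1, -, h2, -⟩ := inv_sqrt_one_add_sq t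
    rw [penaltyDeriv, max_eq_left ht.le]
    set r := (√(1 + t ^ 2))⁻¹
    have e : 3 * t ^ 2 * r - t ^ 3 * (t * r ^ 3) = t ^ 2 * r * (3 - t ^ 2 * r ^ 2) := by ring
    rw [e]
    exact mul_nonneg (by positivity) (by linarith)

theorem penaltyDeriv₂_nonneg (t : ℝ) : 0 ≤ penaltyDeriv₂ t := by
  rcases le_or_gt t 0 with ht | ht
  · simp [penaltyDeriv₂, max_eq_right ht]
  · obtain ⟨h1, -, h2, -⟩ := inv_sqrt_one_add_sq t
    rw [penaltyDeriv₂, max_eq_left ht.le]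
    set r := (√(1 + t ^ 2))⁻¹
    have e : 6 * t * r - 6 * t ^ 2 * (t * r ^ 3) - t ^ 3 * (r ^ 3 - 3 * t ^ 2 * r ^ 5) =
        t * r * (6 - 7 * (t ^ 2 * r ^ 2) + 3 * (t ^ 2 * r ^ 2) ^ 2) := by ring
    rw [e]
    exact mul_nonneg (by positivity) (by nlinarith [sq_nonneg (t ^ 2 * r ^ 2 - 1)])

/-- Lets the zero order term of the equation for w survive composition with `penalty`. -/
theorem penalty_le_mul_deriv (t : ℝ) : penalty t ≤ penaltyDeriv t * t := by
  rcases le_or_gt t 0 with ht | ht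
  · simp [penaltyDeriv, penalty, max_eq_right ht]
  · obtain ⟨h1, -, h2, -⟩ := inv_sqrt_one_add_sq t
    rw [penaltyDeriv, penalty, max_eq_left ht.le]
    set r := (√(1 + t ^ 2))⁻¹
    have e : (3 * t ^ 2 * r - t ^ 3 * (t * r ^ 3)) * t = t ^ 3 * r * (3 - t ^ 2 * r ^ 2) := by ring
    rw [e]
    nlinarith [show 0 < t ^ 3 * r by positivity]

theorem jet_inv_sqrt_im {z : ℂ} (hz : 0 < z.im) :
    Jet (fun w ↦ Real.exp (-1 / 2 * Real.log w.im)) z 0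
      (Real.exp (-1 / 2 * Real.log z.im) * (-1 / (2 * z.im)))
      (Real.exp (-1 / 2 * Real.log z.im) * (3 / (4 * z.im ^ 2))) := by
  refine (((Jet.im z).log hz).const_mul (-1 / 2)).exp.cast ?_ ?_ ?_
  · simp
  · field_simp
  · field_simp
    ring

theorem exp_neg_half_log_sq {y : ℝ} (hy : 0 < y) : Real.exp (-1 / 2 * Real.log y) ^ 2 = 1 / y := by
  rw [← Real.exp_nat_mul]
  have : ((2 : ℕ) : ℝ) * (-1 / 2 * Real.log y) = -Real.log y := by
    push_cast
    ring
  rw [this, Real.exp_neg, Real.exp_log hy, one_div]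

/-- A positive part of a subsolution of the eigenvalue equation is a subsolution for
`div (y ∇)`. -/
theorem mul_penalty_le_div {l : ℝ} (hl : l ≤ 1 / 4) {u : ℂ → ℝ} {z : ℂ} (hz : 0 < z.im)
    (hu : ContDiffAt ℝ 2 u z) (hsub : -l * u z ≤ z.im ^ 2 * Laplacian.laplacian u z) :
    ContDiffAt ℝ 2 (fun w ↦ penalty (u w * Real.exp (-1 / 2 * Real.log w.im))) z ∧
      (1 / 4 - l) * (penalty (u z * Real.exp (-1 / 2 * Real.log z.im)) / z.im) ≤
        z.im * Laplacian.laplacian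
          (fun w ↦ penalty (u w * Real.exp (-1 / 2 * Real.log w.im))) z +
        fderiv ℝ (fun w ↦ penalty (u w * Real.exp (-1 / 2 * Real.log w.im))) z Complex.I := by
  have hJ := ((Jet.of_contDiffAt hu).mul (jet_inv_sqrt_im hz)).comp (F := penalty)
    (F' := penaltyDeriv) contDiff_penalty.contDiffAt
    (Filter.Eventually.of_forall hasDerivAt_penalty) (hasDerivAt_penaltyDeriv _)
  refine ⟨hJ.contDiffAt, ?_⟩
  rw [hJ.lap, hJ.dy]
  have he : 0 < Real.exp (-1 / 2 * Real.log z.im) := Real.exp_pos _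
  generalize Real.exp (-1 / 2 * Real.log z.im) = e at *
  generalize fderiv ℝ u z 1 = a at *
  generalize fderiv ℝ u z Complex.I = b at *
  generalize Laplacian.laplacian u z = L at *
  set w := u z * e with hw
  have h1 := penaltyDeriv_nonneg w
  have h2 := penaltyDeriv₂_nonneg w
  have h3 := penalty_le_mul_deriv w
  -- For w = u/√y one has √y · y div(y∇w) = y²Δu + u/4: the substitution shifts the eigenvalue to
  -- 1/4 - l. The remaining summand, a second derivative times a squared gradient, is nonnegative by
  -- convexity.
  have key : z.im * (penaltyDeriv w * (u z * (e * (3 / (4 * z.im ^ 2))) + e * L +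
      2 * (a * 0 + b * (e * (-1 / (2 * z.im))))) + penaltyDeriv₂ w *
        ((u z * 0 + e * a) ^ 2 + (u z * (e * (-1 / (2 * z.im))) + e * b) ^ 2)) +
      penaltyDeriv w * (u z * (e * (-1 / (2 * z.im))) + e * b) =
      penaltyDeriv w * e * (u z / 4 + z.im ^ 2 * L) / z.im + z.im * (penaltyDeriv₂ w *
        ((u z * 0 + e * a) ^ 2 + (u z * (e * (-1 / (2 * z.im))) + e * b) ^ 2)) := by
    generalize penaltyDeriv₂ w * ((u z * 0 + e * a) ^ 2 +
      (u z * (e * (-1 / (2 * z.im))) + e * b) ^ 2) = S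
    generalize penaltyDeriv w = D
    field_simp
    ring
  rw [key]
  have h4 : 0 ≤ z.im * (penaltyDeriv₂ w *
        ((u z * 0 + e * a) ^ 2 + (u z * (e * (-1 / (2 * z.im))) + e * b) ^ 2)) := by positivity
  have h5 : (1 / 4 - l) * (penalty w / z.im) ≤
      penaltyDeriv w * e * (u z / 4 + z.im ^ 2 * L) / z.im := by
    rw [mul_div_assoc', div_le_div_iff_of_pos_right hz]
    calc (1 / 4 - l) * penalty w ≤ (1 / 4 - l) * (penaltyDeriv w * w) :=
          mul_le_mul_of_nonneg_left h3 (by linarith)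
      _ = penaltyDeriv w * e * (u z / 4 + -l * u z) := by
          rw [hw]
          ring
      _ ≤ _ := mul_le_mul_of_nonneg_left (by linarith) (by positivity)
  linarith

/-! ### Cutoffs and vanishing of integrable subsolutions -/

/-- The logarithm of the hyperbolic cosine of the distance to `i`. -/
noncomputable def logCosh (z : ℂ) : ℝ :=
  Real.log (z.re ^ 2 + z.im ^ 2 + 1) - Real.log z.im - Real.log 2

theorem logCosh_le_iff {z : ℂ} (hz : 0 < z.im) (T : ℝ) :
    logCosh z ≤ T ↔ z.re ^ 2 + z.im ^ 2 + 1 ≤ 2 * z.im * Real.exp T := by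
  have hA : 0 < z.re ^ 2 + z.im ^ 2 + 1 := by positivity
  rw [← Real.log_le_log_iff hA (by positivity), Real.log_mul (by positivity) (Real.exp_pos _).ne',
    Real.log_mul two_ne_zero hz.ne', Real.log_exp, logCosh]
  constructor <;> intro h <;> linarith

theorem logCosh_nonneg {z : ℂ} (hz : 0 < z.im) : 0 ≤ logCosh z := by
  have hA : 0 < z.re ^ 2 + z.im ^ 2 + 1 := by positivity
  have h : Real.log (2 * z.im) ≤ Real.log (z.re ^ 2 + z.im ^ 2 + 1) :=
    Real.log_le_log (by positivity) (by nlinarith [sq_nonneg (z.im - 1), sq_nonneg z.re])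
  rw [Real.log_mul two_ne_zero hz.ne'] at h
  rw [logCosh]
  linarith

theorem jet_logCosh {z : ℂ} (hz : 0 < z.im) :
    Jet logCosh z (2 * z.re / (z.re ^ 2 + z.im ^ 2 + 1))
      (2 * z.im / (z.re ^ 2 + z.im ^ 2 + 1) - 1 / z.im)
      (4 / (z.re ^ 2 + z.im ^ 2 + 1) ^ 2 + 1 / z.im ^ 2) := by
  have hA : 0 < z.re ^ 2 + z.im ^ 2 + 1 := by positivity
  have h1 := (((Jet.re z).mul (Jet.re z)).add ((Jet.im z).mul (Jet.im z))).add (Jet.const 1 z)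
  have h2 : Jet (fun w : ℂ ↦ w.re ^ 2 + w.im ^ 2 + 1) z (2 * z.re) (2 * z.im) 4 :=
    (h1.cast (by ring) (by ring) (by ring)).congr
      (Filter.Eventually.of_forall fun w ↦ by simp only; ring)
  have h3 := ((h2.log hA).add (((Jet.im z).log hz).const_mul (-1))).add
    (Jet.const (-Real.log 2) z)
  refine (h3.cast ?_ ?_ ?_).congr (Filter.Eventually.of_forall fun w ↦ ?_)
  · simp
  · ring
  · field_simp
    ring
  · simp only [logCosh]
    ring

/-- A `C²` cutoff function in the upper half plane. -/
noncomputable def cutoff (T : ℝ) (z : ℂ) : ℝ := max (1 - logCosh z / T) 0 ^ 3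

/-- Because div(y∇ logCosh) ≥ 0, the first order term in 1/T has the good sign. The quadratic term
remains, and y|∇ logCosh|² ≤ 1/y. -/
theorem cutoff_div_le {T : ℝ} (hT : 0 < T) {z : ℂ} (hz : 0 < z.im) :
    ContDiffAt ℝ 2 (cutoff T) z ∧
      z.im * Laplacian.laplacian (cutoff T) z + fderiv ℝ (cutoff T) z Complex.I ≤
        6 / T ^ 2 / z.im := by
  have h1 : Jet (cutoff T) z _ _ _ := (((Jet.const 1 z).add
    ((jet_logCosh hz).const_mul (-1 / T))).max_cube).congr
      (Filter.Eventually.of_forall fun w ↦ by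
        simp only [cutoff]
        congr 2
        ring)
  refine ⟨h1.contDiffAt, ?_⟩
  rw [h1.lap, h1.dy]
  have hm0 : 0 ≤ max (1 + -1 / T * logCosh z) 0 := le_max_right _ _
  have hm1 : max (1 + -1 / T * logCosh z) 0 ≤ 1 := by
    refine max_le ?_ zero_le_one
    have : 0 ≤ 1 / T * logCosh z := mul_nonneg (by positivity) (logCosh_nonneg hz)
    have e : -1 / T * logCosh z = -(1 / T * logCosh z) := by ring
    rw [e]
    linarith
  generalize max (1 + -1 / T * logCosh z) 0 = m at *
  have hA : 0 < z.re ^ 2 + z.im ^ 2 + 1 := by positivity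
  have key : z.im * (3 * m ^ 2 * (0 + -1 / T * (4 / (z.re ^ 2 + z.im ^ 2 + 1) ^ 2 + 1 / z.im ^ 2)) +
      6 * m * ((0 + -1 / T * (2 * z.re / (z.re ^ 2 + z.im ^ 2 + 1))) ^ 2 +
        (0 + -1 / T * (2 * z.im / (z.re ^ 2 + z.im ^ 2 + 1) - 1 / z.im)) ^ 2)) +
      3 * m ^ 2 * (0 + -1 / T * (2 * z.im / (z.re ^ 2 + z.im ^ 2 + 1) - 1 / z.im)) =
      6 / T ^ 2 / z.im * m - (6 * m / T ^ 2 * (4 * z.im / (z.re ^ 2 + z.im ^ 2 + 1) ^ 2) +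
        3 * m ^ 2 / T * (4 * z.im / (z.re ^ 2 + z.im ^ 2 + 1) ^ 2 +
          2 * z.im / (z.re ^ 2 + z.im ^ 2 + 1))) := by
    field_simp
    ring
  rw [key]
  have p1 : 0 ≤ 6 * m / T ^ 2 * (4 * z.im / (z.re ^ 2 + z.im ^ 2 + 1) ^ 2) +
        3 * m ^ 2 / T * (4 * z.im / (z.re ^ 2 + z.im ^ 2 + 1) ^ 2 +
          2 * z.im / (z.re ^ 2 + z.im ^ 2 + 1)) := by positivity
  have p2 : 6 / T ^ 2 / z.im * m ≤ 6 / T ^ 2 / z.im * 1 :=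
    mul_le_mul_of_nonneg_left hm1 (by positivity)
  linarith

theorem isCompact_sublevel (M : ℝ) :
    IsCompact {z : ℂ | z.re ^ 2 + z.im ^ 2 + 1 ≤ 2 * z.im * M} := by
  refine (isCompact_closedBall (0 : ℂ) (2 * |M|)).of_isClosed_subset
    (isClosed_le (by fun_prop) (by fun_prop)) ?_
  intro z hz
  have hz' : z.re ^ 2 + z.im ^ 2 + 1 ≤ 2 * z.im * M := hz
  rw [mem_closedBall_zero_iff]
  have e : z.re ^ 2 + z.im ^ 2 = ‖z‖ ^ 2 := by
    rw [← Complex.normSq_eq_norm_sq, Complex.normSq_apply]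
    ring
  have h1 : z.im * M ≤ ‖z‖ * |M| := by
    calc z.im * M ≤ |z.im * M| := le_abs_self _
      _ = |z.im| * |M| := abs_mul _ _
      _ ≤ _ := mul_le_mul_of_nonneg_right (Complex.abs_im_le_norm z) (abs_nonneg _)
  rw [e] at hz'
  by_contra! h
  nlinarith [norm_nonneg z, abs_nonneg M]

open MeasureTheory in
/-- A nonnegative, integrable strict subsolution of `div (y ∇)` on the upper half plane vanishes. -/
theorem eq_zero_of_subsolution {κ : ℝ} (hκ : 0 < κ) {Ψ : ℂ → ℝ}
    (hΨ : ∀ z : ℂ, 0 < z.im → ContDiffAt ℝ 2 Ψ z) (hΨ0 : ∀ z, 0 ≤ Ψ z)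
    (hsub : ∀ z : ℂ, 0 < z.im →
      κ * (Ψ z / z.im) ≤ z.im * Laplacian.laplacian Ψ z + fderiv ℝ Ψ z Complex.I)
    {g : ℂ → ℝ} (hg : Integrable g) (hg0 : ∀ z, 0 ≤ g z)
    (hle : ∀ z : ℂ, 0 < z.im → Ψ z / z.im ≤ g z) {z₀ : ℂ} (hz₀ : 0 < z₀.im) : Ψ z₀ = 0 := by
  by_contra hne
  have hpos : 0 < Ψ z₀ := lt_of_le_of_ne (hΨ0 z₀) (Ne.symm hne)
  set J := ∫ z, g z with hJ
  have hU : IsOpen {z : ℂ | 0 < z.im} := isOpen_lt continuous_const Complex.continuous_im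
  have hΨc : ∀ z : ℂ, 0 < z.im → ContinuousAt (fun z ↦ Ψ z / z.im) z := fun z hz ↦
    (hΨ z hz).continuousAt.div Complex.continuous_im.continuousAt hz.ne'
  set m := Ψ z₀ / z₀.im / 2 with hm
  have hm0 : 0 < m := by positivity
  obtain ⟨ε, hε, hball⟩ : ∃ ε > 0, ∀ z ∈ Metric.ball z₀ ε, m < Ψ z / z.im ∧
      logCosh z < logCosh z₀ + 1 ∧ 0 < z.im := by
    apply Metric.eventually_nhds_iff_ball.1
    refine ((hΨc z₀ hz₀).eventually (lt_mem_nhds (half_lt_self (by positivity)))).and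
      (((jet_logCosh hz₀).contDiffAt.continuousAt.eventually (gt_mem_nhds (by linarith))).and
        (hU.mem_nhds hz₀))
  set T₀ := logCosh z₀ + 1 with hT₀
  have hT₀1 : 1 ≤ T₀ := by linarith [logCosh_nonneg hz₀]
  set v := (volume : Measure ℂ).real (Metric.ball z₀ ε) with hv
  have hv0 : 0 < v := ENNReal.toReal_pos (Metric.measure_ball_pos _ _ hε).ne'
    measure_ball_lt_top.ne
  -- Green's identity moves div(y∇·) to the cutoff χ: κ∫χΨ/y ≤ ∫Ψ div(y∇χ) ≤ (6/T²)∫Ψ/y. For T ≥ 2T₀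
  -- the cutoff is at least (1/2)³ near z₀, so the left side stays bounded below.
  have main : ∀ T, 2 * T₀ ≤ T → κ / 8 * (m * v) ≤ 6 / T ^ 2 * J := by
    intro T hT
    have hT0 : 0 < T := by linarith
    set K := {z : ℂ | z.re ^ 2 + z.im ^ 2 + 1 ≤ 2 * z.im * Real.exp T} with hK
    have hKc : IsCompact K := isCompact_sublevel _
    have hKU : K ⊆ {z : ℂ | 0 < z.im} := by
      intro z hz
      have hz' : z.re ^ 2 + z.im ^ 2 + 1 ≤ 2 * z.im * Real.exp T := hz
      change 0 < z.im
      have h1 : 0 < z.im * Real.exp T := by nlinarith [sq_nonneg z.re, sq_nonneg z.im]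
      exact pos_of_mul_pos_left h1 (Real.exp_pos T).le
    obtain ⟨hi, hint⟩ := setIntegral_green hU hKc hKU (ω := fun z ↦ z.im) (E := cutoff T)
      (G := Ψ) (fun z _ ↦ (Jet.im z).contDiffAt) (fun z hz ↦ (cutoff_div_le hT0 hz).1) hΨ (by
        intro z hz hzK
        have h1 : ¬ logCosh z ≤ T := fun h ↦ hzK ((logCosh_le_iff hz T).1 h)
        have h2 : 1 < logCosh z / T := by
          rw [lt_div_iff₀ hT0]
          linarith
        rw [cutoff, max_eq_right (by linarith)]
        simp)
    have hΨK : ContinuousOn (fun z ↦ Ψ z / z.im) K := fun z hz ↦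
      (hΨc z (hKU hz)).continuousWithinAt
    have hcK : ContinuousOn (cutoff T) K := fun z hz ↦
      (cutoff_div_le hT0 (hKU hz)).1.continuousAt.continuousWithinAt
    have hΨi : IntegrableOn (fun z ↦ Ψ z / z.im) K := hΨK.integrableOn_compact hKc
    have hcΨi : IntegrableOn (fun z ↦ cutoff T z * (Ψ z / z.im)) K :=
      (hcK.mul hΨK).integrableOn_compact hKc
    have hc0 : ∀ z, 0 ≤ cutoff T z := fun z ↦ by
      unfold cutoff
      positivity
    have hp0 : ∀ z ∈ K, 0 ≤ Ψ z / z.im := fun z hz ↦ div_nonneg (hΨ0 z) (le_of_lt (hKU hz))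
    have h1 := setIntegral_mono_on ((hcΨi.const_mul κ).sub (hΨi.const_mul (6 / T ^ 2))) hi
      hKc.measurableSet (by
        intro z hz
        have hz' : 0 < z.im := hKU hz
        rw [(Jet.im z).dx, (Jet.im z).dy]
        have a1 := mul_le_mul_of_nonneg_left (hsub z hz') (hc0 z)
        have a2 := mul_le_mul_of_nonneg_left (cutoff_div_le hT0 hz').2 (hΨ0 z)
        have e1 : Ψ z * (6 / T ^ 2 / z.im) = 6 / T ^ 2 * (Ψ z / z.im) := by ring
        simp only [Pi.sub_apply]
        linarith)
    rw [hint, integral_sub' (hcΨi.const_mul κ) (hΨi.const_mul _), integral_const_mul,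
      integral_const_mul] at h1
    have h2 : ∫ z in K, Ψ z / z.im ≤ J :=
      (setIntegral_mono_on hΨi hg.integrableOn hKc.measurableSet
        fun z hz ↦ hle z (hKU hz)).trans
        (setIntegral_le_integral hg (Filter.Eventually.of_forall hg0))
    have hBK : Metric.ball z₀ ε ⊆ K := by
      intro z hz
      obtain ⟨-, b2, b3⟩ := hball z hz
      exact (logCosh_le_iff b3 T).1 (by linarith)
    have h3 : ∫ z in Metric.ball z₀ ε, 1 / 8 * m ≤ ∫ z in K, cutoff T z * (Ψ z / z.im) := by
      refine le_trans (setIntegral_mono_on (integrableOn_const measure_ball_lt_top.ne)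
        (hcΨi.mono_set hBK) Metric.isOpen_ball.measurableSet ?_)
        (setIntegral_mono_set hcΨi ?_ hBK.eventuallyLE)
      · intro z hz
        obtain ⟨b1, b2, b3⟩ := hball z hz
        refine mul_le_mul ?_ b1.le hm0.le (hc0 z)
        have b4 : 1 / 2 ≤ max (1 - logCosh z / T) 0 := by
          apply le_max_of_le_left
          have : logCosh z / T ≤ 1 / 2 := by
            rw [div_le_iff₀ hT0]
            linarith
          linarith
        have b5 := pow_le_pow_left₀ (by norm_num) b4 3
        rw [cutoff]
        linarith
      · filter_upwards [ae_restrict_mem hKc.measurableSet] with z hz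
        exact mul_nonneg (hc0 z) (hp0 z hz)
    rw [setIntegral_const, smul_eq_mul, ← hv] at h3
    have h4 : κ * ∫ z in K, cutoff T z * (Ψ z / z.im) ≤ 6 / T ^ 2 * J :=
      le_trans (by linarith) (mul_le_mul_of_nonneg_left h2 (by positivity))
    have h5 := mul_le_mul_of_nonneg_left h3 hκ.le
    linarith
  have hlim : Filter.Tendsto (fun T : ℝ ↦ 6 / T ^ 2 * J) Filter.atTop (𝓝 (0 * J)) :=
    (Filter.Tendsto.div_atTop tendsto_const_nhds
      (Filter.tendsto_pow_atTop two_ne_zero)).mul_const J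
  have := ge_of_tendsto hlim ((Filter.eventually_ge_atTop (2 * T₀)).mono main)
  have hp : 0 < κ / 8 * (m * v) := by positivity
  linarith

/-! ### The maximum principle and the decay estimate -/

open MeasureTheory in
/-- Maximum principle: a square integrable eigenfunction which is below a nonnegative supersolution
on a half circle is below it outside. -/
theorem le_of_le_on_circle {l R : ℝ} (hl : l < 1 / 4) {f H : ℂ → ℝ}
    (hf : ∀ z : ℂ, 0 < z.im → ContDiffAt ℝ 2 f z) (hH : ∀ z : ℂ, 0 < z.im → ContDiffAt ℝ 2 H z)
    (hfeq : ∀ z : ℂ, 0 < z.im → z.im ^ 2 * Laplacian.laplacian f z = -l * f z)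
    (hHle : ∀ z : ℂ, 0 < z.im → z.im ^ 2 * Laplacian.laplacian H z ≤ -l * H z)
    (hH0 : ∀ z, 0 ≤ H z) (hcirc : ∀ z : ℂ, 0 < z.im → ‖z‖ = R → f z < H z)
    (hint : IntegrableOn (fun z ↦ f z ^ 2 / z.im ^ 2) {z : ℂ | 0 < z.im ∧ R < ‖z‖}) {z : ℂ}
    (hz : 0 < z.im) (hzR : R < ‖z‖) : f z ≤ H z := by
  set u : ℂ → ℝ := fun z ↦ f z + -1 * H z with hu
  set Ψ₀ : ℂ → ℝ := fun w ↦ penalty (u w * Real.exp (-1 / 2 * Real.log w.im)) with hΨ₀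
  set V : Set ℂ := {w | R < ‖w‖} with hV
  set Ψ : ℂ → ℝ := V.indicator Ψ₀ with hΨ
  have hVo : IsOpen V := isOpen_lt continuous_const continuous_norm
  have hule : ∀ w : ℂ, u w ≤ 0 → Ψ w = 0 := by
    intro w hw
    by_cases hwV : w ∈ V
    · rw [hΨ, Set.indicator_of_mem hwV]
      exact penalty_of_nonpos (mul_nonpos_of_nonpos_of_nonneg hw (Real.exp_pos _).le)
    · rw [hΨ, Set.indicator_of_notMem hwV]
  have hΨ0 : ∀ w, 0 ≤ Ψ w := Set.indicator_nonneg fun w _ ↦ penalty_nonneg _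
  have hΨV : ∀ w ∈ V, Ψ =ᶠ[𝓝 w] Ψ₀ := fun w hw ↦ by
    filter_upwards [hVo.mem_nhds hw] with w' hw'
    rw [hΨ, Set.indicator_of_mem hw']
  -- The strict inequality on the half circle persists nearby, where the positive part of f - H
  -- vanishes; so extension by zero across it is C².
  have hΨnV : ∀ w : ℂ, 0 < w.im → w ∉ V → Ψ =ᶠ[𝓝 w] fun _ ↦ 0 := by
    intro w hw hwV
    rcases (not_lt.1 (show ¬ R < ‖w‖ from hwV)).lt_or_eq with h | h
    · filter_upwards [(isOpen_lt continuous_norm continuous_const).mem_nhds h] with w' hw'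
      rw [hΨ, Set.indicator_of_notMem]
      exact not_lt.2 (le_of_lt hw')
    · have hc : ContinuousAt (fun w ↦ H w - f w) w :=
        (hH w hw).continuousAt.sub (hf w hw).continuousAt
      filter_upwards [hc.eventually (lt_mem_nhds (sub_pos.2 (hcirc w hw h)))] with w' hw'
      apply hule
      simp only [hu]
      linarith
  have huJ : ∀ w : ℂ, 0 < w.im → Jet u w _ _ _ := fun w hw ↦
    (Jet.of_contDiffAt (hf w hw)).add ((Jet.of_contDiffAt (hH w hw)).const_mul (-1))
  have hsubJ : ∀ w : ℂ, 0 < w.im → -l * u w ≤ w.im ^ 2 * Laplacian.laplacian u w := by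
    intro w hw
    rw [(huJ w hw).lap]
    have h1 := hfeq w hw
    have h2 := hHle w hw
    simp only [hu]
    nlinarith
  have hmain := fun w (hw : 0 < w.im) ↦
    mul_penalty_le_div hl.le hw (huJ w hw).contDiffAt (hsubJ w hw)
  have hzero : Ψ z = 0 := by
    refine eq_zero_of_subsolution (κ := 1 / 4 - l) (by linarith) (Ψ := Ψ) ?_ hΨ0 ?_
      (g := {w : ℂ | 0 < w.im ∧ R < ‖w‖}.indicator fun w ↦ f w ^ 2 / w.im ^ 2) ?_ ?_ ?_ hz
    · intro w hw
      by_cases hwV : w ∈ V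
      · exact (hmain w hw).1.congr_of_eventuallyEq (hΨV w hwV)
      · exact contDiffAt_const.congr_of_eventuallyEq (hΨnV w hw hwV)
    · intro w hw
      by_cases hwV : w ∈ V
      · have hJ := (Jet.of_contDiffAt (hmain w hw).1).congr (hΨV w hwV)
        rw [hJ.lap, hJ.dy, (hΨV w hwV).eq_of_nhds]
        exact (hmain w hw).2
      · have hJ := (Jet.const 0 w).congr (hΨnV w hw hwV)
        rw [hJ.lap, hJ.dy, (hΨnV w hw hwV).eq_of_nhds]
        simp
    · exact hint.integrable_indicator
        ((isOpen_lt continuous_const Complex.continuous_im).inter hVo).measurableSet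
    · exact Set.indicator_nonneg fun w _ ↦ by positivity
    -- Where u = f - H > 0, H ≥ 0 gives 0 < u ≤ f, so Ψ/y ≤ (u/√y)²/y ≤ f²/y².
    · intro w hw
      by_cases hwV : w ∈ V
      · rw [Set.indicator_of_mem (show w ∈ {w : ℂ | 0 < w.im ∧ R < ‖w‖} from ⟨hw, hwV⟩)]
        rcases le_or_gt (u w) 0 with h | h
        · rw [hule w h, zero_div]
          positivity
        · have h1 : Ψ w ≤ u w ^ 2 * (1 / w.im) := by
            rw [(hΨV w hwV).eq_of_nhds, ← exp_neg_half_log_sq hw, ← mul_pow]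
            exact penalty_le_sq (mul_nonneg h.le (Real.exp_pos _).le)
          have h2 : u w ^ 2 ≤ f w ^ 2 := by
            apply pow_le_pow_left₀ h.le
            simp only [hu]
            linarith [hH0 w]
          rw [div_le_div_iff₀ hw (by positivity)]
          have h3 : Ψ w * w.im ≤ f w ^ 2 := by
            rw [mul_one_div, le_div_iff₀ hw] at h1
            linarith
          nlinarith
      · rw [(hΨnV w hw hwV).eq_of_nhds, zero_div]
        exact Set.indicator_nonneg (fun w _ ↦ by positivity) _
  by_contra! hlt
  have : 0 < Ψ z := by
    rw [(hΨV z hzR).eq_of_nhds]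
    apply penalty_pos
    apply mul_pos _ (Real.exp_pos _)
    simp only [hu]
    linarith
  linarith

theorem norm_eq_sqrt_re_im (z : ℂ) : ‖z‖ = √(z.re ^ 2 + z.im ^ 2) := by
  rw [← Real.sqrt_sq (norm_nonneg z), ← Complex.normSq_eq_norm_sq, Complex.normSq_apply]
  congr 1
  ring

open MeasureTheory in
/-- The decay of real square integrable eigenfunctions near infinity. -/
theorem exists_abs_le_rpow {s R : ℝ} (hs : 1 / 2 < s) (hR : 0 < R) {f : ℂ → ℝ}
    (hf : ∀ z : ℂ, 0 < z.im → ContDiffAt ℝ 2 f z)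
    (heq : ∀ z : ℂ, 0 < z.im → z.im ^ 2 * Laplacian.laplacian f z = -(s * (1 - s)) * f z)
    (hint : IntegrableOn (fun z ↦ f z ^ 2 / z.im ^ 2) {z : ℂ | 0 < z.im ∧ R < ‖z‖}) :
    ∃ C : ℝ, ∀ z : ℂ, 0 < z.im → 4 * R < ‖z‖ →
      |f z| ≤ C * (z.im / (z.re ^ 2 + z.im ^ 2)) ^ s := by
  obtain ⟨M, hM0, hM⟩ := exists_abs_le_of_eigen hR hf heq hint
  have hs0 : 0 < s := by linarith
  have hl : s * (1 - s) < 1 / 4 := by nlinarith [sq_pos_of_pos (show 0 < s - 1 / 2 by linarith)]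
  -- The comparison circle has radius 2R, where f is bounded by `M`, and `c` is the lower bound of
  -- the two barriers on it; the 1 in `A` makes the inequality there strict.
  set c := (1 / (2 * (2 * R))) ^ s with hc
  have hc0 : 0 < c := Real.rpow_pos_of_pos (by positivity) _
  set A := (M + 1) / c with hA
  have hA0 : 0 < A := by positivity
  set H : ℂ → ℝ := fun z ↦ A * (barrier s (2 * R) z + barrier s (-(2 * R)) z) with hH
  have hHJ : ∀ z : ℂ, 0 < z.im → Jet H z _ _ _ := fun z hz ↦
    ((Jet.of_contDiffAt (laplacian_barrier_le (s := s) (b := 2 * R) hz).1).add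
      (Jet.of_contDiffAt (laplacian_barrier_le (s := s) (b := -(2 * R)) hz).1)).const_mul A
  have hHle : ∀ z : ℂ, 0 < z.im → z.im ^ 2 * Laplacian.laplacian H z ≤ -(s * (1 - s)) * H z := by
    intro z hz
    rw [(hHJ z hz).lap]
    have h1 := (laplacian_barrier_le (s := s) (b := 2 * R) hz).2
    have h2 := (laplacian_barrier_le (s := s) (b := -(2 * R)) hz).2
    have h3 := mul_le_mul_of_nonneg_left (add_le_add h1 h2) hA0.le
    simp only [hH]
    linarith
  have hH0 : ∀ z, 0 ≤ H z := fun z ↦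
    mul_nonneg hA0.le (add_nonneg (barrier_pos _ _ _).le (barrier_pos _ _ _).le)
  have hcirc : ∀ z : ℂ, 0 < z.im → ‖z‖ = 2 * R → |f z| < H z := by
    intro z hz hn
    have h1 := hM z hz hn.ge
    have h2 : c ≤ barrier s (2 * R) z + barrier s (-(2 * R)) z := by
      refine le_barrier_add_barrier hs0 (by positivity) hz ?_
      rw [← hn, ← Complex.normSq_eq_norm_sq, Complex.normSq_apply]
      ring
    have h3 := mul_le_mul_of_nonneg_left h2 hA0.le
    have h4 : A * c = M + 1 := div_mul_cancel₀ _ hc0.ne'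
    simp only [hH]
    linarith
  have hint' : IntegrableOn (fun z ↦ f z ^ 2 / z.im ^ 2) {z : ℂ | 0 < z.im ∧ 2 * R < ‖z‖} :=
    hint.mono_set fun z hz ↦ ⟨hz.1, by linarith [hz.2]⟩
  refine ⟨A * (2 * 2 ^ s), fun z hz hn ↦ ?_⟩
  have hn2 : 2 * R < ‖z‖ := by linarith
  have h1 : f z ≤ H z := le_of_le_on_circle hl hf (fun z hz ↦ (hHJ z hz).contDiffAt) heq hHle hH0
    (fun z hz hn ↦ (le_abs_self _).trans_lt (hcirc z hz hn)) hint' hz hn2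
  have hnegJ : ∀ z : ℂ, 0 < z.im → Jet (fun z ↦ -1 * f z) z _ _ _ := fun z hz ↦
    (Jet.of_contDiffAt (hf z hz)).const_mul (-1)
  have h2 : -1 * f z ≤ H z := le_of_le_on_circle hl (f := fun z ↦ -1 * f z)
    (fun z hz ↦ (hnegJ z hz).contDiffAt) (fun z hz ↦ (hHJ z hz).contDiffAt)
    (fun z hz ↦ by
      rw [(hnegJ z hz).lap]
      linear_combination (-1 : ℝ) * heq z hz) hHle hH0
    (fun z hz hn ↦ lt_of_le_of_lt (by linarith [neg_abs_le (f z)]) (hcirc z hz hn))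
    (by simpa using hint') hz hn2
  have hn4 : 2 * (2 * R) ≤ √(z.re ^ 2 + z.im ^ 2) := by
    rw [← norm_eq_sqrt_re_im]
    linarith
  have b1 := barrier_le (s := s) (b := 2 * R) hs0 (abs_of_pos (by positivity)) hz hn4
  have b2 := barrier_le (s := s) (b := -(2 * R)) hs0
    (by rw [abs_neg, abs_of_pos (by positivity)]) hz hn4
  have h3 : H z ≤ A * (2 * 2 ^ s) * (z.im / (z.re ^ 2 + z.im ^ 2)) ^ s := by
    simp only [hH]
    rw [mul_assoc]
    apply mul_le_mul_of_nonneg_left _ hA0.le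
    linarith
  rw [abs_le]
  constructor <;> linarith

open MeasureTheory in
-- The eigenvalue is real, so real and imaginary parts of φ satisfy the same equation and inherit
-- the integrability.
theorem exists_norm_le_rpow {Γ : Subgroup SL(2, ℝ)} {φ : ℍ → ℂ} {s R : ℝ} (hs : 1 / 2 < s)
    (hR : 0 < R) (hφ : IsEigenfunction Γ φ (s * (1 - s)))
    (hint : IntegrableOn (fun w : ℂ ↦ ‖φ (UpperHalfPlane.ofComplex w)‖ ^ 2 / w.im ^ 2)
      {w : ℂ | 0 < w.im ∧ R < ‖w‖}) :
    ∃ C : ℝ, ∀ z : ℍ, 4 * R < ‖(z : ℂ)‖ → ‖φ z‖ ≤ C * (z.im / (z.re ^ 2 + z.im ^ 2)) ^ s := by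
  set ψ : ℂ → ℂ := fun w ↦ φ (UpperHalfPlane.ofComplex w) with hψ
  have hU : IsOpen {z : ℂ | 0 < z.im} := isOpen_lt continuous_const Complex.continuous_im
  have hψc : ∀ z : ℂ, 0 < z.im → ContDiffAt ℝ 2 ψ z := fun z hz ↦
    hφ.contDiff.contDiffAt (hU.mem_nhds hz)
  have hψeq : ∀ z : ℂ, 0 < z.im →
      ((z.im ^ 2 : ℝ) : ℂ) * Laplacian.laplacian ψ z = ((-(s * (1 - s)) : ℝ) : ℂ) * ψ z := by
    intro z hz
    have h := hφ.eigen ⟨z, hz⟩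
    rw [hypLaplacian] at h
    have e : ψ z = φ ⟨z, hz⟩ := by
      simp only [hψ]
      rw [UpperHalfPlane.ofComplex_apply_of_im_pos hz]
    rw [e]
    have e2 : (⟨z, hz⟩ : ℍ).im = z.im := rfl
    rw [e2] at h
    push_cast at h ⊢
    linear_combination (-1 : ℂ) * h
  have hVm : MeasurableSet {w : ℂ | 0 < w.im ∧ R < ‖w‖} :=
    (hU.inter (isOpen_lt continuous_const continuous_norm)).measurableSet
  have key : ∀ L : ℂ →L[ℝ] ℝ, (∀ (a : ℝ) (w : ℂ), L (a * w) = a * L w) → (∀ w, |L w| ≤ ‖w‖) →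
      ∃ C : ℝ, ∀ z : ℂ, 0 < z.im → 4 * R < ‖z‖ →
        |L (ψ z)| ≤ C * (z.im / (z.re ^ 2 + z.im ^ 2)) ^ s := by
    intro L hL hLn
    have hc : ∀ z : ℂ, 0 < z.im → ContDiffAt ℝ 2 (fun w ↦ L (ψ w)) z := fun z hz ↦
      L.contDiff.contDiffAt.comp z (hψc z hz)
    refine exists_abs_le_rpow hs hR hc ?_ ?_
    · intro z hz
      have h1 : Laplacian.laplacian (fun w ↦ L (ψ w)) z = L (Laplacian.laplacian ψ z) :=
        (hψc z hz).laplacian_CLM_comp_left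
      rw [h1, ← hL, hψeq z hz, hL]
    · refine Integrable.mono' hint ?_ ?_
      · refine ContinuousOn.aestronglyMeasurable (fun z hz ↦ ?_) hVm
        exact (((hc z hz.1).continuousAt.pow 2).div (Complex.continuous_im.continuousAt.pow 2)
          (pow_ne_zero 2 (ne_of_gt hz.1))).continuousWithinAt
      · filter_upwards with z
        rw [Real.norm_of_nonneg (by positivity)]
        apply div_le_div_of_nonneg_right _ (by positivity)
        rw [← sq_abs (L (ψ z))]
        exact pow_le_pow_left₀ (abs_nonneg _) (hLn _) 2
  obtain ⟨C₁, h1⟩ := key Complex.reCLM (fun a w ↦ by simp) Complex.abs_re_le_norm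
  obtain ⟨C₂, h2⟩ := key Complex.imCLM (fun a w ↦ by simp) Complex.abs_im_le_norm
  refine ⟨C₁ + C₂, fun z hz ↦ ?_⟩
  have e : ψ z = φ z := by simp [hψ]
  have h3 := h1 z z.im_pos hz
  have h4 := h2 z z.im_pos hz
  rw [e] at h3 h4
  have h5 := Complex.norm_le_abs_re_add_abs_im (φ z)
  simp only [Complex.reCLM_apply, Complex.imCLM_apply, UpperHalfPlane.coe_re,
    UpperHalfPlane.coe_im] at h3 h4
  rw [add_mul]
  linarith

theorem aMat_apply (y : ℝ) (hy : 0 < y) : aMat y hy 0 0 = √y ∧ aMat y hy 0 1 = 0 ∧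
    aMat y hy 1 0 = 0 ∧ aMat y hy 1 1 = 1 / √y :=
  ⟨rfl, rfl, rfl, rfl⟩

theorem coe_nMat_mul_aMat_smul_I (x y : ℝ) (hy : 0 < y) :
    (((nMat x * aMat y hy) • UpperHalfPlane.I : ℍ) : ℂ) = ⟨x, y⟩ := by
  obtain ⟨n1, n2, n3, n4⟩ := nMat_apply x
  obtain ⟨a1, a2, a3, a4⟩ := aMat_apply y hy
  have hs : (√y : ℂ) ≠ 0 := by exact_mod_cast (Real.sqrt_pos.2 hy).ne'
  have hsq : (√y : ℂ) ^ 2 = y := by exact_mod_cast Real.sq_sqrt hy.le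
  rw [coe_smul_I, SL2_mul_apply, SL2_mul_apply, SL2_mul_apply, SL2_mul_apply, n1, n2, n3, n4, a1,
    a2, a3, a4]
  have e : (⟨x, y⟩ : ℂ) = x + y * Complex.I := by
    apply Complex.ext <;> simp
  rw [e, ← hsq]
  push_cast
  field_simp
  ring

end HorocycleBound

theorem mainTheorem8
    (Γ : Subgroup SL(2, ℝ)) [DiscreteTopology Γ] (hfg : Γ.FG)
    (hδ : 1 / 2 < HorocycleBound.criticalExponent Γ)
    (F : Set ℍ) (hF : HorocycleBound.IsFundDomain Γ F)
    (hvol : MeasureTheory.volume F = ⊤)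
    (hclosed : HorocycleBound.HorocycleClosed Γ)
    (hinf : HorocycleBound.HorocycleInfinite Γ)
    (s : ℝ) (hs : 1 / 2 < s)
    (φ : ℍ → ℂ)
    (hφ : HorocycleBound.IsEigenfunction Γ φ (s * (1 - s)))
    (hL2 : MeasureTheory.MemLp φ 2 (MeasureTheory.volume.restrict F)) :
    ∃ C x₀ y₀ : ℝ, 0 < x₀ ∧ 0 < y₀ ∧ y₀ < 1 ∧
      ∀ (x y : ℝ) (hy : 0 < y), x₀ < |x| → y < y₀ →
        ‖φ ((HorocycleBound.nMat x * HorocycleBound.aMat y hy) • UpperHalfPlane.I)‖ ≤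
          C * (y / (x ^ 2 + y ^ 2)) ^ s := by
  obtain ⟨R, hR1, hR⟩ := HorocycleBound.exists_radius Γ hfg hδ hclosed hinf
  have hR0 : 0 < R := by linarith
  obtain ⟨C, hC⟩ := HorocycleBound.exists_norm_le_rpow hs hR0 hφ
    (HorocycleBound.integrableOn_outer hF hφ hL2 hR)
  -- The estimate holds for all |z| > 4R, which |x| > 4R guarantees; y₀ = 1/2 is an arbitrary
  -- choice.
  refine ⟨C, 4 * R, 1 / 2, by positivity, by norm_num, by norm_num, fun x y hy hx _ ↦ ?_⟩
  have h := HorocycleBound.coe_nMat_mul_aMat_smul_I x y hy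
  have hre := congrArg Complex.re h
  have him := congrArg Complex.im h
  rw [UpperHalfPlane.coe_re] at hre
  rw [UpperHalfPlane.coe_im] at him
  have hb := hC ((HorocycleBound.nMat x * HorocycleBound.aMat y hy) • UpperHalfPlane.I) (by
    refine hx.trans_le ?_
    have := Complex.abs_re_le_norm
      (((HorocycleBound.nMat x * HorocycleBound.aMat y hy) • UpperHalfPlane.I : ℍ) : ℂ)
    rwa [UpperHalfPlane.coe_re, hre] at this)
  rwa [hre, him] at hb
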